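/- Let $\Phi$ be a wireless network of $v$ nodes at distinct points of the Euclidean plane with transmission power $P>0$, noise density $N_0>0$, path loss factor $\alpha>0$ and thresholds $0<\gamma_i<\gamma_c$. Its communication graph $\mathcal G_c$ has the directed edges $j\to k$ and $k\to j$ for all nodes $j\ne k$ with $D(j,k)\le R_c:=(P/(N_0\gamma_c))^{1/\alpha}$, where $D$ is the Euclidean distance. Let $e$ be the number of directed edges of $\mathcal G_c$, and let $\theta$ be its thickness, that is, the minimum number of planar graphs into which the undirected graph underlying $\mathcal G_c$ can be partitioned. Assume $e\ge 1$. The algorithm ConflictFreeLinkSchedule colours the edges of $\mathcal G_c$ with colours $1,2,\dots$ as follows. Phase 1: label the vertices by a uniformly random permutation of $1,\dots,v$. Phase 2: decompose the undirected graph into forests by successive breadth first searches, each performed on the edges left over by the previous ones until no edge is left, and replace each rooted forest by an out-oriented graph (its edges directed away from the roots) followed by an in-oriented graph (its edges directed toward the roots). This gives oriented graphs $T_1,\dots,T_k$. Phase 3: for $i=1,\dots,k$ and $j=1,\dots,v$ let $x$ be the edge of $T_i$ into (if $T_i$ is out-oriented) or out of (if $T_i$ is in-oriented) the vertex with label $j$,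 if there is one. Among the colours used so far that occur on no edge sharing a vertex with $x$, give $x$ the smallest colour $r$ such that, for the set $S$ consisting of $x$ and all edges of colour $r$, every edge $t\to u$ in $S$ satisfies $$\frac{P/D(t,u)^{\alpha}}{N_0+\sum_{(t'\to u')\in S\setminus\{t\to u\}}P/D(t',u)^{\alpha}}\ \ge\ \gamma_c .$$ If there is no such colour, give $x$ a new colour, namely the number of colours used so far plus one. Then the running time of ConflictFreeLinkSchedule is $O(ev\log v+ev\theta)$. Precisely: on a random access machine with registers and arrays of natural and of real numbers, on which each arithmetic operation (addition, subtraction and comparison of natural numbers; the four operations, powers and comparison of real numbers), each memory access and each uniform random draw from a set $\{0,\dots,n\}$ costs one unit of time, there are one program and one absolute constant $c$ such that for every network with $e\ge1$, given by its parameters, the coordinates of its nodes and a list of the directed edges of $\mathcal G_c$ in any order, and for all outcomes of the random draws, the program halts after at most $c\,(ev\log v+ev\theta)$ units of time with a vertex labelling and the colouring that the algorithm produces from this labelling and some successive breadth first search decomposition; and the labelling is uniformly distributed over all $v!$ labellings. -/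

import Mathlib

noncomputable section

namespace STDMA

/-! ### Planarity and thickness -/

/-- A crossing-free drawing of `G` in the Euclidean plane: vertices are distinct points, the edge
`s(u, v)` is drawn as a simple arc from the point of `u` to the point of `v`, an arc passes through
no vertex other than its ends, and two different arcs meet only in common ends. -/
structure PlaneDrawing {V : Type*} (G : SimpleGraph V) where
  pt : V → EuclideanSpace ℝ (Fin 2)
  pt_injective : Function.Injective pt
  arc : Sym2 V → Set (EuclideanSpace ℝ (Fin 2))
  isArc : ∀ u v, G.Adj u v →
    ∃ f : Path (pt u) (pt v), Function.Injective f ∧ Set.range f = arc s(u, v)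
  vertex_of_mem_arc : ∀ e ∈ G.edgeSet, ∀ w, pt w ∈ arc e → w ∈ e
  arc_inter : ∀ e ∈ G.edgeSet, ∀ e' ∈ G.edgeSet, e ≠ e' →
    arc e ∩ arc e' ⊆ {p | ∃ w, w ∈ e ∧ w ∈ e' ∧ p = pt w}

def IsPlanar {V : Type*} (G : SimpleGraph V) : Prop := Nonempty (PlaneDrawing G)

/-- The minimum number of planar graphs into which (the edge set of) `G` can be partitioned. -/
def thickness {V : Type*} (G : SimpleGraph V) : ℕ :=
  sInf {t | ∃ H : Fin t → SimpleGraph V,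
    (∀ i, IsPlanar (H i)) ∧ Pairwise (fun i j => Disjoint (H i) (H j)) ∧ ⨆ i, H i = G}

/-! ### The physical network and its communication graph -/

/-- A network of `N` nodes in the plane with common transmission power `P`, communication
threshold `γc`, interference threshold `γi`, path loss factor `α` and noise density `N₀`. -/
structure Network (N : ℕ) where
  pos : Fin N → EuclideanSpace ℝ (Fin 2)
  P : ℝ
  γc : ℝ
  γi : ℝ
  α : ℝ
  N₀ : ℝ
  pos_injective : Function.Injective pos
  P_pos : 0 < P
  γi_pos : 0 < γi
  γi_lt_γc : γi < γc
  α_pos : 0 < α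
  N₀_pos : 0 < N₀

/-- A link `(t, r)` with transmitter `t` and receiver `r`. -/
abbrev Link (N : ℕ) := Fin N × Fin N

namespace Network

variable {N : ℕ} (Φ : Network N)

/-- Communication range. -/
def Rc : ℝ := (Φ.P / (Φ.N₀ * Φ.γc)) ^ (1 / Φ.α)

/-- The undirected equivalent of the communication graph. -/
def graph : SimpleGraph (Fin N) where
  Adj j k := j ≠ k ∧ dist (Φ.pos j) (Φ.pos k) ≤ Φ.Rc
  symm := ⟨fun _ _ h => ⟨h.1.symm, by rw [dist_comm]; exact h.2⟩⟩
  loopless := ⟨fun _ h => h.1 rfl⟩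

open Classical in
/-- The directed communication edges; both orientations of each adjacent pair occur. -/
def commEdges : Finset (Link N) := Finset.univ.filter fun x => Φ.graph.Adj x.1 x.2

/-- Power received at node `r` from node `t`. -/
def power (t r : Fin N) : ℝ := Φ.P / dist (Φ.pos t) (Φ.pos r) ^ Φ.α

/-- SINR at the receiver of the link `h` when the links in `S` are active simultaneously. -/
def SINR (S : Finset (Link N)) (h : Link N) : ℝ :=
  Φ.power h.1 h.2 / (Φ.N₀ + ∑ g ∈ S.erase h, Φ.power g.1 h.2)

end Network

/-! ### Phase 2: successive breadth first searches -/

/-- `F`, rooted in every component by `root`, is a breadth first search forest of `R`: it is a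
forest in `R` with one root per component of `R`, and it joins each vertex to the root of its
component by a path which is a shortest path in `R`. -/
structure IsBFSForest {V : Type*} (R F : SimpleGraph V) (root : V → V) : Prop where
  le : F ≤ R
  acyclic : F.IsAcyclic
  root_eq : ∀ u v, R.Reachable u v → root u = root v
  reachable_root : ∀ u, F.Reachable (root u) u
  dist_eq : ∀ u, F.dist (root u) u = R.dist (root u) u

/-- What is left of `G` after the removal of the first `i` forests. -/
def residual {V : Type*} (G : SimpleGraph V) (F : ℕ → SimpleGraph V) : ℕ → SimpleGraph V
  | 0 => G
  | i + 1 => residual G F i \ F i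

/-- A decomposition of `G` into `m` forests by successive breadth first searches, each performed on
the edges left over by the previous ones, until no edge is left. -/
structure BFSDecomposition {V : Type*} (G : SimpleGraph V) where
  m : ℕ
  F : ℕ → SimpleGraph V
  root : ℕ → V → V
  isBFSForest : ∀ i < m, IsBFSForest (residual G F i) (F i) (root i)
  residual_ne_bot : ∀ i < m, residual G F i ≠ ⊥
  residual_eq_bot : residual G F m = ⊥

namespace BFSDecomposition

variable {V : Type*} {G : SimpleGraph V} (D : BFSDecomposition G)

/-- The number `k` of oriented graphs: each undirected forest gives two. -/
def k : ℕ := 2 * D.m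

/-- `D.oriented i x`: the directed edge `x` belongs to the oriented graph `T i`, for `i < D.k`.
The forest `F i` gives the out-oriented graph `T (2 * i)` of its edges pointing away from the
root, and the in-oriented graph `T (2 * i + 1)` of its edges pointing toward the root. -/
def oriented (i : ℕ) (x : V × V) : Prop :=
  (D.F (i / 2)).Adj x.1 x.2 ∧
    if Even i then
      (D.F (i / 2)).dist (D.root (i / 2) x.2) x.2 =
        (D.F (i / 2)).dist (D.root (i / 2) x.2) x.1 + 1
    else
      (D.F (i / 2)).dist (D.root (i / 2) x.1) x.1 =
        (D.F (i / 2)).dist (D.root (i / 2) x.1) x.2 + 1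

/-- `x` is the edge of `T i` associated with the vertex `u`: the edge into `u` if `T i` is
out-oriented, the edge out of `u` if `T i` is in-oriented. -/
def IsEdgeOf (i : ℕ) (u : V) (x : V × V) : Prop :=
  D.oriented i x ∧ if Even i then x.2 = u else x.1 = u

end BFSDecomposition

/-! ### Phase 3: colouring -/

/-- A partial colouring of links by `1, 2, …`; the value `0` means "not coloured". -/
abbrev Coloring (N : ℕ) := Link N → ℕ

/-- Primary edge conflict: the ends of the two links are not all distinct. -/
def PrimaryConflict {N : ℕ} (x h : Link N) : Prop :=
  x.1 = h.1 ∨ x.1 = h.2 ∨ x.2 = h.1 ∨ x.2 = h.2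

variable {N : ℕ}

open Classical in
/-- The set of existing colours. -/
def existing (C : Coloring N) : Finset ℕ := (Finset.univ.filter fun h => C h ≠ 0).image C

open Classical in
/-- The colours of the coloured links which have a primary conflict with `x`. -/
def conflicting (C : Coloring N) (x : Link N) : Finset ℕ :=
  (Finset.univ.filter fun h => C h ≠ 0 ∧ PrimaryConflict x h).image C

open Classical in
/-- If `x` gets the colour `r`, then the SINR at all receivers of colour `r` is sufficient. -/
def SINRCompliant (Φ : Network N) (C : Coloring N) (x : Link N) (r : ℕ) : Prop :=
  ∀ h ∈ insert x (Finset.univ.filter fun h => C h = r),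
    Φ.γc ≤ Φ.SINR (insert x (Finset.univ.filter fun h => C h = r)) h

open Classical in
def firstConflictFreeColor (Φ : Network N) (C : Coloring N) (x : Link N) : ℕ :=
  if h : ((existing C \ conflicting C x).filter (SINRCompliant Φ C x)).Nonempty then
    ((existing C \ conflicting C x).filter (SINRCompliant Φ C x)).min' h
  else (existing C).card + 1

open Classical in
/-- One pass of the inner loop: colour the edge of `T i` associated with the vertex of label `j`,
if there is one. -/
def colorStep (Φ : Network N) (L : Equiv.Perm (Fin N)) (D : BFSDecomposition Φ.graph)
    (C : Coloring N) (p : ℕ × Fin N) : Coloring N :=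
  if h : ∃ x, D.IsEdgeOf p.1 (L.symm p.2) x then
    Function.update C h.choose (firstConflictFreeColor Φ C h.choose)
  else C

/-- The colouring produced by ConflictFreeLinkSchedule from the labelling `L` (Phase 1) and the
decomposition `D` (Phase 2): the oriented graphs are scanned one after the other, and in each of
them the vertices in increasing order of their labels. -/
def conflictFreeLinkSchedule (Φ : Network N) (L : Equiv.Perm (Fin N))
    (D : BFSDecomposition Φ.graph) : Coloring N :=
  ((List.range D.k).flatMap fun i => (List.finRange N).map fun j => (i, j)).foldl
    (colorStep Φ L D) fun _ => 0

/-! ### The machine model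

A randomized real random access machine.  There are registers and arrays of two sorts: natural
numbers (with addition, truncated subtraction and comparison) and real numbers (with the four
arithmetic operations, powers and comparison).  There is no conversion between the two sorts.
A number can be drawn uniformly from `{0, …, n}`.  Each operation costs one unit of time. -/

inductive NExp
  | const (n : ℕ)
  | reg (i : ℕ)
  | get (a : ℕ) (idx : NExp)
  | add (x y : NExp)
  | sub (x y : NExp)

inductive RExp
  | const (n : ℕ)
  | reg (i : ℕ)
  | get (a : ℕ) (idx : NExp)
  | add (x y : RExp)
  | sub (x y : RExp)
  | mul (x y : RExp)
  | div (x y : RExp)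
  | pow (x y : RExp)

inductive Test
  | nle (x y : NExp)
  | rle (x y : RExp)
  | not (b : Test)
  | and (b c : Test)

inductive Cmd
  | skip
  | nset (i : ℕ) (x : NExp)
  | rset (i : ℕ) (x : RExp)
  | nput (a : ℕ) (idx x : NExp)
  | rput (a : ℕ) (idx : NExp) (x : RExp)
  | draw (i : ℕ) (bound : NExp)
  | seq (p q : Cmd)
  | ite (b : Test) (p q : Cmd)
  | while (b : Test) (p : Cmd)

/-- Contents of the memory, and the number of random draws made so far. -/
@[ext] structure State where
  nreg : ℕ → ℕ
  rreg : ℕ → ℝ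
  narr : ℕ → ℕ → ℕ
  rarr : ℕ → ℕ → ℝ
  draws : ℕ

namespace NExp

def eval (s : State) : NExp → ℕ
  | const n => n
  | reg i => s.nreg i
  | get a idx => s.narr a (idx.eval s)
  | add x y => x.eval s + y.eval s
  | sub x y => x.eval s - y.eval s

/-- The time to evaluate an expression. -/
def cost : NExp → ℕ
  | const _ => 1
  | reg _ => 1
  | get _ idx => idx.cost + 1
  | add x y => x.cost + y.cost + 1
  | sub x y => x.cost + y.cost + 1

end NExp

namespace RExp

def eval (s : State) : RExp → ℝ
  | const n => n
  | reg i => s.rreg i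
  | get a idx => s.rarr a (idx.eval s)
  | add x y => x.eval s + y.eval s
  | sub x y => x.eval s - y.eval s
  | mul x y => x.eval s * y.eval s
  | div x y => x.eval s / y.eval s
  | pow x y => x.eval s ^ y.eval s

def cost : RExp → ℕ
  | const _ => 1
  | reg _ => 1
  | get _ idx => idx.cost + 1
  | add x y => x.cost + y.cost + 1
  | sub x y => x.cost + y.cost + 1
  | mul x y => x.cost + y.cost + 1
  | div x y => x.cost + y.cost + 1
  | pow x y => x.cost + y.cost + 1

end RExp

namespace Test

def eval (s : State) : Test → Prop
  | nle x y => x.eval s ≤ y.eval s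
  | rle x y => x.eval s ≤ y.eval s
  | not b => ¬ b.eval s
  | and b c => b.eval s ∧ c.eval s

def cost : Test → ℕ
  | nle x y => x.cost + y.cost + 1
  | rle x y => x.cost + y.cost + 1
  | not b => b.cost + 1
  | and b c => b.cost + c.cost + 1

end Test

/-- The source of randomness: `ω (i, n) ∈ {0, …, n}` is the outcome of the `i`-th draw if that is a
draw from `{0, …, n}`. -/
abbrev Tape := (p : ℕ × ℕ) → Fin (p.2 + 1)

/-- All the entries of the tape are independent and uniformly distributed. -/
def tapeMeasure : MeasureTheory.Measure Tape :=
  MeasureTheory.Measure.infinitePi fun p : ℕ × ℕ =>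
    (PMF.uniformOfFintype (Fin (p.2 + 1))).toMeasure

/-- `Exec ω p s t s'`: started in the state `s`, and with the random outcomes `ω`, the program `p`
halts in the state `s'` after `t` units of time. -/
inductive Exec (ω : Tape) : Cmd → State → ℕ → State → Prop
  | skip (s : State) : Exec ω Cmd.skip s 1 s
  | nset (i : ℕ) (x : NExp) (s : State) :
      Exec ω (Cmd.nset i x) s (x.cost + 1)
        { s with nreg := Function.update s.nreg i (x.eval s) }
  | rset (i : ℕ) (x : RExp) (s : State) :
      Exec ω (Cmd.rset i x) s (x.cost + 1)
        { s with rreg := Function.update s.rreg i (x.eval s) }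
  | nput (a : ℕ) (idx x : NExp) (s : State) :
      Exec ω (Cmd.nput a idx x) s (idx.cost + x.cost + 1)
        { s with narr := Function.update s.narr a
                  (Function.update (s.narr a) (idx.eval s) (x.eval s)) }
  | rput (a : ℕ) (idx : NExp) (x : RExp) (s : State) :
      Exec ω (Cmd.rput a idx x) s (idx.cost + x.cost + 1)
        { s with rarr := Function.update s.rarr a
                  (Function.update (s.rarr a) (idx.eval s) (x.eval s)) }
  | draw (i : ℕ) (bound : NExp) (s : State) :
      Exec ω (Cmd.draw i bound) s (bound.cost + 1)
        { s with nreg := Function.update s.nreg i (ω (s.draws, bound.eval s)).val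
                 draws := s.draws + 1 }
  | seq {p q : Cmd} {s s' s'' : State} {t t' : ℕ} (hp : Exec ω p s t s') (hq : Exec ω q s' t' s'') :
      Exec ω (Cmd.seq p q) s (t + t') s''
  | ite_true {b : Test} {p q : Cmd} {s s' : State} {t : ℕ} (hb : b.eval s) (hp : Exec ω p s t s') :
      Exec ω (Cmd.ite b p q) s (b.cost + t) s'
  | ite_false {b : Test} {p q : Cmd} {s s' : State} {t : ℕ} (hb : ¬ b.eval s)
      (hq : Exec ω q s t s') : Exec ω (Cmd.ite b p q) s (b.cost + t) s'
  | while_true {b : Test} {p : Cmd} {s s' s'' : State} {t t' : ℕ} (hb : b.eval s)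
      (hp : Exec ω p s t s') (hw : Exec ω (Cmd.while b p) s' t' s'') :
      Exec ω (Cmd.while b p) s (b.cost + t + t') s''
  | while_false {b : Test} {p : Cmd} {s : State} (hb : ¬ b.eval s) :
      Exec ω (Cmd.while b p) s b.cost s

/-- The machine is deterministic once the random outcomes are fixed. -/
theorem Exec.unique {ω : Tape} {p : Cmd} {s s₁ s₂ : State} {t₁ t₂ : ℕ}
    (h₁ : Exec ω p s t₁ s₁) (h₂ : Exec ω p s t₂ s₂) : t₁ = t₂ ∧ s₁ = s₂ := by
  induction h₁ generalizing t₂ s₂ with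
  | skip => cases h₂; exact ⟨rfl, rfl⟩
  | nset => cases h₂; exact ⟨rfl, rfl⟩
  | rset => cases h₂; exact ⟨rfl, rfl⟩
  | nput => cases h₂; exact ⟨rfl, rfl⟩
  | rput => cases h₂; exact ⟨rfl, rfl⟩
  | draw => cases h₂; exact ⟨rfl, rfl⟩
  | seq _ _ ihp ihq =>
    cases h₂ with
    | seq hp' hq' =>
      obtain ⟨rfl, rfl⟩ := ihp hp'
      obtain ⟨rfl, rfl⟩ := ihq hq'
      exact ⟨rfl, rfl⟩
  | ite_true hb _ ih =>
    cases h₂ with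
    | ite_true _ hp' => obtain ⟨rfl, rfl⟩ := ih hp'; exact ⟨rfl, rfl⟩
    | ite_false hb' _ => exact absurd hb hb'
  | ite_false hb _ ih =>
    cases h₂ with
    | ite_true hb' _ => exact absurd hb' hb
    | ite_false _ hq' => obtain ⟨rfl, rfl⟩ := ih hq'; exact ⟨rfl, rfl⟩
  | while_true hb _ _ ihp ihw =>
    cases h₂ with
    | while_true _ hp' hw' =>
      obtain ⟨rfl, rfl⟩ := ihp hp'
      obtain ⟨rfl, rfl⟩ := ihw hw'
      exact ⟨rfl, rfl⟩
    | while_false hb' => exact absurd hb hb'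
  | while_false hb =>
    cases h₂ with
    | while_true hb' _ _ => exact absurd hb' hb
    | while_false _ => exact ⟨rfl, rfl⟩

/-! ### Input and output -/

/-- The initial state.  The network is given by the parameters and the coordinates of the nodes,
the communication graph by the list `ed` of its directed edges, in an arbitrary order.  All other
registers and array entries are `0`. -/
def input (Φ : Network N) (ed : Fin Φ.commEdges.card ≃ Φ.commEdges) : State where
  nreg i := if i = 0 then N else if i = 1 then Φ.commEdges.card else 0
  rreg i := if i = 0 then Φ.P else if i = 1 then Φ.γc else if i = 2 then Φ.γi
    else if i = 3 then Φ.α else if i = 4 then Φ.N₀ else 0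
  narr a i := if h : i < Φ.commEdges.card then
      if a = 0 then ((ed ⟨i, h⟩).1.1 : ℕ) else if a = 1 then ((ed ⟨i, h⟩).1.2 : ℕ) else 0
    else 0
  rarr a i := if h : i < N then
      if a = 0 then Φ.pos ⟨i, h⟩ 0 else if a = 1 then Φ.pos ⟨i, h⟩ 1 else 0
    else 0
  draws := 0

/-- Array `2` of naturals holds the labels, which are `1, …, N`. -/
def HasLabels (s : State) (L : Equiv.Perm (Fin N)) : Prop :=
  ∀ j : Fin N, s.narr 2 j = (L j : ℕ) + 1

/-- Array `3` of naturals holds the colours of the communication edges, in the order of `ed`. -/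
def HasColors (Φ : Network N) (ed : Fin Φ.commEdges.card ≃ Φ.commEdges) (s : State)
    (C : Coloring N) : Prop :=
  ∀ i : Fin Φ.commEdges.card, s.narr 3 i = C (ed i)

end STDMA

end

open STDMA

/-! The program is deliberately naive and runs in time O(e(v + e)). To colour one link it scans all
e links. It caches the interference at the receiver of every coloured link and accumulates, for each
colour, the power arriving at the new receiver, so the SINR conditions of all colours are checked in
O(e) altogether (`colorCmd_spec`). A breadth first search forest is grown edge by edge, each new
edge being found by a full scan (`bfsCmd_spec`). Every forest edge is coloured in both directions
right afterwards, so all scans are charged to freshly coloured links. The O(v) overhead of a round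
is charged to one of them too, since a round on a nonempty graph colours something
(`roundCmd_spec`).

Phases 2 and 3 are interleaved: after i rounds the uncoloured links are exactly the residual graph
of i searches. Colouring each forest as soon as it is found therefore gives the same schedule as
decomposing first (`Rounds.schedule_eq`, `mainLoop_spec`).

The thickness enters through e ≤ 32vθ, which turns the term e² into O(evθ); the term ev is O(ev log
v) because e ≥ 1 forces v ≥ 2 (`time_le`). The bound on e needs only that planar graphs have
linearly many edges. This is derived without Euler's formula. A graph of average degree at least 32
has a complete minor on five vertices, by Mader's contraction argument (`exists_completeMinor`). In
a plane drawing such a minor would give ten paths joining five points, where paths without a common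
endpoint are disjoint. That is impossible by a parity count of winding numbers
(`not_exists_pairwise_disjoint_paths`).

The labels come from an inside-out shuffle. Its v! equally likely sequences of choices correspond
bijectively to the permutations, which gives uniformity (`exists_shuffle_eq`,
`tapeMeasure_cylinder`). -/

noncomputable section

namespace STDMA

open unitInterval

/-! ### Continuous angles and the non-planarity of the complete graph on five vertices -/

/-- `θ` is a continuous choice of an angle of the function `g`. -/
def IsAngle {X : Type*} [TopologicalSpace X] (θ : X → ℝ) (g : X → ℂ) : Prop :=
  Continuous θ ∧ ∀ x, g x = ‖g x‖ * Complex.exp (θ x * Complex.I)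

/-- The normalised map to the circle lifts through the covering `Circle.exp`: first along one side
of the square, then over the whole square by homotopy lifting. -/
theorem exists_isAngle_square (g : C(I × I, ℂ)) (hg : ∀ x, g x ≠ 0) :
    ∃ θ : I × I → ℝ, IsAngle θ g := by
  have hn : ∀ x, (‖g x‖ : ℂ) ≠ 0 := fun x => by simpa using hg x
  let H : C(I × I, Circle) := ⟨fun x => ⟨g x / ‖g x‖, by
    rw [Submonoid.unitSphere]
    change _ ∈ Metric.sphere (0 : ℂ) 1
    simp [hg x]⟩, by
      refine Continuous.subtype_mk ?_ _
      exact (map_continuous g).div (Complex.continuous_ofReal.comp (map_continuous g).norm) hn⟩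
  have hc : Function.Surjective Circle.exp := fun z =>
    ⟨Complex.arg z, Circle.exp_arg z⟩
  obtain ⟨x₀, hx₀⟩ := hc (H (0, 0))
  let γ₀ : C(I, Circle) := H.comp ((ContinuousMap.const I 0).prodMk (ContinuousMap.id I))
  let f := Circle.isCoveringMap_exp.liftPath γ₀ x₀ hx₀.symm
  have hf : ∀ t, H (0, t) = Circle.exp (f t) := fun t =>
    (congr_fun (Circle.isCoveringMap_exp.liftPath_lifts γ₀ x₀ hx₀.symm) t).symm
  let θ := Circle.isCoveringMap_exp.liftHomotopy H f hf
  refine ⟨θ, map_continuous θ, fun x => ?_⟩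
  have h := congr_fun (Circle.isCoveringMap_exp.liftHomotopy_lifts H f hf) x
  have h' : Complex.exp (θ x * Complex.I) = g x / ‖g x‖ := by
    rw [← Circle.coe_exp]
    exact congrArg (Subtype.val) h
  rw [h']
  have := hn x
  field_simp

theorem exists_int_angle_eq_arg {z : ℂ} (hz : z ≠ 0) {x : ℝ}
    (h : z = ‖z‖ * Complex.exp (x * Complex.I)) : ∃ k : ℤ, x = z.arg + 2 * Real.pi * k := by
  have hn : (‖z‖ : ℂ) ≠ 0 := by simpa using hz
  have h2 : Complex.exp (x * Complex.I) = Complex.exp (z.arg * Complex.I) := by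
    have h3 := Complex.norm_mul_exp_arg_mul_I z
    exact mul_left_cancel₀ hn (h.symm.trans h3.symm)
  obtain ⟨k, hk⟩ := Complex.exp_eq_exp_iff_exists_int.1 h2
  refine ⟨k, ?_⟩
  have := congrArg Complex.im hk
  simp at this
  linarith

theorem IsAngle.sub_eq {θ θ' : I → ℝ} {g : I → ℂ} (hg : ∀ x, g x ≠ 0) (h : IsAngle θ g)
    (h' : IsAngle θ' g) : θ 1 - θ 0 = θ' 1 - θ' 0 := by
  have h1 : ∀ t, Circle.exp (θ t - θ' t) = 1 := by
    intro t
    have hn : (‖g t‖ : ℂ) ≠ 0 := by simpa using hg t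
    rw [Circle.exp_sub, div_eq_one]
    apply Circle.ext
    rw [Circle.coe_exp, Circle.coe_exp]
    exact mul_left_cancel₀ hn ((h.2 t).symm.trans (h'.2 t))
  have h2 := Circle.isCoveringMap_exp.const_of_comp (g := fun t => θ t - θ' t)
    (h.1.sub h'.1) (fun a a' => (h1 a).trans (h1 a').symm) 0 1
  linarith

/-- The point is that one integer serves every choice of angle: two choices differ by a constant, so
the total change is the same. If no continuous angle exists the claim is vacuous. -/
theorem exists_winding (g : I → ℂ) (hg : ∀ x, g x ≠ 0) :
    ∃ n : ℤ, ∀ θ, IsAngle θ g → θ 1 - θ 0 = (g 1).arg - (g 0).arg + 2 * Real.pi * n := by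
  by_cases h : ∃ θ, IsAngle θ g
  · obtain ⟨θ₀, h₀⟩ := h
    obtain ⟨k, hk⟩ := exists_int_angle_eq_arg (hg 0) (h₀.2 0)
    obtain ⟨l, hl⟩ := exists_int_angle_eq_arg (hg 1) (h₀.2 1)
    refine ⟨l - k, fun θ hθ => ?_⟩
    rw [hθ.sub_eq hg h₀, hk, hl]
    push_cast
    ring
  · exact ⟨0, fun θ hθ => (h ⟨θ, hθ⟩).elim⟩

theorem exists_int_arg_sub_arg_neg {z : ℂ} (hz : z ≠ 0) :
    ∃ k : ℤ, z.arg - (-z).arg = Real.pi * (2 * k + 1) := by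
  have h : -z = ‖-z‖ * Complex.exp ((z.arg + Real.pi : ℝ) * Complex.I) := by
    push_cast
    rw [add_mul, Complex.exp_add, Complex.exp_pi_mul_I, norm_neg, ← mul_assoc,
      Complex.norm_mul_exp_arg_mul_I]
    ring
  obtain ⟨k, hk⟩ := exists_int_angle_eq_arg (neg_ne_zero.2 hz) h
  refine ⟨k - 1, ?_⟩
  push_cast
  linarith

theorem IsAngle.neg {X : Type*} [TopologicalSpace X] {θ : X → ℝ} {g : X → ℂ} (h : IsAngle θ g) :
    IsAngle (fun x => θ x + Real.pi) (fun x => -g x) := by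
  refine ⟨h.1.add continuous_const, fun x => ?_⟩
  push_cast
  rw [add_mul, Complex.exp_add, Complex.exp_pi_mul_I, norm_neg, ← mul_assoc, ← h.2 x]
  ring

theorem IsAngle.comp {X Y : Type*} [TopologicalSpace X] [TopologicalSpace Y] {θ : X → ℝ}
    {g : X → ℂ} (h : IsAngle θ g) {f : Y → X} (hf : Continuous f) :
    IsAngle (fun y => θ (f y)) (fun y => g (f y)) :=
  ⟨h.1.comp hf, fun y => h.2 (f y)⟩

/-- Integers that count the turns of a path around a point satisfy a linear relation for any two
disjoint paths. -/
theorem exists_turns {ι : Type*} (p : ι → ℂ) (hp : Function.Injective p)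
    (γ : ∀ i j, Path (p i) (p j)) :
    ∃ (n : ι → ι → ι → ℤ) (x : ι → ι → ℤ), (∀ i j, i ≠ j → x i j + x j i = -1) ∧
      ∀ a b c d, a ≠ c → a ≠ d → b ≠ c → b ≠ d →
        Disjoint (Set.range (γ a b)) (Set.range (γ c d)) →
        x b c - x a c - x b d + x a d + n a b c - n a b d - n c d a + n c d b = 0 := by
  have hn : ∀ a b c, ∃ n : ℤ, (∀ t, γ a b t - p c ≠ 0) → ∀ θ, IsAngle θ (fun t => γ a b t - p c) →
      θ 1 - θ 0 = (p b - p c).arg - (p a - p c).arg + 2 * Real.pi * n := by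
    intro a b c
    by_cases h : ∀ t, γ a b t - p c ≠ 0
    · obtain ⟨n, hn⟩ := exists_winding _ h
      exact ⟨n, fun _ => by simpa using hn⟩
    · exact ⟨0, fun h' => (h h').elim⟩
  choose n hn using hn
  have hx : ∀ i j, ∃ k : ℤ, i ≠ j →
      (p i - p j).arg - (p j - p i).arg = Real.pi * (2 * k + 1) := by
    intro i j
    by_cases h : i = j
    · exact ⟨0, fun h' => (h' h).elim⟩
    · obtain ⟨k, hk⟩ := exists_int_arg_sub_arg_neg (sub_ne_zero.2 (hp.ne h))
      exact ⟨k, fun _ => by rwa [neg_sub] at hk⟩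
  choose x hx using hx
  refine ⟨n, x, fun i j h => ?_, fun a b c d hac had hbc hbd hdis => ?_⟩
  · have h1 := hx i j h
    have h2 := hx j i h.symm
    have : Real.pi * (2 * (x i j + x j i + 1)) = 0 := by linarith
    have h3 : (x i j : ℝ) + x j i + 1 = 0 := by
      simpa [Real.pi_ne_zero] using this
    have h4 : x i j + x j i + 1 = 0 := by exact_mod_cast h3
    omega
  · have hne : ∀ s t, γ a b s - γ c d t ≠ 0 := fun s t h =>
      Set.disjoint_left.1 hdis ⟨s, rfl⟩ ⟨t, (sub_eq_zero.1 h).symm⟩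
    -- Disjoint paths have a nowhere vanishing difference on the square of parameters. Its angle has
    -- total change zero around the boundary; the four sides give the winding of each path about the
    -- endpoints of the other.
    obtain ⟨θ, hθ⟩ := exists_isAngle_square
      ⟨fun y : I × I => γ a b y.1 - γ c d y.2, by fun_prop⟩ (fun y => hne y.1 y.2)
    have e1 := hn a b c (fun t => by simpa using hne t 0) _
      (by simpa using hθ.comp (f := fun t : I => (t, (0 : I))) (by fun_prop))
    have e2 := hn a b d (fun t => by simpa using hne t 1) _
      (by simpa using hθ.comp (f := fun t : I => (t, (1 : I))) (by fun_prop))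
    -- On this side and the next the difference is the negative of the path minus the point. Adding
    -- π to the angle repairs the sign and does not affect the total change.
    have e3 := hn c d a (fun t h => hne 0 t (by
        rw [Path.source, ← neg_sub, h, neg_zero])) _
      (by simpa using (hθ.comp (f := fun t : I => ((0 : I), t)) (by fun_prop)).neg)
    have e4 := hn c d b (fun t h => hne 1 t (by
        rw [Path.target, ← neg_sub, h, neg_zero])) _
      (by simpa using (hθ.comp (f := fun t : I => ((1 : I), t)) (by fun_prop)).neg)
    have h1 := hx b c hbc
    have h2 := hx a c hac
    have h3 := hx b d hbd
    have h4 := hx a d had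
    have : Real.pi * (2 * ((x b c : ℝ) - x a c - x b d + x a d + n a b c - n a b d - n c d a
        + n c d b)) = 0 := by
      linarith
    have h5 : (x b c : ℝ) - x a c - x b d + x a d + n a b c - n a b d - n c d a + n c d b = 0 := by
      simpa [Real.pi_ne_zero] using this
    exact_mod_cast h5

/-- Add the relations of `exists_turns` over all fifteen pairs of disjoint edges of the complete
graph and read the sum modulo 2. Each winding number occurs twice, because an edge ab and a point c
leave two choices of d. Each unordered pair of points occurs six times among the `x` terms, and
replacing `x j i` by `-1 - x i j` changes the parity. Every four points contribute three such
reversals, so five quadruples give fifteen: the sum would be odd, yet it is zero. Only edges without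
a common end need disjoint paths. -/
theorem not_exists_pairwise_disjoint_paths (p : Fin 5 → ℂ) (γ : ∀ i j, Path (p i) (p j))
    (h : ∀ a b c d, a ≠ c → a ≠ d → b ≠ c → b ≠ d →
      Disjoint (Set.range (γ a b)) (Set.range (γ c d))) : False := by
  have hp : Function.Injective p := by
    intro i j hij
    by_contra hne
    have hi : p i ∈ Set.range (γ i i) := ⟨0, by simp⟩
    exact Set.disjoint_left.1 (h i i j j hne hne hne hne) hi ⟨0, by simp [hij]⟩
  obtain ⟨n, x, hx, hn⟩ := exists_turns p hp γ
  have H : ∀ a b c d, a ≠ c ∧ a ≠ d ∧ b ≠ c ∧ b ≠ d →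
      x b c - x a c - x b d + x a d + n a b c - n a b d - n c d a + n c d b = 0 :=
    fun a b c d ⟨h1, h2, h3, h4⟩ => hn a b c d h1 h2 h3 h4 (h a b c d h1 h2 h3 h4)
  have a1 := H 0 1 2 3 (by decide)
  have a2 := H 0 2 1 3 (by decide)
  have a3 := H 0 3 1 2 (by decide)
  have b1 := H 0 1 2 4 (by decide)
  have b2 := H 0 2 1 4 (by decide)
  have b3 := H 0 4 1 2 (by decide)
  have c1 := H 0 1 3 4 (by decide)
  have c2 := H 0 3 1 4 (by decide)
  have c3 := H 0 4 1 3 (by decide)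
  have d1 := H 0 2 3 4 (by decide)
  have d2 := H 0 3 2 4 (by decide)
  have d3 := H 0 4 2 3 (by decide)
  have e1 := H 1 2 3 4 (by decide)
  have e2 := H 1 3 2 4 (by decide)
  have e3 := H 1 4 2 3 (by decide)
  have x10 := hx 0 1 (by decide)
  have x20 := hx 0 2 (by decide)
  have x30 := hx 0 3 (by decide)
  have x40 := hx 0 4 (by decide)
  have x21 := hx 1 2 (by decide)
  have x31 := hx 1 3 (by decide)
  have x41 := hx 1 4 (by decide)
  have x32 := hx 2 3 (by decide)
  have x42 := hx 2 4 (by decide)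
  have x43 := hx 3 4 (by decide)
  omega

end STDMA
end

noncomputable section

namespace STDMA

/-! ### Dense graphs have complete minors -/

section Minor

variable {V : Type*} (G : SimpleGraph V)

/-- `x` and `y` are joined by a walk of `G` that stays inside `B`. -/
def JoinedWithin (B : Set V) : V → V → Prop :=
  Relation.ReflTransGen fun x y => G.Adj x y ∧ x ∈ B ∧ y ∈ B

/-- Any two vertices of `B` are joined inside `B`. -/
def ConnectedSet (B : Set V) : Prop := ∀ x ∈ B, ∀ y ∈ B, JoinedWithin G B x y

variable {G}

theorem JoinedWithin.mono {B B' : Set V} (h : B ⊆ B') {x y : V} (hxy : JoinedWithin G B x y) :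
    JoinedWithin G B' x y :=
  Relation.ReflTransGen.mono (fun _ _ ⟨h1, h2, h3⟩ => ⟨h1, h h2, h h3⟩) _ _ hxy

theorem ConnectedSet.union {B B' : Set V} (hB : ConnectedSet G B) (hB' : ConnectedSet G B')
    {a b : V} (ha : a ∈ B) (hb : b ∈ B') (hab : G.Adj a b) : ConnectedSet G (B ∪ B') := by
  have h1 : JoinedWithin G (B ∪ B') a b := .single ⟨hab, .inl ha, .inr hb⟩
  have h2 : JoinedWithin G (B ∪ B') b a := .single ⟨hab.symm, .inr hb, .inl ha⟩
  have hl : ∀ x ∈ B, ∀ y ∈ B, JoinedWithin G (B ∪ B') x y := fun x hx y hy =>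
    (hB x hx y hy).mono Set.subset_union_left
  have hr : ∀ x ∈ B', ∀ y ∈ B', JoinedWithin G (B ∪ B') x y := fun x hx y hy =>
    (hB' x hx y hy).mono Set.subset_union_right
  rintro x (hx | hx) y (hy | hy)
  · exact hl x hx y hy
  · exact ((hl x hx a ha).trans h1).trans (hr b hb y hy)
  · exact ((hr x hx b hb).trans h2).trans (hl a ha y hy)
  · exact hr x hx y hy

theorem connectedSet_singleton (a : V) : ConnectedSet G {a} := by
  rintro x rfl y rfl
  exact .refl

variable (G) in
/-- A model of the complete graph on `t` vertices as a minor of `G` inside `A`. -/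
structure CompleteMinor (t : ℕ) (A : Set V) where
  branch : Fin t → Set V
  subset : ∀ i, branch i ⊆ A
  nonempty : ∀ i, (branch i).Nonempty
  connected : ∀ i, ConnectedSet G (branch i)
  disjoint : ∀ i j, i ≠ j → Disjoint (branch i) (branch j)
  adj : ∀ i j, i ≠ j → ∃ a ∈ branch i, ∃ b ∈ branch j, G.Adj a b

/-- The set `U` becomes an additional branch set: it sees every vertex of `A`, hence every old
branch set. -/
theorem CompleteMinor.nonempty_succ {t : ℕ} {A A' U : Set V} (M : CompleteMinor G t A)
    (hA : A ⊆ A') (hU : U ⊆ A') (hUc : ConnectedSet G U) (hUne : U.Nonempty)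
    (hd : Disjoint U A) (hadj : ∀ x ∈ A, ∃ a ∈ U, G.Adj a x) :
    Nonempty (CompleteMinor G (t + 1) A') := by
  refine ⟨⟨Fin.cons U M.branch, ?_, ?_, ?_, ?_, ?_⟩⟩
  · intro i
    refine Fin.cases ?_ (fun i => ?_) i
    · simpa using hU
    · simpa using (M.subset i).trans hA
  · intro i
    refine Fin.cases ?_ (fun i => ?_) i
    · simpa using hUne
    · simpa using M.nonempty i
  · intro i
    refine Fin.cases ?_ (fun i => ?_) i
    · simpa using hUc
    · simpa using M.connected i
  · intro i j
    refine Fin.cases ?_ (fun i => ?_) i <;> refine Fin.cases ?_ (fun j => ?_) j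
    · simp
    · intro _
      simpa using hd.mono_right (M.subset j)
    · intro _
      simpa using (hd.mono_right (M.subset i)).symm
    · intro h
      simpa using M.disjoint i j (fun h' => h (by rw [h']))
  · intro i j
    refine Fin.cases ?_ (fun i => ?_) i <;> refine Fin.cases ?_ (fun j => ?_) j
    · simp
    · intro _
      obtain ⟨b, hb⟩ := M.nonempty j
      obtain ⟨a, ha, hab⟩ := hadj b (M.subset j hb)
      exact ⟨a, by simpa using ha, b, by simpa using hb, hab⟩
    · intro _
      obtain ⟨b, hb⟩ := M.nonempty i
      obtain ⟨a, ha, hab⟩ := hadj b (M.subset i hb)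
      exact ⟨b, by simpa using hb, a, by simpa using ha, hab.symm⟩
    · intro h
      simpa using M.adj i j (fun h' => h (by rw [h']))

open Classical in
variable (G) in
/-- The neighbours of `x` in `A`. -/
def nbrs (A : Finset V) (x : V) : Finset V := A.filter (G.Adj x)

variable (G) in
/-- Twice the number of edges inside `A`. -/
def arcCount (A : Finset V) : ℕ := ∑ x ∈ A, (nbrs G A x).card

open Classical in
variable (G) in
/-- The vertices of `A \ U` adjacent to `U`. -/
def boundary (A U : Finset V) : Finset V := (A \ U).filter fun x => ∃ u ∈ U, G.Adj u x

open Classical in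
theorem arcCount_insert {A : Finset V} {x : V} (hx : x ∉ A) :
    arcCount G (insert x A) = arcCount G A + 2 * (nbrs G A x).card := by
  have h1 : ∀ y ∈ A, (nbrs G (insert x A) y).card =
      (nbrs G A y).card + if G.Adj x y then 1 else 0 := by
    intro y hy
    unfold nbrs
    rw [Finset.filter_insert]
    by_cases h : G.Adj y x
    · rw [if_pos h, if_pos h.symm, Finset.card_insert_of_notMem (by simp [hx])]
    · rw [if_neg h, if_neg (fun h' => h h'.symm), add_zero]
  have h2 : nbrs G (insert x A) x = nbrs G A x := by
    unfold nbrs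
    rw [Finset.filter_insert, if_neg (G.loopless.irrefl x)]
  unfold arcCount
  rw [Finset.sum_insert hx, h2, Finset.sum_congr rfl h1, Finset.sum_add_distrib,
    Finset.sum_boole]
  have : (nbrs G A x).card = (A.filter fun y => G.Adj x y).card := rfl
  simp only [Nat.cast_id]
  omega

-- Mader's argument. Choose a maximal connected `U` whose contraction to a single vertex leaves the
-- average degree at least `c`. By maximality every vertex of the boundary of `U` has at least `c /
-- 2` neighbours inside the boundary. The boundary thus carries a complete minor with one branch set
-- fewer, and `U`, adjacent to all of it, supplies the missing one.
open Classical in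
theorem exists_completeMinor (t : ℕ) : ∀ A : Finset V, A.Nonempty →
    2 ^ (t + 1) * A.card ≤ arcCount G A → Nonempty (CompleteMinor G (t + 1) A) := by
  induction t with
  | zero =>
    rintro A ⟨a, ha⟩ -
    refine ⟨⟨fun _ => {a}, by simpa using ha, by simp, fun _ => connectedSet_singleton a,
      fun i j h => (h (Fin.ext (by omega))).elim, fun i j h => (h (Fin.ext (by omega))).elim⟩⟩
  | succ t ih =>
    intro A
    induction hn : A.card using Nat.strong_induction_on generalizing A with
    | _ n ihA =>
    intro hA hcount
    obtain ⟨a, ha⟩ := hA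
    set c := 2 ^ (t + 1 + 1) with hc
    -- The inequality says that the contracted graph has average degree at least `c`: it has one
    -- vertex besides `A \ U`, and that vertex has the boundary as its neighbourhood.
    let good : Finset V → Prop := fun U => U.Nonempty ∧ ConnectedSet G (U : Set V) ∧
      c * ((A \ U).card + 1) ≤ arcCount G (A \ U) + 2 * (boundary G A U).card
    have hgood : good {a} := by
      refine ⟨by simp, by simpa using connectedSet_singleton a, ?_⟩
      have h1 : insert a (A \ {a}) = A := by
        rw [Finset.sdiff_singleton_eq_erase, Finset.insert_erase ha]
      have h2 : boundary G A {a} = nbrs G (A \ {a}) a := by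
        unfold boundary nbrs
        simp
      have h3 := arcCount_insert (G := G) (A := A \ {a}) (x := a) (by simp)
      have h4 : (A \ {a}).card + 1 = A.card := by
        conv_rhs => rw [← h1]
        rw [Finset.card_insert_of_notMem (by simp)]
      rw [h1] at h3
      rw [h2, h4, hn]
      omega
    obtain ⟨U, hU, hmax⟩ := (A.powerset.filter good).exists_max_image Finset.card
      ⟨{a}, by simp [ha, hgood]⟩
    simp only [Finset.mem_filter, Finset.mem_powerset] at hU hmax
    obtain ⟨hUA, hUne, hUc, hUcount⟩ := hU
    have hsplit : (A \ U).card + U.card = n := by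
      rw [← hn]; exact Finset.card_sdiff_add_card_eq_card hUA
    have hUpos := hUne.card_pos
    rcases (boundary G A U).eq_empty_or_nonempty with hB | hB
    -- Without a boundary the contracted vertex is isolated, so the smaller set `A \ U` is itself
    -- dense enough and the induction on the cardinality applies.
    · rw [hB, Finset.card_empty] at hUcount
      have hne : (A \ U).Nonempty := by
        rw [Finset.nonempty_iff_ne_empty]
        intro h0
        rw [h0] at hUcount
        have : 0 < c := by positivity
        simp [arcCount] at hUcount
        omega
      obtain ⟨M⟩ := ihA (A \ U).card (by omega) (A \ U) rfl hne (by nlinarith)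
      exact ⟨{ M with subset := fun i => (M.subset i).trans (by simp) }⟩
    · have hdeg : ∀ w ∈ boundary G A U, c ≤ 2 * (nbrs G (boundary G A U) w).card := by
        intro w hw
        have hw' := hw
        simp only [boundary, Finset.mem_filter, Finset.mem_sdiff] at hw
        obtain ⟨⟨hwA, hwU⟩, u, huU, huw⟩ := hw
        have hnot : ¬ good (insert w U) := by
          intro hg
          have := hmax (insert w U) ⟨Finset.insert_subset hwA hUA, hg⟩
          rw [Finset.card_insert_of_notMem hwU] at this
          omega
        have hconn : ConnectedSet G ((insert w U : Finset V) : Set V) := by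
          have := (connectedSet_singleton (G := G) w).union hUc rfl huU huw.symm
          rw [Finset.coe_insert]
          exact this
        have hins : insert w (A \ insert w U) = A \ U := by
          ext x
          simp only [Finset.mem_insert, Finset.mem_sdiff, not_or]
          constructor
          · rintro (rfl | ⟨h1, h2, h3⟩)
            · exact ⟨hwA, hwU⟩
            · exact ⟨h1, h3⟩
          · rintro ⟨h1, h2⟩
            by_cases h : x = w
            · exact .inl h
            · exact .inr ⟨h1, h, h2⟩
        have hnw : w ∉ A \ insert w U := by simp
        have h1 := arcCount_insert (G := G) hnw
        have h2 := Finset.card_insert_of_notMem hnw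
        rw [hins] at h1 h2
        have hlt : arcCount G (A \ insert w U) + 2 * (boundary G A (insert w U)).card <
            c * ((A \ insert w U).card + 1) := by
          by_contra h
          exact hnot ⟨by simp, hconn, not_lt.1 h⟩
        -- Inclusion and exclusion: the new boundary is the old one without `w` together with the
        -- outside neighbours of `w`, and the overlap consists of the neighbours of `w` in the old
        -- boundary. Moving `w` into `U` therefore loses one edge plus that many more. Failure of
        -- the density condition then gives `c` less than two plus twice that number, and `c` is
        -- even.
        have h3 : (nbrs G (A \ insert w U) w).card + (boundary G A U).card =
            (boundary G A (insert w U)).card + 1 + (nbrs G (boundary G A U) w).card := by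
          have e1 : nbrs G (A \ insert w U) w ∪ (boundary G A U).erase w =
              boundary G A (insert w U) := by
            ext x
            simp only [nbrs, boundary, Finset.mem_union, Finset.mem_filter, Finset.mem_erase,
              Finset.mem_sdiff, Finset.mem_insert, not_or]
            constructor
            · rintro (⟨⟨h1, h2, h3⟩, h4⟩ | ⟨h0, ⟨h1, h2⟩, u, h3, h4⟩)
              · exact ⟨⟨h1, h2, h3⟩, w, .inl rfl, h4⟩
              · exact ⟨⟨h1, h0, h2⟩, u, .inr h3, h4⟩
            · rintro ⟨⟨h1, h2, h3⟩, z, hz | h4, h5⟩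
              · exact .inl ⟨⟨h1, h2, h3⟩, hz ▸ h5⟩
              · exact .inr ⟨h2, ⟨h1, h3⟩, z, h4, h5⟩
          have e2 : nbrs G (A \ insert w U) w ∩ (boundary G A U).erase w =
              nbrs G (boundary G A U) w := by
            ext x
            simp only [nbrs, boundary, Finset.mem_inter, Finset.mem_filter, Finset.mem_erase,
              Finset.mem_sdiff, Finset.mem_insert, not_or]
            constructor
            · rintro ⟨⟨⟨h1, h2, h3⟩, h4⟩, ⟨h0, ⟨h5, h6⟩, h7⟩⟩
              exact ⟨⟨⟨h1, h3⟩, h7⟩, h4⟩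
            · rintro ⟨⟨⟨h1, h3⟩, h7⟩, h4⟩
              exact ⟨⟨⟨h1, h4.ne', h3⟩, h4⟩, ⟨h4.ne', ⟨h1, h3⟩, h7⟩⟩
          have e3 := Finset.card_union_add_card_inter (nbrs G (A \ insert w U) w)
            ((boundary G A U).erase w)
          rw [e1, e2, Finset.card_erase_of_mem hw'] at e3
          have := hB.card_pos
          omega
        have h4 : c * ((A \ U).card + 1) = c * ((A \ insert w U).card + 1) + c := by
          rw [h2]; ring
        omega
      have hcount' : 2 ^ (t + 1) * (boundary G A U).card ≤ arcCount G (boundary G A U) := by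
        have : ∑ _w ∈ boundary G A U, c ≤ ∑ w ∈ boundary G A U,
          2 * (nbrs G (boundary G A U) w).card := Finset.sum_le_sum hdeg
        rw [Finset.sum_const, ← Finset.mul_sum, smul_eq_mul, hc, pow_succ] at this
        unfold arcCount
        linarith
      obtain ⟨M⟩ := ih _ hB hcount'
      refine M.nonempty_succ (U := U) ?_ (by exact_mod_cast hUA) hUc (by exact_mod_cast hUne) ?_ ?_
      · intro x hx
        simp only [boundary, Finset.coe_filter, Finset.mem_sdiff, Set.mem_ofPred_eq] at hx
        exact hx.1.1
      · rw [Set.disjoint_left]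
        intro x hx hx'
        simp only [boundary, Finset.coe_filter, Finset.mem_sdiff, Set.mem_ofPred_eq] at hx'
        exact hx'.1.2 hx
      · intro x hx
        simp only [boundary, Finset.coe_filter, Finset.mem_sdiff, Set.mem_ofPred_eq] at hx
        exact hx.2

end Minor

end STDMA
end

noncomputable section

namespace STDMA

/-! ### The number of edges of planar graphs and the thickness -/

section Planar

variable {V : Type*} {G : SimpleGraph V}

/-- The part of a drawing that belongs to the subgraph induced by `S`. -/
def PlaneDrawing.trace (d : PlaneDrawing G) (S : Set V) : Set (EuclideanSpace ℝ (Fin 2)) :=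
  d.pt '' S ∪ {q | ∃ u ∈ S, ∃ w ∈ S, G.Adj u w ∧ q ∈ d.arc s(u, w)}

/-- Arcs meet only in common ends and avoid all other vertices, so a common point of the two traces
would yield a common vertex of `S` and `T`. -/
theorem PlaneDrawing.disjoint_trace (d : PlaneDrawing G) {S T : Set V} (h : Disjoint S T) :
    Disjoint (d.trace S) (d.trace T) := by
  rw [Set.disjoint_left] at h ⊢
  rintro q (⟨u, hu, rfl⟩ | ⟨u, hu, w, hw, huw, hq⟩) (⟨u', hu', h1⟩ | ⟨u', hu', w', hw', huw', hq'⟩)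
  · exact h hu (d.pt_injective h1 ▸ hu')
  · have := d.vertex_of_mem_arc _ (G.mem_edgeSet.2 huw') u hq'
    rcases Sym2.mem_iff.1 this with rfl | rfl
    exacts [h hu hu', h hu hw']
  · rw [← h1] at hq
    have := d.vertex_of_mem_arc _ (G.mem_edgeSet.2 huw) u' hq
    rcases Sym2.mem_iff.1 this with rfl | rfl
    exacts [h hu hu', h hw hu']
  · have hne : s(u, w) ≠ s(u', w') := by
      intro he
      have : u ∈ s(u', w') := he ▸ Sym2.mem_mk_left u w
      rcases Sym2.mem_iff.1 this with rfl | rfl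
      exacts [h hu hu', h hu hw']
    obtain ⟨z, hz, hz', -⟩ := d.arc_inter _ (G.mem_edgeSet.2 huw) _ (G.mem_edgeSet.2 huw') hne
      ⟨hq, hq'⟩
    have h1 : z ∈ S := by rcases Sym2.mem_iff.1 hz with rfl | rfl <;> assumption
    have h2 : z ∈ T := by rcases Sym2.mem_iff.1 hz' with rfl | rfl <;> assumption
    exact h h1 h2

theorem PlaneDrawing.joinedIn_trace (d : PlaneDrawing G) {S : Set V} {u w : V} (hu : u ∈ S)
    (h : JoinedWithin G S u w) : JoinedIn (d.trace S) (d.pt u) (d.pt w) := by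
  induction h with
  | refl => exact JoinedIn.refl (.inl ⟨u, hu, rfl⟩)
  | tail _ hbc ih =>
    obtain ⟨hadj, hb, hc⟩ := hbc
    obtain ⟨f, -, hf⟩ := d.isArc _ _ hadj
    exact ih.trans ⟨f, fun t => .inr ⟨_, hb, _, hc, hadj, hf ▸ ⟨t, rfl⟩⟩⟩

/-- Pick a vertex in each branch set and join the chosen vertices of branch sets i and j inside the
trace of their union. For disjoint pairs of indices these traces are disjoint, so the paths
contradict `not_exists_pairwise_disjoint_paths`. Paths sharing an index may cross. -/
theorem not_completeMinor_five_of_isPlanar (h : IsPlanar G) {A : Set V}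
    (M : CompleteMinor G 5 A) : False := by
  obtain ⟨d⟩ := h
  choose c hc using M.nonempty
  let toC : EuclideanSpace ℝ (Fin 2) → ℂ := fun x => ⟨x 0, x 1⟩
  have hcont : Continuous toC := by
    have : toC = fun x => (x 0 : ℂ) + (x 1 : ℂ) * Complex.I := by
      funext x
      exact Complex.mk_eq_add_mul_I _ _
    rw [this]
    fun_prop
  have hinj : Function.Injective toC := by
    intro x y hxy
    have h0 := congrArg Complex.re hxy
    have h1 := congrArg Complex.im hxy
    ext i
    fin_cases i
    exacts [h0, h1]
  have hj : ∀ i j, JoinedIn (d.trace (M.branch i ∪ M.branch j)) (d.pt (c i)) (d.pt (c j)) := by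
    intro i j
    by_cases hij : i = j
    · subst hij
      exact JoinedIn.refl (.inl ⟨_, .inl (hc i), rfl⟩)
    · obtain ⟨a, ha, b, hb, hab⟩ := M.adj i j hij
      exact d.joinedIn_trace (.inl (hc i)) ((M.connected i).union (M.connected j) ha hb hab _
        (.inl (hc i)) _ (.inr (hc j)))
  choose γ hγ using hj
  refine not_exists_pairwise_disjoint_paths (fun i => toC (d.pt (c i)))
    (fun i j => (γ i j).map hcont) fun i j k l hik hil hjk hjl => ?_
  have hd : Disjoint (d.trace (M.branch i ∪ M.branch j)) (d.trace (M.branch k ∪ M.branch l)) := by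
    apply d.disjoint_trace
    simp only [Set.disjoint_union_left, Set.disjoint_union_right]
    exact ⟨⟨M.disjoint _ _ hik, M.disjoint _ _ hjk⟩, M.disjoint _ _ hil, M.disjoint _ _ hjl⟩
  rw [Set.disjoint_left]
  rintro _ ⟨s, rfl⟩ ⟨t, ht⟩
  have := hinj ht
  exact Set.disjoint_left.1 hd (hγ i j s) (this ▸ hγ k l t)

open Classical in
theorem card_arcs_le_of_isPlanar [Fintype V] (h : IsPlanar G) :
    (Finset.univ.filter fun x : V × V => G.Adj x.1 x.2).card ≤ 32 * Fintype.card V := by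
  have hc : (Finset.univ.filter fun x : V × V => G.Adj x.1 x.2).card
      = arcCount G (Finset.univ : Finset V) := by
    unfold arcCount nbrs
    simp only [Finset.card_filter]
    rw [← Finset.univ_product_univ, Finset.sum_product]
  rcases isEmpty_or_nonempty V with hV | hV
  · simp
  rw [hc]
  by_contra hlt
  obtain ⟨M⟩ := exists_completeMinor (G := G) 4 Finset.univ Finset.univ_nonempty (by
    rw [Finset.card_univ]; norm_num; omega)
  exact not_completeMinor_five_of_isPlanar h M

/-- With the vertices on the parabola y = x² no three are collinear, so a straight segment between
two of them avoids the rest. -/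
theorem isPlanar_fromEdgeSet_singleton {n : ℕ} (e : Sym2 (Fin n)) :
    IsPlanar (SimpleGraph.fromEdgeSet {e}) := by
  let pt : Fin n → EuclideanSpace ℝ (Fin 2) := fun i => !₂[(i : ℝ), (i : ℝ) ^ 2]
  have hinj : Function.Injective pt := by
    intro i j hij
    have := congrArg (fun x : EuclideanSpace ℝ (Fin 2) => x 0) hij
    simp only [pt, Matrix.cons_val_zero] at this
    exact Fin.ext (by exact_mod_cast this)
  refine ⟨⟨pt, hinj, fun e => {q | ∃ u w, e = s(u, w) ∧ q ∈ segment ℝ (pt u) (pt w)}, ?_, ?_, ?_⟩⟩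
  · intro u w huw
    have hne : pt u ≠ pt w := hinj.ne huw.ne
    refine ⟨⟨⟨fun t => AffineMap.lineMap (pt u) (pt w) (t : ℝ), ?_⟩, by simp, by simp⟩, ?_, ?_⟩
    · exact AffineMap.lineMap_continuous.comp continuous_subtype_val
    · intro s t hst
      exact Subtype.ext (AffineMap.lineMap_injective ℝ hne hst)
    · have h1 : Set.range (fun t : unitInterval => AffineMap.lineMap (pt u) (pt w) (t : ℝ)) =
          segment ℝ (pt u) (pt w) := by
        rw [segment_eq_image_lineMap, Set.image_eq_range]
      ext q
      change q ∈ Set.range (fun t : unitInterval => AffineMap.lineMap (pt u) (pt w) (t : ℝ)) ↔ _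
      rw [h1]
      constructor
      · exact fun h => ⟨u, w, rfl, h⟩
      · rintro ⟨u', w', he, h⟩
        rcases Sym2.eq_iff.1 he with ⟨rfl, rfl⟩ | ⟨rfl, rfl⟩
        · exact h
        · rwa [segment_symm]
  · rintro e he z ⟨u, w, rfl, a, b, ha, hb, hab, hz⟩
    have h0 := congrArg (fun x : EuclideanSpace ℝ (Fin 2) => x 0) hz
    have h1 := congrArg (fun x : EuclideanSpace ℝ (Fin 2) => x 1) hz
    simp [pt] at h0 h1
    obtain rfl : a = 1 - b := by linarith
    -- The gap between chord and parabola; it vanishes only at an end of the chord.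
    have h2 : b * (1 - b) * ((u : ℝ) - w) ^ 2 = 0 := by
      rw [← h0] at h1
      linear_combination h1
    rw [Sym2.mem_iff]
    rcases mul_eq_zero.1 h2 with h2 | h2
    · rcases mul_eq_zero.1 h2 with h2 | h2
      · subst h2
        exact .inl (Fin.ext (by
          have : (z : ℝ) = u := by linarith
          exact_mod_cast this))
      · obtain rfl : b = 1 := by linarith
        exact .inr (Fin.ext (by
          have : (z : ℝ) = w := by linarith
          exact_mod_cast this))
    · have h3 : (u : ℝ) = w := by linarith [pow_eq_zero_iff (two_ne_zero) |>.1 h2]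
      exact .inl (Fin.ext (by
          have : (z : ℝ) = u := by rw [← h0, ← h3]; ring
          exact_mod_cast this))
  · intro e he e' he' hne
    simp only [SimpleGraph.edgeSet_fromEdgeSet, Set.mem_sdiff, Set.mem_singleton_iff] at he he'
    exact (hne (he.1.trans he'.1.symm)).elim

/-- The partition into single edges shows that the infimum defining `thickness` is attained, instead
of being the default value 0 of an empty infimum. -/
theorem exists_planar_partition {n : ℕ} (G : SimpleGraph (Fin n)) :
    ∃ (t : ℕ) (H : Fin t → SimpleGraph (Fin n)), (∀ i, IsPlanar (H i)) ∧
      Pairwise (fun i j => Disjoint (H i) (H j)) ∧ ⨆ i, H i = G := by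
  classical
  let f := (Fintype.equivFin G.edgeSet).symm
  refine ⟨Fintype.card G.edgeSet, fun i => SimpleGraph.fromEdgeSet {(f i : Sym2 (Fin n))},
    fun i => isPlanar_fromEdgeSet_singleton _, ?_, ?_⟩
  · intro i j hij
    rw [SimpleGraph.disjoint_left]
    intro x y hx hy
    simp only [SimpleGraph.fromEdgeSet_adj, Set.mem_singleton_iff] at hx hy
    exact hij (f.injective (Subtype.ext (hx.1.symm.trans hy.1)))
  · ext x y
    simp only [SimpleGraph.iSup_adj, SimpleGraph.fromEdgeSet_adj, Set.mem_singleton_iff]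
    constructor
    · rintro ⟨i, hi, -⟩
      have := (f i).2
      rwa [← hi, SimpleGraph.mem_edgeSet] at this
    · intro h
      exact ⟨f.symm ⟨s(x, y), h⟩, by simp, h.ne⟩

open Classical in
theorem card_arcs_le_thickness {n : ℕ} (G : SimpleGraph (Fin n)) :
    (Finset.univ.filter fun x : Fin n × Fin n => G.Adj x.1 x.2).card ≤ 32 * n * thickness G := by
  obtain ⟨H, hH, -, hsup⟩ : ∃ H : Fin (thickness G) → SimpleGraph (Fin n), (∀ i, IsPlanar (H i)) ∧
      Pairwise (fun i j => Disjoint (H i) (H j)) ∧ ⨆ i, H i = G :=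
    Nat.sInf_mem (exists_planar_partition G)
  have hsub : (Finset.univ.filter fun x : Fin n × Fin n => G.Adj x.1 x.2) ⊆
      Finset.univ.biUnion fun i => Finset.univ.filter fun x : Fin n × Fin n => (H i).Adj x.1 x.2 := by
    intro x hx
    simp only [Finset.mem_filter, Finset.mem_univ, true_and, Finset.mem_biUnion] at hx ⊢
    have hx' : (⨆ i, H i).Adj x.1 x.2 := by rw [hsup]; exact hx
    exact SimpleGraph.iSup_adj.1 hx'
  calc _ ≤ _ := Finset.card_le_card hsub
    _ ≤ ∑ i, (Finset.univ.filter fun x : Fin n × Fin n => (H i).Adj x.1 x.2).card :=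
      Finset.card_biUnion_le
    _ ≤ ∑ _i : Fin (thickness G), 32 * n := Finset.sum_le_sum fun i _ => by
      simpa using card_arcs_le_of_isPlanar (hH i)
    _ = 32 * n * thickness G := by simp [mul_comm]

end Planar

theorem Network.card_commEdges_le {N : ℕ} (Φ : Network N) :
    Φ.commEdges.card ≤ 32 * N * thickness Φ.graph :=
  card_arcs_le_thickness Φ.graph

end STDMA
end

noncomputable section

namespace STDMA

/-! ### Reasoning about programs -/

/-- The program `p`, started in `s`, halts after a time `t` in a state `s'` with `Q t s'`. -/
def Runs (ω : Tape) (p : Cmd) (s : State) (Q : ℕ → State → Prop) : Prop :=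
  ∃ t s', Exec ω p s t s' ∧ Q t s'

namespace Cmd

/-- The registers of naturals that a program may change. -/
def nregW : Cmd → List ℕ
  | skip => []
  | nset i _ => [i]
  | rset _ _ => []
  | nput _ _ _ => []
  | rput _ _ _ => []
  | draw i _ => [i]
  | seq p q => p.nregW ++ q.nregW
  | ite _ p q => p.nregW ++ q.nregW
  | .while _ p => p.nregW

/-- The registers of reals that a program may change. -/
def rregW : Cmd → List ℕ
  | rset i _ => [i]
  | seq p q => p.rregW ++ q.rregW
  | ite _ p q => p.rregW ++ q.rregW
  | .while _ p => p.rregW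
  | _ => []

/-- The arrays of naturals that a program may change. -/
def narrW : Cmd → List ℕ
  | nput a _ _ => [a]
  | seq p q => p.narrW ++ q.narrW
  | ite _ p q => p.narrW ++ q.narrW
  | .while _ p => p.narrW
  | _ => []

/-- The arrays of reals that a program may change. -/
def rarrW : Cmd → List ℕ
  | rput a _ _ => [a]
  | seq p q => p.rarrW ++ q.rarrW
  | ite _ p q => p.rarrW ++ q.rarrW
  | .while _ p => p.rarrW
  | _ => []

/-- The program has no loops. -/
def loopFree : Cmd → Bool
  | seq p q => p.loopFree && q.loopFree
  | ite _ p q => p.loopFree && q.loopFree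
  | .while _ _ => false
  | _ => true

/-- A bound for the running time of a program without loops. -/
def maxCost : Cmd → ℕ
  | skip => 1
  | nset _ x => x.cost + 1
  | rset _ x => x.cost + 1
  | nput _ idx x => idx.cost + x.cost + 1
  | rput _ idx x => idx.cost + x.cost + 1
  | draw _ bound => bound.cost + 1
  | seq p q => p.maxCost + q.maxCost
  | ite b p q => b.cost + (p.maxCost + q.maxCost)
  | .while _ _ => 0

open Classical in
/-- The final state of a program without loops. -/
def run (ω : Tape) : Cmd → State → State
  | skip, s => s
  | nset i x, s => { s with nreg := Function.update s.nreg i (x.eval s) }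
  | rset i x, s => { s with rreg := Function.update s.rreg i (x.eval s) }
  | nput a idx x, s =>
    { s with
      narr := Function.update s.narr a (Function.update (s.narr a) (idx.eval s) (x.eval s)) }
  | rput a idx x, s =>
    { s with
      rarr := Function.update s.rarr a (Function.update (s.rarr a) (idx.eval s) (x.eval s)) }
  | draw i bound, s =>
    { s with
      nreg := Function.update s.nreg i (ω (s.draws, bound.eval s)).val
      draws := s.draws + 1 }
  | seq p q, s => q.run ω (p.run ω s)
  | ite b p q, s => if b.eval s then p.run ω s else q.run ω s
  | .while _ _, s => s

end Cmd

/-- The states agree outside the registers and arrays which `p` may change. -/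
structure Frame (p : Cmd) (s s' : State) : Prop where
  nreg : ∀ i, i ∉ p.nregW → s'.nreg i = s.nreg i
  rreg : ∀ i, i ∉ p.rregW → s'.rreg i = s.rreg i
  narr : ∀ i, i ∉ p.narrW → s'.narr i = s.narr i
  rarr : ∀ i, i ∉ p.rarrW → s'.rarr i = s.rarr i

theorem Frame.refl (p : Cmd) (s : State) : Frame p s s :=
  ⟨fun _ _ => rfl, fun _ _ => rfl, fun _ _ => rfl, fun _ _ => rfl⟩

theorem Frame.trans {p : Cmd} {s s' s'' : State} (h : Frame p s s') (h' : Frame p s' s'') :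
    Frame p s s'' :=
  ⟨fun i hi => (h'.nreg i hi).trans (h.nreg i hi), fun i hi => (h'.rreg i hi).trans (h.rreg i hi),
    fun i hi => (h'.narr i hi).trans (h.narr i hi), fun i hi => (h'.rarr i hi).trans (h.rarr i hi)⟩

/-- Every location that `p` may change may be changed by `q`. -/
structure WritesLE (p q : Cmd) : Prop where
  nreg : p.nregW ⊆ q.nregW
  rreg : p.rregW ⊆ q.rregW
  narr : p.narrW ⊆ q.narrW
  rarr : p.rarrW ⊆ q.rarrW

theorem Frame.mono {p q : Cmd} {s s' : State} (h : Frame p s s') (hpq : WritesLE p q) :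
    Frame q s s' :=
  ⟨fun i hi => h.nreg i fun hi' => hi (hpq.nreg hi'), fun i hi => h.rreg i fun hi' => hi (hpq.rreg hi'),
    fun i hi => h.narr i fun hi' => hi (hpq.narr hi'), fun i hi => h.rarr i fun hi' => hi (hpq.rarr hi')⟩

theorem writesLE_seq_left (p q : Cmd) : WritesLE p (p.seq q) :=
  ⟨List.subset_append_left _ _, List.subset_append_left _ _, List.subset_append_left _ _,
    List.subset_append_left _ _⟩

theorem writesLE_seq_right (p q : Cmd) : WritesLE q (p.seq q) :=
  ⟨List.subset_append_right _ _, List.subset_append_right _ _, List.subset_append_right _ _,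
    List.subset_append_right _ _⟩

theorem writesLE_ite_left (b : Test) (p q : Cmd) : WritesLE p (.ite b p q) :=
  ⟨List.subset_append_left _ _, List.subset_append_left _ _, List.subset_append_left _ _,
    List.subset_append_left _ _⟩

theorem writesLE_ite_right (b : Test) (p q : Cmd) : WritesLE q (.ite b p q) :=
  ⟨List.subset_append_right _ _, List.subset_append_right _ _, List.subset_append_right _ _,
    List.subset_append_right _ _⟩

theorem writesLE_while (b : Test) (p : Cmd) : WritesLE p (.while b p) :=
  ⟨List.Subset.refl _, List.Subset.refl _, List.Subset.refl _, List.Subset.refl _⟩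

theorem Exec.frame {ω : Tape} {p : Cmd} {s s' : State} {t : ℕ} (h : Exec ω p s t s') :
    Frame p s s' := by
  induction h with
  | skip s => exact Frame.refl _ _
  | nset i x s =>
    refine ⟨fun j hj => ?_, fun _ _ => rfl, fun _ _ => rfl, fun _ _ => rfl⟩
    exact Function.update_of_ne (by simpa [Cmd.nregW] using hj) _ _
  | rset i x s =>
    refine ⟨fun _ _ => rfl, fun j hj => ?_, fun _ _ => rfl, fun _ _ => rfl⟩
    exact Function.update_of_ne (by simpa [Cmd.rregW] using hj) _ _
  | nput a idx x s =>
    refine ⟨fun _ _ => rfl, fun _ _ => rfl, fun j hj => ?_, fun _ _ => rfl⟩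
    exact Function.update_of_ne (by simpa [Cmd.narrW] using hj) _ _
  | rput a idx x s =>
    refine ⟨fun _ _ => rfl, fun _ _ => rfl, fun _ _ => rfl, fun j hj => ?_⟩
    exact Function.update_of_ne (by simpa [Cmd.rarrW] using hj) _ _
  | draw i b s =>
    refine ⟨fun j hj => ?_, fun _ _ => rfl, fun _ _ => rfl, fun _ _ => rfl⟩
    exact Function.update_of_ne (by simpa [Cmd.nregW] using hj) _ _
  | seq _ _ ihp ihq =>
    exact (ihp.mono (writesLE_seq_left _ _)).trans (ihq.mono (writesLE_seq_right _ _))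
  | ite_true _ _ ih => exact ih.mono (writesLE_ite_left _ _ _)
  | ite_false _ _ ih => exact ih.mono (writesLE_ite_right _ _ _)
  | while_true _ _ _ ihp ihw => exact (ihp.mono (writesLE_while _ _)).trans ihw
  | while_false _ => exact Frame.refl _ _

variable {ω : Tape} {p q : Cmd} {s : State} {Q Q' : ℕ → State → Prop}

theorem Runs.mono (h : Runs ω p s Q) (hQ : ∀ t s', Q t s' → Q' t s') : Runs ω p s Q' :=
  let ⟨t, s', h1, h2⟩ := h
  ⟨t, s', h1, hQ t s' h2⟩

theorem Runs.mono_frame (h : Runs ω p s Q) (hQ : ∀ t s', Frame p s s' → Q t s' → Q' t s') :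
    Runs ω p s Q' :=
  let ⟨t, s', h1, h2⟩ := h
  ⟨t, s', h1, hQ t s' h1.frame h2⟩

theorem Runs.seq (h : Runs ω p s fun t s' => Runs ω q s' fun t' s'' => Q (t + t') s'') :
    Runs ω (p.seq q) s Q :=
  let ⟨t, _, h1, t', s'', h2, h3⟩ := h
  ⟨t + t', s'', .seq h1 h2, h3⟩

theorem Runs.ite {b : Test} (ht : b.eval s → Runs ω p s fun t s' => Q (b.cost + t) s')
    (hf : ¬ b.eval s → Runs ω q s fun t s' => Q (b.cost + t) s') : Runs ω (.ite b p q) s Q := by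
  by_cases hb : b.eval s
  · obtain ⟨t, s', h1, h2⟩ := ht hb
    exact ⟨_, s', .ite_true hb h1, h2⟩
  · obtain ⟨t, s', h1, h2⟩ := hf hb
    exact ⟨_, s', .ite_false hb h1, h2⟩

theorem exists_exec_run (ω : Tape) (p : Cmd) (s : State) (hp : p.loopFree = true) :
    ∃ t ≤ p.maxCost, Exec ω p s t (p.run ω s) := by
  induction p generalizing s with
  | skip => exact ⟨_, le_rfl, .skip s⟩
  | nset i x => exact ⟨_, le_rfl, .nset i x s⟩
  | rset i x => exact ⟨_, le_rfl, .rset i x s⟩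
  | nput a idx x => exact ⟨_, le_rfl, .nput a idx x s⟩
  | rput a idx x => exact ⟨_, le_rfl, .rput a idx x s⟩
  | draw i b => exact ⟨_, le_rfl, .draw i b s⟩
  | seq p q ihp ihq =>
    simp only [Cmd.loopFree, Bool.and_eq_true] at hp
    obtain ⟨t, ht, h⟩ := ihp s hp.1
    obtain ⟨t', ht', h'⟩ := ihq (p.run ω s) hp.2
    exact ⟨t + t', add_le_add ht ht', .seq h h'⟩
  | ite b p q ihp ihq =>
    simp only [Cmd.loopFree, Bool.and_eq_true] at hp
    by_cases hb : b.eval s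
    · obtain ⟨t, ht, h⟩ := ihp s hp.1
      refine ⟨b.cost + t, by simp only [Cmd.maxCost]; omega, ?_⟩
      rw [Cmd.run, if_pos hb]
      exact .ite_true hb h
    · obtain ⟨t, ht, h⟩ := ihq s hp.2
      refine ⟨b.cost + t, by simp only [Cmd.maxCost]; omega, ?_⟩
      rw [Cmd.run, if_neg hb]
      exact .ite_false hb h
  | _ => simp [Cmd.loopFree] at hp

theorem Runs.of_loopFree (hp : p.loopFree = true)
    (h : ∀ t ≤ p.maxCost, Frame p s (p.run ω s) → Q t (p.run ω s)) :
    Runs ω p s Q := by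
  obtain ⟨t, ht, he⟩ := exists_exec_run ω p s hp
  exact ⟨t, _, he, h t ht he.frame⟩

/-- A loop with an invariant that may depend on the time used so far, and a variant. -/
theorem Runs.while {b : Test} (Inv : ℕ → State → Prop) (μ : State → ℕ) {t₀ : ℕ} (h0 : Inv t₀ s)
    (hstep : ∀ t s', Frame (.while b p) s s' → Inv t s' → b.eval s' →
      Runs ω p s' fun t' s'' => Inv (t + b.cost + t') s'' ∧ μ s'' < μ s') :
    Runs ω (.while b p) s fun t s' => ∃ t', t₀ + t = t' + b.cost ∧ Inv t' s' ∧ ¬ b.eval s' := by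
  induction hn : μ s using Nat.strong_induction_on generalizing s t₀ with
  | _ n ih =>
    by_cases hb : b.eval s
    · obtain ⟨t, s', he, hI, hlt⟩ := hstep t₀ s (Frame.refl _ _) h0 hb
      have hf : Frame (.while b p) s s' := he.frame.mono (writesLE_while _ _)
      obtain ⟨t', s'', he', t'', h1, h2, h3⟩ := ih (μ s') (hn ▸ hlt) (s := s')
        (t₀ := t₀ + b.cost + t) hI
        (fun u r hr => hstep u r (hf.trans hr)) rfl
      exact ⟨_, s'', .while_true hb he he', t'', by omega, h2, h3⟩
    · exact ⟨_, s, .while_false hb, t₀, rfl, h0, hb⟩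

/-- The state with the register `i` set to `x`. -/
def State.setN (s : State) (i x : ℕ) : State := { s with nreg := Function.update s.nreg i x }

theorem frame_setN (s : State) (i x : ℕ) : Frame (.nset i (.const 0)) s (s.setN i x) :=
  ⟨fun _ hj => Function.update_of_ne (by simpa [Cmd.nregW] using hj) _ _, fun _ _ => rfl,
    fun _ _ => rfl, fun _ _ => rfl⟩

/-- `for i = 0, …, n - 1 do body`. -/
def forN (i : ℕ) (n : NExp) (body : Cmd) : Cmd :=
  .seq (.nset i (.const 0))
    (.while (.not (.nle n (.reg i))) (.seq body (.nset i (.add (.reg i) (.const 1)))))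

/-- The rule for counting loops with an invariant that depends on the time used by the body. -/
theorem Runs.forN_time {i : ℕ} {n : NExp} {body : Cmd} (k : ℕ) (Inv : ℕ → ℕ → State → Prop)
    (hi : i ∉ body.nregW)
    (hn : ∀ s', Frame (forN i n body) s s' → n.eval s' = k)
    (hinv : ∀ j t s' x, Inv j t s' → Inv j t (s'.setN i x))
    (h0 : Inv 0 0 s)
    (hstep : ∀ j < k, ∀ t s', Frame (forN i n body) s s' → s'.nreg i = j → Inv j t s' →
      Runs ω body s' fun t' s'' => Inv (j + 1) (t + t') s'') :
    Runs ω (forN i n body) s fun t s' =>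
      ∃ t', t ≤ t' + (k + 1) * (n.cost + 10) ∧ Inv k t' s' := by
  have hfr : Frame (forN i n body) s (s.setN i 0) :=
    (Exec.nset (ω := ω) i (.const 0) s).frame.mono (writesLE_seq_left _ _)
  apply Runs.seq
  refine ⟨_, _, .nset i (.const 0) s, ?_⟩
  change Runs ω _ (s.setN i 0) _
  set b : Test := .not (.nle n (.reg i)) with hb
  have hbc : b.cost = n.cost + 3 := by simp [hb, Test.cost, NExp.cost]
  -- Each iteration adds `n.cost + 3` for the test and 4 for the increment to the time of the body.
  -- The initialisation and the last, failing test fit into the slack of the final constant.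
  refine (Runs.while (t₀ := 0)
    (fun t s' => s'.nreg i ≤ k ∧ ∃ t', Inv (s'.nreg i) t' s' ∧
      t ≤ t' + s'.nreg i * (n.cost + 7)) (fun s' => k - s'.nreg i) ?_ ?_).mono_frame ?_
  · refine ⟨by simp [State.setN], 0, ?_, by simp⟩
    simpa [State.setN] using hinv 0 0 s 0 h0
  · rintro t s' hf ⟨h1, t₁, h2, h3⟩ hbt
    have hf' := hfr.trans (hf.mono (writesLE_seq_right (.nset i (.const 0)) _))
    have hlt : s'.nreg i < k := by
      simpa [hb, Test.eval, NExp.eval, hn s' hf'] using hbt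
    apply Runs.seq
    refine (hstep _ hlt t₁ s' hf' rfl h2).mono_frame ?_
    rintro t' s'' hfb h5
    have h6 : s''.nreg i = s'.nreg i := hfb.nreg i hi
    refine ⟨_, _, .nset i (.add (.reg i) (.const 1)) s'', ?_⟩
    have h7 := hinv _ _ _ (s''.nreg i + 1) h5
    simp only [State.setN] at h7
    simp only [NExp.eval, NExp.cost, Function.update_self, hbc, h6] at h7 ⊢
    refine ⟨⟨hlt, _, h7, ?_⟩, by omega⟩
    rw [add_mul]
    omega
  · rintro t s' hf ⟨t', h1, ⟨h2, t₁, h3, h4⟩, h5⟩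
    have hf' := hfr.trans (hf.mono (writesLE_seq_right (.nset i (.const 0)) _))
    have h6 : s'.nreg i = k := by
      have : k ≤ s'.nreg i := by
        simpa [hb, Test.eval, NExp.eval, hn s' hf'] using h5
      omega
    rw [h6] at h3 h4
    refine ⟨t₁, ?_, h3⟩
    have : k * (n.cost + 7) ≤ k * (n.cost + 10) := Nat.mul_le_mul_left _ (by omega)
    simp only [NExp.cost]
    rw [add_mul]
    omega

/-- The rule for counting loops whose body has a bounded running time. -/
theorem Runs.forN {i : ℕ} {n : NExp} {body : Cmd} (k T : ℕ) (Inv : ℕ → State → Prop)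
    (hi : i ∉ body.nregW)
    (hn : ∀ s', Frame (forN i n body) s s' → n.eval s' = k)
    (hinv : ∀ j s' x, Inv j s' → Inv j (s'.setN i x))
    (h0 : Inv 0 s)
    (hstep : ∀ j < k, ∀ s', Frame (STDMA.forN i n body) s s' → s'.nreg i = j → Inv j s' →
      Runs ω body s' fun t s'' => t ≤ T ∧ Inv (j + 1) s'') :
    Runs ω (STDMA.forN i n body) s fun t s' => t ≤ (k + 1) * (T + n.cost + 10) ∧ Inv k s' := by
  refine (Runs.forN_time k (fun j t s' => t ≤ j * T ∧ Inv j s') hi hn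
    (fun j t s' x h => ⟨h.1, hinv j s' x h.2⟩) ⟨by simp, h0⟩ ?_).mono ?_
  · rintro j hj t s' hf hs' ⟨h1, h2⟩
    refine (hstep j hj s' hf hs' h2).mono ?_
    rintro t' s'' ⟨h3, h4⟩
    exact ⟨by rw [add_mul]; omega, h4⟩
  · rintro t s' ⟨t', h1, h2, h3⟩
    refine ⟨?_, h3⟩
    have : (k + 1) * (T + n.cost + 10) = k * T + T + (k + 1) * (n.cost + 10) := by ring
    omega

end STDMA
end

noncomputable section

namespace STDMA

/-! ### The program: colouring one edge -/

section Program

/-- Equality of two naturals. -/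
def natEqTest (x y : NExp) : Test := .and (.nle x y) (.nle y x)

/-- The power received at the node `r` from the node `t`. -/
def powerExp (t r : NExp) : RExp :=
  .div (.reg 0) (.pow (.pow (.add
    (.mul (.sub (.get 0 t) (.get 0 r)) (.sub (.get 0 t) (.get 0 r)))
    (.mul (.sub (.get 1 t) (.get 1 r)) (.sub (.get 1 t) (.get 1 r))))
    (.div (.const 1) (.const 2))) (.reg 3))

/-- Clear the entries `0, …, K + 1` of the accumulators, where `K` is the number of colours. -/
def clearBody : Cmd := .seq (.nput 10 (.reg 4) (.const 0)) (.rput 3 (.reg 4) (.const 0))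

/-- Index 0 receives the contributions of the uncoloured links and is never consulted as a colour.
Index K + 1 must be clear because a newly opened colour reads its accumulator. -/
def clearLoop : Cmd := forN 4 (.add (.reg 3) (.const 2)) clearBody

/-- No end of the link with index in register `4` is an end of the link in registers `10`, `11`,
and the link tolerates the additional interference. -/
def tolerateTest : Test :=
  .and (.not (natEqTest (.reg 10) (.get 0 (.reg 4))))
    (.and (.not (natEqTest (.reg 10) (.get 1 (.reg 4))))
      (.and (.not (natEqTest (.reg 11) (.get 0 (.reg 4))))
        (.and (.not (natEqTest (.reg 11) (.get 1 (.reg 4))))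
          (.rle (.reg 1) (.div (powerExp (.get 0 (.reg 4)) (.get 1 (.reg 4)))
            (.add (.reg 4) (.add (.get 2 (.reg 4)) (powerExp (.reg 10) (.get 1 (.reg 4))))))))))

/-- One pass serves all colours. Real array 3 collects, per colour, the power arriving at the
receiver of the new link; array 10 flags the colours containing a link that conflicts with it or
does not tolerate it. Real array 2 caches the present interference of each coloured link, so each
step takes constant time. -/
def scanBody : Cmd :=
  .seq (.rput 3 (.get 3 (.reg 4))
    (.add (.get 3 (.get 3 (.reg 4))) (powerExp (.get 0 (.reg 4)) (.reg 11))))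
    (.ite tolerateTest .skip (.nput 10 (.get 3 (.reg 4)) (.const 1)))

def scanLoop : Cmd := forN 4 (.reg 1) scanBody

/-- The counter goes up while the tested colour goes down from K to 1, so the last success to
overwrite register 12 is the smallest admissible colour. -/
def findBody : Cmd :=
  .ite (.and (.nle (.get 10 (.sub (.reg 3) (.reg 4))) (.const 0))
      (.rle (.reg 1) (.div (powerExp (.reg 10) (.reg 11))
        (.add (.reg 4) (.get 3 (.sub (.reg 3) (.reg 4)))))))
    (.nset 12 (.sub (.reg 3) (.reg 4))) .skip

/-- Find the smallest admissible colour. -/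
def findLoop : Cmd := .seq (.nset 12 (.add (.reg 3) (.const 1))) (forN 4 (.reg 3) findBody)

/-- Keeps the cache of interferences valid: the new link inherits the accumulator of its colour, and
each other link of that colour gains one summand. -/
def updateBody : Cmd :=
  .ite (.and (natEqTest (.reg 10) (.get 0 (.reg 4))) (natEqTest (.reg 11) (.get 1 (.reg 4))))
    (.seq (.nput 3 (.reg 4) (.reg 12)) (.rput 2 (.reg 4) (.get 3 (.reg 12))))
    (.ite (natEqTest (.get 3 (.reg 4)) (.reg 12))
      (.rput 2 (.reg 4) (.add (.get 2 (.reg 4)) (powerExp (.reg 10) (.get 1 (.reg 4)))))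
      .skip)

def updateLoop : Cmd := forN 4 (.reg 1) updateBody

/-- Register the new colour, if there is one, and count the coloured edges. -/
def countStep : Cmd :=
  .seq (.ite (.nle (.reg 12) (.reg 3)) .skip (.nset 3 (.reg 12)))
    (.nset 2 (.add (.reg 2) (.const 1)))

/-- Colour the edge in registers `10`, `11`. -/
def colorCmd : Cmd :=
  .seq clearLoop (.seq scanLoop (.seq findLoop (.seq updateLoop countStep)))

end Program

variable {N : ℕ}

/-- The input is in its place. -/
structure Env (Φ : Network N) (ed : Fin Φ.commEdges.card ≃ Φ.commEdges) (s : State) : Prop where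
  nodes : s.nreg 0 = N
  edges : s.nreg 1 = Φ.commEdges.card
  power : s.rreg 0 = Φ.P
  threshold : s.rreg 1 = Φ.γc
  loss : s.rreg 3 = Φ.α
  noise : s.rreg 4 = Φ.N₀
  src : ∀ i, s.narr 0 (i : Fin Φ.commEdges.card).val = ((ed i).1.1 : ℕ)
  dst : ∀ i, s.narr 1 (i : Fin Φ.commEdges.card).val = ((ed i).1.2 : ℕ)
  xpos : ∀ i, s.rarr 0 (i : Fin N).val = Φ.pos i 0
  ypos : ∀ i, s.rarr 1 (i : Fin N).val = Φ.pos i 1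

/-- The program does not overwrite the input. -/
def Cmd.keepsInput (p : Cmd) : Prop :=
  0 ∉ p.nregW ∧ 1 ∉ p.nregW ∧ 0 ∉ p.rregW ∧ 1 ∉ p.rregW ∧ 3 ∉ p.rregW ∧ 4 ∉ p.rregW ∧
    0 ∉ p.narrW ∧ 1 ∉ p.narrW ∧ 0 ∉ p.rarrW ∧ 1 ∉ p.rarrW

instance (p : Cmd) : Decidable p.keepsInput := by unfold Cmd.keepsInput; infer_instance

section Spec

variable {Φ : Network N} {ed : Fin Φ.commEdges.card ≃ Φ.commEdges} {s s' : State} {ω : Tape}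

theorem Env.frame {p : Cmd} (h : Env Φ ed s) (hf : Frame p s s') (hp : p.keepsInput) :
    Env Φ ed s' := by
  obtain ⟨h1, h2, h3, h4, h5, h6, h7, h8, h9, h10⟩ := hp
  constructor
  · rw [hf.nreg 0 h1, h.nodes]
  · rw [hf.nreg 1 h2, h.edges]
  · rw [hf.rreg 0 h3, h.power]
  · rw [hf.rreg 1 h4, h.threshold]
  · rw [hf.rreg 3 h5, h.loss]
  · rw [hf.rreg 4 h6, h.noise]
  · rw [hf.narr 0 h7]; exact h.src
  · rw [hf.narr 1 h8]; exact h.dst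
  · rw [hf.rarr 0 h9]; exact h.xpos
  · rw [hf.rarr 1 h10]; exact h.ypos

/-- The machine has no square root; the distance is computed as a power with exponent 1/2. -/
theorem Env.eval_powerExp (h : Env Φ ed s) {t r : NExp} {a b : Fin N} (ht : t.eval s = a)
    (hr : r.eval s = b) : (powerExp t r).eval s = Φ.power a b := by
  simp only [powerExp, RExp.eval, ht, hr, h.xpos, h.ypos, h.power, h.loss, Network.power,
    EuclideanSpace.dist_eq, Real.sqrt_eq_rpow, Fin.sum_univ_two, Real.dist_eq, sq_abs]
  norm_num [sq]

/-- With registers `10`, `11` holding `x`. -/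
def HoldsLink (s : State) (x : Link N) : Prop := s.nreg 10 = x.1 ∧ s.nreg 11 = x.2

theorem clearLoop_spec (ω : Tape) (s : State) :
    Runs ω clearLoop s fun t s' => t ≤ (s.nreg 3 + 3) * (clearBody.maxCost + 13) ∧
      ∀ c ≤ s.nreg 3 + 1, s'.narr 10 c = 0 ∧ s'.rarr 3 c = 0 := by
  refine (Runs.forN (s.nreg 3 + 2) clearBody.maxCost
    (fun j s' => ∀ c < j, s'.narr 10 c = 0 ∧ s'.rarr 3 c = 0) (by decide) ?_ ?_ ?_ ?_).mono ?_
  · intro s' hf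
    simp [NExp.eval, hf.nreg 3 (by decide)]
  · exact fun _ _ _ h => h
  · simp
  · intro j hj s' hf hi hI
    refine Runs.of_loopFree (by decide) fun t ht _ => ⟨ht, fun c hc => ?_⟩
    simp only [clearBody, Cmd.run, NExp.eval, RExp.eval, hi, Function.update_self]
    rcases Nat.lt_succ_iff_lt_or_eq.1 hc with h | rfl
    · simp [Function.update_of_ne h.ne, hI c h]
    · simp
  · rintro t s' ⟨h1, h2⟩
    refine ⟨?_, fun c hc => h2 c (by omega)⟩
    simpa [NExp.cost, add_assoc] using h1

open Classical in
/-- The link `ed i` tolerates the interference by `x` when it gets `I` from the links of its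
colour. -/
def Tolerates (Φ : Network N) (x h : Link N) (I : ℝ) : Prop :=
  ¬ PrimaryConflict x h ∧ Φ.γc ≤ Φ.power h.1 h.2 / (Φ.N₀ + (I + Φ.power x.1 h.2))

theorem eval_natEqTest (x y : NExp) : (natEqTest x y).eval s ↔ x.eval s = y.eval s := by
  simp [natEqTest, Test.eval, le_antisymm_iff]

theorem Env.eval_tolerateTest (h : Env Φ ed s) {x : Link N} (hx : HoldsLink s x)
    (i : Fin Φ.commEdges.card) (hi : s.nreg 4 = i) :
    tolerateTest.eval s ↔ Tolerates Φ x (ed i).1 (s.rarr 2 i) := by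
  have h1 : (powerExp (.get 0 (.reg 4)) (.get 1 (.reg 4))).eval s =
      Φ.power (ed i).1.1 (ed i).1.2 :=
    h.eval_powerExp (by simp [NExp.eval, hi, h.src]) (by simp [NExp.eval, hi, h.dst])
  have h2 : (powerExp (.reg 10) (.get 1 (.reg 4))).eval s = Φ.power x.1 (ed i).1.2 :=
    h.eval_powerExp (by simp [NExp.eval, hx.1]) (by simp [NExp.eval, hi, h.dst])
  simp only [tolerateTest, Test.eval, eval_natEqTest, NExp.eval, RExp.eval, h1, h2, hi, h.src, h.dst,
    hx.1, hx.2, h.threshold, h.noise, Tolerates, PrimaryConflict, Fin.val_inj, not_or, and_assoc]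

open Classical in
theorem scanLoop_spec (h : Env Φ ed s) {x : Link N} (hx : HoldsLink s x) (K : ℕ)
    (hz : ∀ c ≤ K, s.narr 10 c = 0 ∧ s.rarr 3 c = 0) :
    Runs ω scanLoop s fun t s' => t ≤ (Φ.commEdges.card + 1) * (scanBody.maxCost + 11) ∧
      ∀ c ≤ K, s'.rarr 3 c = (∑ i : Fin Φ.commEdges.card,
          if s.narr 3 i = c then Φ.power (ed i).1.1 x.2 else 0) ∧
        (s'.narr 10 c = 0 ↔ ∀ i : Fin Φ.commEdges.card, s.narr 3 i = c →
          Tolerates Φ x (ed i).1 (s.rarr 2 i)) := by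
  refine (Runs.forN Φ.commEdges.card scanBody.maxCost
    (fun j s' => ∀ c ≤ K, s'.rarr 3 c = (∑ i : Fin Φ.commEdges.card,
          if (i : ℕ) < j then (if s.narr 3 i = c then Φ.power (ed i).1.1 x.2 else 0) else 0) ∧
        (s'.narr 10 c = 0 ↔ ∀ i : Fin Φ.commEdges.card, (i : ℕ) < j → s.narr 3 i = c →
          Tolerates Φ x (ed i).1 (s.rarr 2 i))) (by decide) ?_ ?_ ?_ ?_).mono ?_
  · intro s' hf
    simp [NExp.eval, hf.nreg 1 (by decide), h.edges]
  · exact fun _ _ _ h => h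
  · intro c hc
    simp [hz c hc]
  · intro j hj s' hf hi hI
    refine Runs.of_loopFree (by decide) fun t ht hf' => ⟨ht, fun c hc => ?_⟩
    have he' : Env Φ ed s' := h.frame hf (by decide)
    have hx' : HoldsLink s' x := ⟨by rw [hf.nreg 10 (by decide), hx.1],
      by rw [hf.nreg 11 (by decide), hx.2]⟩
    obtain ⟨hI1, hI2⟩ := hI c hc
    have h3 : s'.narr 3 = s.narr 3 := hf.narr 3 (by decide)
    have h2 : s'.rarr 2 = s.rarr 2 := hf.rarr 2 (by decide)
    have hpow : (powerExp (.get 0 (.reg 4)) (.reg 11)).eval s' = Φ.power (ed ⟨j, hj⟩).1.1 x.2 :=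
      he'.eval_powerExp (by simp [NExp.eval, hi, he'.src ⟨j, hj⟩]) (by simp [NExp.eval, hx'.2])
    -- The test is evaluated after the accumulation, but it does not read real array 3, so its
    -- meaning is unchanged.
    set s₁ : State := Cmd.run ω (.rput 3 (.get 3 (.reg 4))
      (.add (.get 3 (.get 3 (.reg 4))) (powerExp (.get 0 (.reg 4)) (.reg 11)))) s' with hs₁
    have hfr₁ : Frame scanBody s' s₁ := by
      obtain ⟨t, _, he⟩ := exists_exec_run ω (.rput 3 (.get 3 (.reg 4))
        (.add (.get 3 (.get 3 (.reg 4))) (powerExp (.get 0 (.reg 4)) (.reg 11)))) s' rfl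
      exact he.frame.mono (writesLE_seq_left _ _)
    have he₁ : Env Φ ed s₁ := he'.frame hfr₁ (by decide)
    have htest := he₁.eval_tolerateTest (x := x) ⟨hx'.1, hx'.2⟩ ⟨j, hj⟩ hi
    have hr2 : s₁.rarr 2 = s.rarr 2 := by
      rw [← h2]
      simp [hs₁, Cmd.run]
    rw [hr2] at htest
    have hr3 : s₁.rarr 3 c = s'.rarr 3 c +
        if s.narr 3 j = c then Φ.power (ed ⟨j, hj⟩).1.1 x.2 else 0 := by
      simp only [hs₁, Cmd.run, NExp.eval, RExp.eval, hi, hpow, h3, Function.update_self]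
      by_cases hc : s.narr 3 j = c
      · subst hc; simp
      · rw [Function.update_of_ne (Ne.symm hc)]; simp [hc]
    have hrun : scanBody.run ω s' = if tolerateTest.eval s₁ then s₁ else
        Cmd.run ω (.nput 10 (.get 3 (.reg 4)) (.const 1)) s₁ := rfl
    have hsum : (∑ i : Fin Φ.commEdges.card,
          if (i : ℕ) < j + 1 then (if s.narr 3 i = c then Φ.power (ed i).1.1 x.2 else 0) else 0) =
        (∑ i : Fin Φ.commEdges.card,
          if (i : ℕ) < j then (if s.narr 3 i = c then Φ.power (ed i).1.1 x.2 else 0) else 0) +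
          if s.narr 3 j = c then Φ.power (ed ⟨j, hj⟩).1.1 x.2 else 0 := by
      have : ∀ i : Fin Φ.commEdges.card,
          (if (i : ℕ) < j + 1 then (if s.narr 3 i = c then Φ.power (ed i).1.1 x.2 else 0) else 0) =
          (if (i : ℕ) < j then (if s.narr 3 i = c then Φ.power (ed i).1.1 x.2 else 0) else 0) +
          if i = ⟨j, hj⟩ then
            (if s.narr 3 i = c then Φ.power (ed i).1.1 x.2 else 0) else 0 := by
        intro i
        have : (i = ⟨j, hj⟩) ↔ (i : ℕ) = j := Fin.ext_iff
        rcases lt_trichotomy (i : ℕ) j with hlt | heq | hgt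
        · have h1 : (i : ℕ) < j + 1 := by omega
          have h2 : ¬ (i : ℕ) = j := by omega
          simp [hlt, h1, this, h2]
        · simp [heq, this]
        · have h1 : ¬ (i : ℕ) < j + 1 := by omega
          have h2 : ¬ (i : ℕ) = j := by omega
          have h3 : ¬ (i : ℕ) < j := by omega
          simp [h1, this, h2, h3]
      rw [Finset.sum_congr rfl fun i _ => this i, Finset.sum_add_distrib, Finset.sum_ite_eq']
      simp
    have hall : (∀ i : Fin Φ.commEdges.card, (i : ℕ) < j + 1 → s.narr 3 i = c →
          Tolerates Φ x (ed i).1 (s.rarr 2 i)) ↔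
        (∀ i : Fin Φ.commEdges.card, (i : ℕ) < j → s.narr 3 i = c →
          Tolerates Φ x (ed i).1 (s.rarr 2 i)) ∧
        (s.narr 3 j = c → Tolerates Φ x (ed ⟨j, hj⟩).1 (s.rarr 2 j)) := by
      constructor
      · exact fun H => ⟨fun i hi => H i (by omega), H ⟨j, hj⟩ (by simp)⟩
      · rintro ⟨H1, H2⟩ i hi
        rcases Nat.lt_succ_iff_lt_or_eq.1 hi with hi | hi
        · exact H1 i hi
        · obtain rfl : i = ⟨j, hj⟩ := Fin.ext hi
          exact H2
    rw [hsum, hall, ← hI1, ← hr3, ← hI2, hrun]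
    have hn10 : s₁.narr 10 = s'.narr 10 := rfl
    have hn3 : s₁.narr 3 = s.narr 3 := h3
    have hreg : s₁.nreg 4 = j := hi
    by_cases hb : tolerateTest.eval s₁
    · rw [if_pos hb]
      refine ⟨rfl, ?_⟩
      have := htest.1 hb
      simp only [hn10]
      tauto
    · rw [if_neg hb]
      refine ⟨rfl, ?_⟩
      have hnt : ¬ Tolerates Φ x (ed ⟨j, hj⟩).1 (s.rarr 2 j) := fun h' => hb (htest.2 h')
      simp only [Cmd.run, NExp.eval, hreg, hn3, Function.update_self, hn10]
      by_cases hcj : s.narr 3 j = c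
      · subst hcj
        simp [hnt]
      · rw [Function.update_of_ne (Ne.symm hcj)]
        simp [hcj]
  · rintro t s' ⟨h1, h2⟩
    refine ⟨by simpa [NExp.cost, add_assoc] using h1, fun c hc => ?_⟩
    simpa using h2 c hc

end Spec

end STDMA
end

noncomputable section

namespace STDMA

/-! ### Selecting a colour and keeping the cached interferences up to date -/

section Spec

variable {N : ℕ} {Φ : Network N} {ed : Fin Φ.commEdges.card ≃ Φ.commEdges} {s s' : State}
  {ω : Tape}

theorem HoldsLink.frame {p : Cmd} {x : Link N} (h : HoldsLink s x) (hf : Frame p s s')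
    (h10 : 10 ∉ p.nregW) (h11 : 11 ∉ p.nregW) : HoldsLink s' x :=
  ⟨by rw [hf.nreg 10 h10, h.1], by rw [hf.nreg 11 h11, h.2]⟩

theorem findLoop_spec (h : Env Φ ed s) {x : Link N} (hx : HoldsLink s x) (good : ℕ → Prop)
    (hgood : ∀ r, good r ↔ s.narr 10 r = 0 ∧ Φ.γc ≤ Φ.power x.1 x.2 / (Φ.N₀ + s.rarr 3 r)) :
    Runs ω findLoop s fun t s' => t ≤ (s.nreg 3 + 1) * (findBody.maxCost + 11) + 4 ∧
      (1 ≤ s'.nreg 12 ∧ s'.nreg 12 ≤ s.nreg 3 ∧ good (s'.nreg 12) ∨ s'.nreg 12 = s.nreg 3 + 1) ∧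
      ∀ r, 1 ≤ r → r < s'.nreg 12 → ¬ good r := by
  apply Runs.seq
  refine ⟨_, _, .nset 12 _ s, ?_⟩
  set s₀ : State := { s with nreg := Function.update s.nreg 12 (NExp.eval s (.add (.reg 3)
    (.const 1))) } with hs₀
  have he₀ : Env Φ ed s₀ := h.frame (Exec.nset (ω := ω) 12 _ s).frame (by decide)
  have hx₀ : HoldsLink s₀ x := by
    constructor <;> simp [hs₀, hx.1, hx.2]
  have hK : s₀.nreg 3 = s.nreg 3 := by simp [hs₀]
  refine (Runs.forN (s.nreg 3) findBody.maxCost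
    -- After `j` steps exactly the colours above K - j have been tried, and register 12 holds the
    -- least good one among them, or K + 1 if there is none.
    (fun j s' => (s.nreg 3 < s'.nreg 12 + j ∧ s'.nreg 12 ≤ s.nreg 3 ∧ good (s'.nreg 12) ∨
        s'.nreg 12 = s.nreg 3 + 1) ∧
      ∀ r, s.nreg 3 < r + j → r < s'.nreg 12 → ¬ good r) (by decide) ?_ ?_ ?_ ?_).mono ?_
  · intro s' hf
    simp [NExp.eval, hf.nreg 3 (by decide), hK]
  · intro j s' y hI
    simpa [State.setN] using hI
  · refine ⟨.inr ?_, fun r hr hr' => ?_⟩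
    · simp [hs₀, NExp.eval]
    · simp [hs₀, NExp.eval] at hr'
      omega
  · intro j hj s' hf hi hI
    refine Runs.of_loopFree (by decide) fun t ht hf' => ⟨ht, ?_⟩
    have he' : Env Φ ed s' := he₀.frame hf (by decide)
    have hx' : HoldsLink s' x := hx₀.frame hf (by decide) (by decide)
    have h3 : s'.nreg 3 = s.nreg 3 := (hf.nreg 3 (by decide)).trans hK
    have hn10 : s'.narr 10 = s.narr 10 := hf.narr 10 (by decide)
    have hr3 : s'.rarr 3 = s.rarr 3 := hf.rarr 3 (by decide)
    have hpow : (powerExp (.reg 10) (.reg 11)).eval s' = Φ.power x.1 x.2 :=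
      he'.eval_powerExp hx'.1 hx'.2
    have hb : (Test.and (.nle (.get 10 (.sub (.reg 3) (.reg 4))) (.const 0))
      (.rle (.reg 1) (.div (powerExp (.reg 10) (.reg 11))
        (.add (.reg 4) (.get 3 (.sub (.reg 3) (.reg 4))))))).eval s' ↔ good (s.nreg 3 - j) := by
      rw [hgood]
      simp only [Test.eval, NExp.eval, RExp.eval, hpow, h3, hi, hn10, hr3, he'.threshold, he'.noise,
        Nat.le_zero]
    by_cases hg : good (s.nreg 3 - j)
    · have hrun : findBody.run ω s' = s'.setN 12 (s.nreg 3 - j) := by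
        rw [findBody, Cmd.run, if_pos (hb.2 hg)]
        simp [Cmd.run, NExp.eval, h3, hi, State.setN]
      rw [hrun]
      have : (s'.setN 12 (s.nreg 3 - j)).nreg 12 = s.nreg 3 - j := by simp [State.setN]
      rw [this]
      exact ⟨.inl ⟨by omega, by omega, hg⟩, fun r hr hr' => by omega⟩
    · have hrun : findBody.run ω s' = s' := by
        rw [findBody, Cmd.run, if_neg (fun h => hg (hb.1 h))]
        rfl
      rw [hrun]
      refine ⟨?_, fun r hr hr' => ?_⟩
      · rcases hI.1 with h | h
        · exact .inl ⟨by omega, h.2⟩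
        · exact .inr h
      · by_cases hrj : s.nreg 3 < r + j
        · exact hI.2 r hrj hr'
        · obtain rfl : r = s.nreg 3 - j := by omega
          exact hg
  · rintro t s' ⟨h1, h2, h3⟩
    refine ⟨?_, ?_, fun r hr hr' => h3 r (by omega) hr'⟩
    · simp only [NExp.cost] at h1 ⊢
      have : findBody.maxCost + 1 + 10 = findBody.maxCost + 11 := by ring
      rw [this] at h1
      omega
    · rcases h2 with h | h
      · exact .inl ⟨by omega, h.2⟩
      · exact .inr h

open Classical in
theorem updateLoop_spec (h : Env Φ ed s) {x : Link N} (hx : HoldsLink s x) :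
    Runs ω updateLoop s fun t s' => t ≤ (Φ.commEdges.card + 1) * (updateBody.maxCost + 11) ∧
      ∀ i : Fin Φ.commEdges.card,
        s'.narr 3 i = (if (ed i).1 = x then s.nreg 12 else s.narr 3 i) ∧
        s'.rarr 2 i = (if (ed i).1 = x then s.rarr 3 (s.nreg 12) else
          if s.narr 3 i = s.nreg 12 then s.rarr 2 i + Φ.power x.1 (ed i).1.2 else s.rarr 2 i) := by
  refine (Runs.forN Φ.commEdges.card updateBody.maxCost
    -- Entries from `j` on are still the old ones, so the comparison in step `j` sees the colour
    -- before the update.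
    (fun j s' => ∀ i : Fin Φ.commEdges.card, if (i : ℕ) < j then
        s'.narr 3 i = (if (ed i).1 = x then s.nreg 12 else s.narr 3 i) ∧
        s'.rarr 2 i = (if (ed i).1 = x then s.rarr 3 (s.nreg 12) else
          if s.narr 3 i = s.nreg 12 then s.rarr 2 i + Φ.power x.1 (ed i).1.2 else s.rarr 2 i)
        else s'.narr 3 i = s.narr 3 i ∧ s'.rarr 2 i = s.rarr 2 i) (by decide) ?_ ?_ ?_ ?_).mono ?_
  · intro s' hf
    simp [NExp.eval, hf.nreg 1 (by decide), h.edges]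
  · exact fun _ _ _ h => h
  · simp
  · intro j hj s' hf hi hI
    refine Runs.of_loopFree (by decide) fun t ht hf' => ⟨ht, fun i => ?_⟩
    have he' : Env Φ ed s' := h.frame hf (by decide)
    have hx' : HoldsLink s' x := hx.frame hf (by decide) (by decide)
    have hn12 : s'.nreg 12 = s.nreg 12 := hf.nreg 12 (by decide)
    have hr3 : s'.rarr 3 = s.rarr 3 := hf.rarr 3 (by decide)
    have hpow : (powerExp (.reg 10) (.get 1 (.reg 4))).eval s' =
        Φ.power x.1 (ed ⟨j, hj⟩).1.2 :=
      he'.eval_powerExp hx'.1 (by simp [NExp.eval, hi, he'.dst ⟨j, hj⟩])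
    have hIj := hI ⟨j, hj⟩
    simp only [lt_irrefl, if_false] at hIj
    have hb1 : (Test.and (natEqTest (.reg 10) (.get 0 (.reg 4)))
        (natEqTest (.reg 11) (.get 1 (.reg 4)))).eval s' ↔ (ed ⟨j, hj⟩).1 = x := by
      simp only [Test.eval, eval_natEqTest, NExp.eval, hx'.1, hx'.2, hi, he'.src ⟨j, hj⟩,
        he'.dst ⟨j, hj⟩, Fin.val_inj, Prod.ext_iff]
      exact ⟨fun h => ⟨h.1.symm, h.2.symm⟩, fun h => ⟨h.1.symm, h.2.symm⟩⟩
    have hb2 : (natEqTest (.get 3 (.reg 4)) (.reg 12)).eval s' ↔ s.narr 3 j = s.nreg 12 := by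
      simp only [eval_natEqTest, NExp.eval, hi, hn12, hIj.1]
    have key : ∀ s'' : State, (∀ k, k ≠ j → s''.narr 3 k = s'.narr 3 k ∧
        s''.rarr 2 k = s'.rarr 2 k) →
        (s''.narr 3 j = (if (ed ⟨j, hj⟩).1 = x then s.nreg 12 else s.narr 3 j) ∧
        s''.rarr 2 j = (if (ed ⟨j, hj⟩).1 = x then s.rarr 3 (s.nreg 12) else
          if s.narr 3 j = s.nreg 12 then s.rarr 2 j + Φ.power x.1 (ed ⟨j, hj⟩).1.2
          else s.rarr 2 j)) →
        if (i : ℕ) < j + 1 then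
        s''.narr 3 i = (if (ed i).1 = x then s.nreg 12 else s.narr 3 i) ∧
        s''.rarr 2 i = (if (ed i).1 = x then s.rarr 3 (s.nreg 12) else
          if s.narr 3 i = s.nreg 12 then s.rarr 2 i + Φ.power x.1 (ed i).1.2 else s.rarr 2 i)
        else s''.narr 3 i = s.narr 3 i ∧ s''.rarr 2 i = s.rarr 2 i := by
      intro s'' h1 h2
      rcases lt_trichotomy (i : ℕ) j with hlt | heq | hgt
      · have := hI i
        rw [if_pos hlt] at this
        rw [if_pos (by omega), (h1 i hlt.ne).1, (h1 i hlt.ne).2]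
        exact this
      · obtain rfl : i = ⟨j, hj⟩ := Fin.ext heq
        rw [if_pos (by simp)]
        exact h2
      · have := hI i
        rw [if_neg (by omega)] at this
        rw [if_neg (by omega), (h1 i hgt.ne').1, (h1 i hgt.ne').2]
        exact this
    apply key
    · intro k hk
      unfold updateBody
      rw [Cmd.run]
      split_ifs
      · simp [Cmd.run, NExp.eval, RExp.eval, hi, hk]
      · rw [Cmd.run]
        split_ifs
        · simp [Cmd.run, NExp.eval, RExp.eval, hi, hk]
        · simp [Cmd.run]
    · unfold updateBody
      rw [Cmd.run]
      by_cases h1 : (ed ⟨j, hj⟩).1 = x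
      · rw [if_pos (hb1.2 h1), if_pos h1, if_pos h1]
        simp [Cmd.run, NExp.eval, RExp.eval, hi, hn12, hr3]
      · rw [if_neg (fun h => h1 (hb1.1 h)), if_neg h1, if_neg h1, Cmd.run]
        by_cases h2 : s.narr 3 j = s.nreg 12
        · rw [if_pos (hb2.2 h2), if_pos h2]
          simp [Cmd.run, NExp.eval, RExp.eval, hi, hIj.1, hIj.2, hpow]
        · rw [if_neg (fun h => h2 (hb2.1 h)), if_neg h2]
          simpa [Cmd.run] using hIj
  · rintro t s' ⟨h1, h2⟩
    refine ⟨by simpa [NExp.cost, add_assoc] using h1, fun i => ?_⟩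
    simpa using h2 i

open Classical in
/-- The memory holds the partial colouring `C`, the number of its links and of its colours, and the
interference at the receiver of each coloured link. -/
structure ColorState (Φ : Network N) (ed : Fin Φ.commEdges.card ≃ Φ.commEdges) (s : State)
    (C : Coloring N) : Prop where
  colors : ∀ i, s.narr 3 (i : Fin Φ.commEdges.card).val = C (ed i).1
  off : ∀ h, h ∉ Φ.commEdges → C h = 0
  count : s.nreg 2 = (Finset.univ.filter fun h => C h ≠ 0).card
  existing_eq : existing C = Finset.Icc 1 (s.nreg 3)
  interference : ∀ i : Fin Φ.commEdges.card, C (ed i).1 ≠ 0 → s.rarr 2 i =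
    ∑ g ∈ (Finset.univ.filter fun g => C g = C (ed i).1).erase (ed i).1, Φ.power g.1 (ed i).1.2

open Classical in
theorem card_colored_le {C : Coloring N} (hoff : ∀ h, h ∉ Φ.commEdges → C h = 0) :
    (Finset.univ.filter fun h => C h ≠ 0).card ≤ Φ.commEdges.card := by
  apply Finset.card_le_card
  intro h hh
  by_contra hn
  exact (Finset.mem_filter.1 hh).2 (hoff h hn)

open Classical in
theorem ColorState.colors_le {C : Coloring N} (h : ColorState Φ ed s C) :
    s.nreg 3 ≤ Φ.commEdges.card := by
  have h1 : (existing C).card = s.nreg 3 := by rw [h.existing_eq]; simp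
  have h2 : (existing C).card ≤ (Finset.univ.filter fun h => C h ≠ 0).card := by
    unfold existing
    exact Finset.card_image_le
  have h3 := card_colored_le h.off
  omega

-- Only for a nonzero colour does the class consist of communication edges; colour 0 also contains
-- every pair that is not an edge.
open Classical in
theorem sum_edges_eq {C : Coloring N} (hoff : ∀ h, h ∉ Φ.commEdges → C h = 0) {c : ℕ} (hc : c ≠ 0)
    (f : Link N → ℝ) : (∑ i : Fin Φ.commEdges.card, if C (ed i).1 = c then f (ed i).1 else 0) =
      ∑ g ∈ Finset.univ.filter (fun g => C g = c), f g := by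
  rw [Equiv.sum_comp ed (fun g => if C g.1 = c then f g.1 else 0),
    Finset.sum_coe_sort Φ.commEdges (fun g => if C g = c then f g else 0), ← Finset.sum_filter]
  congr 1
  ext g
  simp only [Finset.mem_filter, Finset.mem_univ, true_and, and_iff_right_iff_imp]
  intro hg
  by_contra hn
  exact hc (hg ▸ hoff g hn)

theorem mem_existing {C : Coloring N} {r : ℕ} : r ∈ existing C ↔ r ≠ 0 ∧ ∃ h, C h = r := by
  simp only [existing, Finset.mem_image, Finset.mem_filter, Finset.mem_univ, true_and]
  constructor
  · rintro ⟨h, h1, rfl⟩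
    exact ⟨h1, h, rfl⟩
  · rintro ⟨h1, h, rfl⟩
    exact ⟨h, h1, rfl⟩

theorem mem_conflicting {C : Coloring N} {x : Link N} {r : ℕ} :
    r ∈ conflicting C x ↔ r ≠ 0 ∧ ∃ h, C h = r ∧ PrimaryConflict x h := by
  simp only [conflicting, Finset.mem_image, Finset.mem_filter, Finset.mem_univ, true_and]
  constructor
  · rintro ⟨h, ⟨h1, h2⟩, rfl⟩
    exact ⟨h1, h, rfl, h2⟩
  · rintro ⟨h1, h, rfl, h2⟩
    exact ⟨h, ⟨h1, h2⟩, rfl⟩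

-- This is the form the program can check: a condition at the new receiver, involving the
-- accumulator, and one at each old receiver, involving the cached interference plus a single new
-- term.
open Classical in
theorem sinrCompliant_iff {C : Coloring N} {x : Link N} (hx : C x = 0) {r : ℕ} (hr : r ≠ 0) :
    SINRCompliant Φ C x r ↔
      (Φ.γc ≤ Φ.power x.1 x.2 /
        (Φ.N₀ + ∑ g ∈ Finset.univ.filter (fun g => C g = r), Φ.power g.1 x.2)) ∧
      ∀ h, C h = r → Φ.γc ≤ Φ.power h.1 h.2 / (Φ.N₀ +
        (∑ g ∈ (Finset.univ.filter fun g => C g = r).erase h, Φ.power g.1 h.2 +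
          Φ.power x.1 h.2)) := by
  have hxS : x ∉ Finset.univ.filter fun g => C g = r := by simp [hx, hr.symm]
  unfold SINRCompliant Network.SINR
  rw [Finset.forall_mem_insert, Finset.erase_insert hxS]
  refine and_congr Iff.rfl (forall_congr' fun h => ?_)
  simp only [Finset.mem_filter, Finset.mem_univ, true_and]
  refine imp_congr_right fun hh => ?_
  have hne : x ≠ h := by
    rintro rfl
    exact hr (hh.symm.trans hx)
  rw [Finset.erase_insert_of_ne hne, Finset.sum_insert (by simp [hx, hr.symm]),
    add_comm (Φ.power x.1 h.2)]

-- Since the colours in use form an initial interval, testing `r ≤ K` decides whether a colour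
-- exists, and the new colour is K + 1.
open Classical in
theorem firstConflictFreeColor_eq {C : Coloring N} {x : Link N} {K r : ℕ}
    (hK : existing C = Finset.Icc 1 K)
    (h : (1 ≤ r ∧ r ≤ K ∧ r ∉ conflicting C x ∧ SINRCompliant Φ C x r) ∨ r = K + 1)
    (hmin : ∀ r', 1 ≤ r' → r' < r → ¬ (r' ∉ conflicting C x ∧ SINRCompliant Φ C x r')) :
    firstConflictFreeColor Φ C x = r := by
  have hmem : ∀ r', r' ∈ (existing C \ conflicting C x).filter (SINRCompliant Φ C x) ↔
      1 ≤ r' ∧ r' ≤ K ∧ r' ∉ conflicting C x ∧ SINRCompliant Φ C x r' := by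
    intro r'
    rw [Finset.mem_filter, Finset.mem_sdiff, hK, Finset.mem_Icc]
    tauto
  unfold firstConflictFreeColor
  split_ifs with hne
  · have h1 := Finset.min'_mem _ hne
    rcases h with h | h
    · apply le_antisymm
      · exact Finset.min'_le _ _ ((hmem r).2 h)
      · by_contra hlt
        have h2 := (hmem _).1 h1
        exact hmin _ h2.1 (not_le.1 hlt) h2.2.2
    · have h2 := (hmem _).1 h1
      exact (hmin _ h2.1 (by omega) h2.2.2).elim
  · rcases h with h | h
    · exact (hne ⟨r, (hmem r).2 h⟩).elim
    · rw [hK, h]; simp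

end Spec

end STDMA
end

noncomputable section

namespace STDMA

/-! ### Correctness and linear cost of colouring one link -/

section Spec

variable {N : ℕ} {Φ : Network N} {ed : Fin Φ.commEdges.card ≃ Φ.commEdges} {s s' : State}
  {ω : Tape}

open Classical in
theorem firstConflictFreeColor_ne_zero (Φ : Network N) (C : Coloring N) (x : Link N) :
    firstConflictFreeColor Φ C x ≠ 0 := by
  unfold firstConflictFreeColor
  split_ifs with h
  · have := Finset.min'_mem _ h
    rw [Finset.mem_filter, Finset.mem_sdiff] at this
    exact (mem_existing.1 this.1.1).1
  · omega

open Classical in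
theorem existing_update {C : Coloring N} {x : Link N} (hx : C x = 0) {r : ℕ} (hr : r ≠ 0) :
    existing (Function.update C x r) = insert r (existing C) := by
  ext c
  rw [Finset.mem_insert, mem_existing, mem_existing]
  constructor
  · rintro ⟨hc, h, rfl⟩
    by_cases hh : h = x
    · subst hh; left; simp
    · right
      exact ⟨hc, h, by rw [Function.update_of_ne hh]⟩
  · rintro (rfl | ⟨hc, h, rfl⟩)
    · exact ⟨hr, x, by simp⟩
    · refine ⟨hc, h, ?_⟩
      rw [Function.update_of_ne]
      rintro rfl
      exact hc hx

open Classical in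
theorem card_colored_update {C : Coloring N} {x : Link N} (hx : C x = 0) {r : ℕ} (hr : r ≠ 0) :
    (Finset.univ.filter fun h => Function.update C x r h ≠ 0).card =
      (Finset.univ.filter fun h => C h ≠ 0).card + 1 := by
  have : (Finset.univ.filter fun h => Function.update C x r h ≠ 0) =
      insert x (Finset.univ.filter fun h => C h ≠ 0) := by
    ext h
    by_cases hh : h = x
    · subst hh; simp [hr]
    · simp [hh]
  rw [this, Finset.card_insert_of_notMem (by simp [hx])]

open Classical in
theorem colorClass_update_self {C : Coloring N} {x : Link N} {r : ℕ} :
    (Finset.univ.filter fun g => Function.update C x r g = r) =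
      insert x (Finset.univ.filter fun g => C g = r) := by
  ext g
  by_cases hg : g = x
  · subst hg; simp
  · simp [hg]

open Classical in
theorem colorClass_update_of_ne {C : Coloring N} {x : Link N} {r c : ℕ} (hx : C x ≠ c)
    (hr : r ≠ c) : (Finset.univ.filter fun g => Function.update C x r g = c) =
      Finset.univ.filter fun g => C g = c := by
  ext g
  by_cases hg : g = x
  · subst hg; simp [hx, hr]
  · simp [Function.update_of_ne hg]

theorem ColorState.frame {p : Cmd} {C : Coloring N} (h : ColorState Φ ed s C) (hf : Frame p s s')
    (h2 : 2 ∉ p.nregW) (h3 : 3 ∉ p.nregW) (h3' : 3 ∉ p.narrW) (h2' : 2 ∉ p.rarrW) :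
    ColorState Φ ed s' C where
  colors := by rw [hf.narr 3 h3']; exact h.colors
  off := h.off
  count := by rw [hf.nreg 2 h2]; exact h.count
  existing_eq := by rw [hf.nreg 3 h3]; exact h.existing_eq
  interference := by rw [hf.rarr 2 h2']; exact h.interference

theorem colorCmd_time_le {K e A B C D E t₁ t₂ t₃ t₄ t₅ : ℕ} (hK : K ≤ e) (h₁ : t₁ ≤ (K + 3) * A)
    (h₂ : t₂ ≤ (e + 1) * B) (h₃ : t₃ ≤ (K + 1) * C + 4) (h₄ : t₄ ≤ (e + 1) * D) (h₅ : t₅ ≤ E) :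
    t₁ + (t₂ + (t₃ + (t₄ + t₅))) ≤ (3 * A + B + C + 4 + D + E) * (e + 1) := by
  have h1 : (K + 3) * A ≤ (3 * (e + 1)) * A := Nat.mul_le_mul_right _ (by omega)
  have h3 : (K + 1) * C ≤ (e + 1) * C := Nat.mul_le_mul_right _ (by omega)
  have h5 : E ≤ (e + 1) * E := Nat.le_mul_of_pos_left _ (by omega)
  have : (3 * A + B + C + 4 + D + E) * (e + 1) = (3 * (e + 1)) * A + (e + 1) * B + (e + 1) * C +
      4 * (e + 1) + (e + 1) * D + (e + 1) * E := by ring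
  omega

-- Two of the loops run over the edges and two over the colours. There are at most as many colours
-- as edges, whence the linear time; the constant adds up the costs of the loop bodies.
open Classical in
theorem colorCmd_spec : ∃ c : ℕ, ∀ {N : ℕ} {Φ : Network N}
    {ed : Fin Φ.commEdges.card ≃ Φ.commEdges} {s : State} (ω : Tape) {C : Coloring N} {x : Link N},
    Env Φ ed s → ColorState Φ ed s C → HoldsLink s x → x ∈ Φ.commEdges → C x = 0 →
    Runs ω colorCmd s fun t s' => t ≤ c * (Φ.commEdges.card + 1) ∧ Env Φ ed s' ∧
      ColorState Φ ed s' (Function.update C x (firstConflictFreeColor Φ C x)) := by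
  refine ⟨3 * (clearBody.maxCost + 13) + (scanBody.maxCost + 11) + (findBody.maxCost + 11) + 4 +
    (updateBody.maxCost + 11) + countStep.maxCost, ?_⟩
  intro N Φ ed s ω C x he hC hl hx hx0
  have hKe := hC.colors_le
  set K := s.nreg 3 with hK
  apply Runs.seq
  refine (clearLoop_spec ω s).mono_frame ?_
  rintro t₁ s₁ hf₁ ⟨ht₁, hz⟩
  have he₁ : Env Φ ed s₁ := he.frame hf₁ (by decide)
  have hl₁ := hl.frame hf₁ (by decide) (by decide)
  have hC₁ := hC.frame hf₁ (by decide) (by decide) (by decide) (by decide)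
  have hK₁ : s₁.nreg 3 = K := hf₁.nreg 3 (by decide)
  apply Runs.seq
  -- The index K + 1 is included so that the accumulator of a new colour is known to be the empty
  -- sum, the correct interference of its first link.
  refine (scanLoop_spec he₁ hl₁ (K + 1) hz).mono_frame ?_
  rintro t₂ s₂ hf₂ ⟨ht₂, hscan⟩
  have he₂ : Env Φ ed s₂ := he₁.frame hf₂ (by decide)
  have hl₂ := hl₁.frame hf₂ (by decide) (by decide)
  have hC₂ := hC₁.frame hf₂ (by decide) (by decide) (by decide) (by decide)
  have hK₂ : s₂.nreg 3 = K := (hf₂.nreg 3 (by decide)).trans hK₁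
  have hacc : ∀ c, c ≠ 0 → c ≤ K + 1 →
      s₂.rarr 3 c = ∑ g ∈ Finset.univ.filter (fun g => C g = c), Φ.power g.1 x.2 := by
    intro c hc0 hc
    rw [(hscan c hc).1, ← sum_edges_eq (ed := ed) hC.off hc0 (fun g => Φ.power g.1 x.2)]
    exact Finset.sum_congr rfl fun i _ => by rw [hC₁.colors i]
  have hgood : ∀ r, 1 ≤ r → r ≤ K →
      ((s₂.narr 10 r = 0 ∧ Φ.γc ≤ Φ.power x.1 x.2 / (Φ.N₀ + s₂.rarr 3 r)) ↔
        (r ∉ conflicting C x ∧ SINRCompliant Φ C x r)) := by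
    intro r hr1 hr2
    have hr0 : r ≠ 0 := by omega
    rw [(hscan r (by omega)).2, hacc r hr0 (by omega), sinrCompliant_iff hx0 hr0, mem_conflicting]
    have hint : ∀ i : Fin Φ.commEdges.card, C (ed i).1 = r → s₁.rarr 2 i =
        ∑ g ∈ (Finset.univ.filter fun g => C g = r).erase (ed i).1, Φ.power g.1 (ed i).1.2 := by
      intro i hi
      have := hC₁.interference i (by rw [hi]; exact hr0)
      rwa [hi] at this
    have hsurj : ∀ h, C h = r → ∃ i : Fin Φ.commEdges.card, (ed i).1 = h := by
      intro h hh
      have hm : h ∈ Φ.commEdges := by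
        by_contra hn
        exact hr0 (hh ▸ hC.off h hn)
      exact ⟨ed.symm ⟨h, hm⟩, by simp⟩
    constructor
    · rintro ⟨h1, h2⟩
      refine ⟨?_, h2, ?_⟩
      · rintro ⟨-, h, hh, hconf⟩
        obtain ⟨i, rfl⟩ := hsurj h hh
        exact (h1 i ((hC₁.colors i).trans hh)).1 hconf
      · intro h hh
        obtain ⟨i, rfl⟩ := hsurj h hh
        have := (h1 i ((hC₁.colors i).trans hh)).2
        rwa [hint i hh] at this
    · rintro ⟨h1, h2, h3⟩
      refine ⟨fun i hi => ?_, h2⟩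
      have hh : C (ed i).1 = r := (hC₁.colors i).symm.trans hi
      refine ⟨fun hconf => h1 ⟨hr0, _, hh, hconf⟩, ?_⟩
      rw [hint i hh]
      exact h3 _ hh
  apply Runs.seq
  refine (findLoop_spec he₂ hl₂ _ fun r => Iff.rfl).mono_frame ?_
  rintro t₃ s₃ hf₃ ⟨ht₃, hfind, hmin⟩
  have he₃ : Env Φ ed s₃ := he₂.frame hf₃ (by decide)
  have hl₃ := hl₂.frame hf₃ (by decide) (by decide)
  have hC₃ := hC₂.frame hf₃ (by decide) (by decide) (by decide) (by decide)
  have hK₃ : s₃.nreg 3 = K := (hf₃.nreg 3 (by decide)).trans hK₂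
  have hacc₃ : s₃.rarr 3 = s₂.rarr 3 := hf₃.rarr 3 (by decide)
  rw [hK₂] at ht₃ hfind
  set r := s₃.nreg 12 with hr
  have hr1 : 1 ≤ r := by rcases hfind with h | h <;> omega
  have hrK : r ≤ K + 1 := by rcases hfind with h | h <;> omega
  have hfc : firstConflictFreeColor Φ C x = r := by
    apply firstConflictFreeColor_eq (K := K) hC.existing_eq
    · rcases hfind with h | h
      · exact .inl ⟨h.1, h.2.1, (hgood r h.1 h.2.1).1 h.2.2⟩
      · exact .inr h
    · intro r' h1 h2 h3
      exact hmin r' h1 h2 ((hgood r' h1 (by omega)).2 h3)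
  apply Runs.seq
  refine (updateLoop_spec he₃ hl₃).mono_frame ?_
  rintro t₄ s₄ hf₄ ⟨ht₄, hup⟩
  have he₄ : Env Φ ed s₄ := he₃.frame hf₄ (by decide)
  have hK₄ : s₄.nreg 3 = K := (hf₄.nreg 3 (by decide)).trans hK₃
  have hr₄ : s₄.nreg 12 = r := hf₄.nreg 12 (by decide)
  have hc₄ : s₄.nreg 2 = s₃.nreg 2 := hf₄.nreg 2 (by decide)
  refine Runs.of_loopFree (by decide) fun t₅ ht₅ hf₅ => ⟨?_, he₄.frame hf₅ (by decide), ?_⟩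
  · exact colorCmd_time_le hKe ht₁ ht₂ ht₃ ht₄ ht₅
  · rw [hfc]
    have hcolor : ∀ i : Fin Φ.commEdges.card, s₄.narr 3 i = Function.update C x r (ed i).1 := by
      intro i
      rw [(hup i).1, hC₃.colors i, Function.update_apply]
    have hn3 : (countStep.run ω s₄).narr 3 = s₄.narr 3 := hf₅.narr 3 (by decide)
    have hr2 : (countStep.run ω s₄).rarr 2 = s₄.rarr 2 := hf₅.rarr 2 (by decide)
    have hnK : (countStep.run ω s₄).nreg 3 = max K r := by
      unfold countStep
      simp only [Cmd.run, Test.eval, NExp.eval, hr₄, hK₄]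
      split_ifs with h
      · simp [hK₄, h]
      · simp
        omega
    have hn2 : (countStep.run ω s₄).nreg 2 = s₃.nreg 2 + 1 := by
      unfold countStep
      simp only [Cmd.run, Test.eval, NExp.eval, hr₄, hK₄]
      split_ifs with h <;> simp [hc₄]
    constructor
    · rw [hn3]; exact hcolor
    · intro h hh
      rw [Function.update_of_ne, hC.off h hh]
      rintro rfl
      exact hh hx
    · rw [hn2, hC₃.count, card_colored_update hx0 (by omega)]
    · rw [hnK, existing_update hx0 (by omega), hC.existing_eq]
      ext c
      simp only [Finset.mem_insert, Finset.mem_Icc]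
      omega
    · intro i hi
      rw [hr2, (hup i).2, hC₃.colors i]
      by_cases hix : (ed i).1 = x
      · rw [if_pos hix, hix, Function.update_self, colorClass_update_self,
          Finset.erase_insert (by simp [hx0]; omega), hacc₃, hacc r (by omega) hrK]
      · rw [if_neg hix, Function.update_of_ne hix]
        rw [Function.update_of_ne hix] at hi
        by_cases hir : C (ed i).1 = r
        · rw [if_pos hir, hir, colorClass_update_self, Finset.erase_insert_of_ne (Ne.symm hix),
            Finset.sum_insert (by simp [hx0]; omega), hC₃.interference i hi, hir, add_comm]
        · rw [if_neg hir, hC₃.interference i hi, colorClass_update_of_ne]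
          · rw [hx0]; exact Ne.symm hi
          · exact Ne.symm hir

end Spec

end STDMA
end

noncomputable section

namespace STDMA

/-! ### The program: colouring the edges of an oriented forest -/

/-- Take the vertex with the next label; if it has a parent, colour the link given by the
expressions `A` and `B`. -/
def passBody (A B : NExp) : Cmd :=
  .seq (.nset 9 (.get 4 (.add (.reg 8) (.const 1))))
    (.ite (.nle (.const 1) (.get 7 (.reg 9)))
      (.seq (.nset 10 A) (.seq (.nset 11 B) colorCmd)) .skip)

def passLoop (A B : NExp) : Cmd := forN 8 (.reg 0) (passBody A B)

/-- The parent of the vertex in register `9`. -/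
def parentExp : NExp := .sub (.get 7 (.reg 9)) (.const 1)

def outPass : Cmd := passLoop parentExp (.reg 9)

def inPass : Cmd := passLoop (.reg 9) parentExp

section Spec

variable {N : ℕ} {Φ : Network N} {ed : Fin Φ.commEdges.card ≃ Φ.commEdges} {s s' : State}
  {ω : Tape}

/-- Array `4` holds the vertex with a given label. -/
def HasInverse (s : State) (L : Equiv.Perm (Fin N)) : Prop :=
  ∀ j : Fin N, s.narr 4 (j + 1) = (L.symm j : ℕ)

/-- Array `7` holds the parents, shifted by one, with `0` for no parent. -/
def HasParents (s : State) (par : Fin N → Option (Fin N)) : Prop :=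
  ∀ u : Fin N, s.narr 7 u = (par u).elim 0 fun p => (p : ℕ) + 1

/-- Colour the link associated with the vertex of label `j`. -/
def passStep (Φ : Network N) (L : Equiv.Perm (Fin N)) (edgeOf : Fin N → Option (Link N))
    (C : Coloring N) (j : Fin N) : Coloring N :=
  (edgeOf (L.symm j)).elim C fun x => Function.update C x (firstConflictFreeColor Φ C x)

theorem foldl_passStep_ne_zero (L : Equiv.Perm (Fin N)) (edgeOf : Fin N → Option (Link N))
    (l : List (Fin N)) (C : Coloring N) (h : Link N) :
    l.foldl (passStep Φ L edgeOf) C h ≠ 0 ↔ C h ≠ 0 ∨ ∃ j ∈ l, edgeOf (L.symm j) = some h := by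
  induction l generalizing C with
  | nil => simp
  | cons j l ih =>
    rw [List.foldl_cons, ih]
    have : passStep Φ L edgeOf C j h ≠ 0 ↔ C h ≠ 0 ∨ edgeOf (L.symm j) = some h := by
      unfold passStep
      rcases hj : edgeOf (L.symm j) with _ | x
      · simp
      · by_cases hx : h = x
        · subst hx
          simp [firstConflictFreeColor_ne_zero]
        · simp [Function.update_of_ne hx, Ne.symm hx]
    rw [this]
    simp only [List.mem_cons, exists_eq_or_imp, or_assoc]

/-- The time bound is amortised, with the number of coloured links in register 2 as potential: a
vertex with a parent costs O(e) and raises the count by one, any other vertex costs O(1). Different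
vertices have different links by injectivity of `f`, so each link is still uncoloured when reached.
-/
theorem passLoop_spec : ∃ c : ℕ, ∀ {N : ℕ} {Φ : Network N}
    {ed : Fin Φ.commEdges.card ≃ Φ.commEdges} {s : State} (ω : Tape) {C : Coloring N}
    {L : Equiv.Perm (Fin N)} {par : Fin N → Option (Fin N)} (A B : NExp)
    (f : Fin N → Fin N → Link N),
    A.cost + B.cost ≤ 6 →
    (∀ (s : State) (u p : Fin N), s.nreg 9 = u → s.narr 7 u = p + 1 →
      A.eval s = (f u p).1 ∧ B.eval s = (f u p).2) →
    (∀ u p u' p', f u p = f u' p' → par u = some p → par u' = some p' → u = u') →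
    (∀ u p, par u = some p → f u p ∈ Φ.commEdges ∧ C (f u p) = 0) →
    Env Φ ed s → ColorState Φ ed s C → HasInverse s L → HasParents s par →
    Runs ω (passLoop A B) s fun t s' =>
      t + c * (Φ.commEdges.card + 1) * s.nreg 2 ≤
        c * (N + 1) + c * (Φ.commEdges.card + 1) * s'.nreg 2 ∧ Env Φ ed s' ∧
      ColorState Φ ed s'
        ((List.finRange N).foldl (passStep Φ L fun u => (par u).map (f u)) C) := by
  obtain ⟨c₀, hc₀⟩ := colorCmd_spec
  refine ⟨c₀ + 40, ?_⟩
  intro N Φ ed s ω C L par A B f hcost hAB hinj hunc he hC hL hpar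
  set edgeOf : Fin N → Option (Link N) := fun u => (par u).map (f u) with hedge
  set D := (c₀ + 40) * (Φ.commEdges.card + 1) with hD
  refine (Runs.forN_time N (fun j t s' => t + D * s.nreg 2 ≤ j * 20 + D * s'.nreg 2 ∧
    Env Φ ed s' ∧ ColorState Φ ed s' (((List.finRange N).take j).foldl (passStep Φ L edgeOf) C))
    -- The set of written locations does not depend on the two expressions, so they may be replaced
    -- by constants to make the claim decidable.
    (by change 8 ∉ (passBody (.const 0) (.const 0)).nregW; decide) ?_ ?_ ?_ ?_).mono ?_
  · intro s' hf
    have : s'.nreg 0 = s.nreg 0 := hf.nreg 0 (by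
      change 0 ∉ (passLoop (.const 0) (.const 0)).nregW; decide)
    simp [NExp.eval, this, he.nodes]
  · rintro j t s' x ⟨h1, h2, h3⟩
    have hf := frame_setN s' 8 x
    refine ⟨?_, h2.frame hf (by decide), h3.frame hf (by decide) (by decide) (by decide) (by decide)⟩
    rw [hf.nreg 2 (by decide)]
    exact h1
  · simpa using ⟨he, hC⟩
  · rintro j hj t s' hf hreg ⟨ht, he', hC'⟩
    set Cj := ((List.finRange N).take j).foldl (passStep Φ L edgeOf) C with hCj
    have htake : ((List.finRange N).take (j + 1)).foldl (passStep Φ L edgeOf) C =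
        passStep Φ L edgeOf Cj ⟨j, hj⟩ := by
      have hlen : j < (List.finRange N).length := by simpa using hj
      rw [← List.take_concat_get' _ _ hlen, List.foldl_append, ← hCj]
      simp
    set u := L.symm ⟨j, hj⟩ with hu
    have hf4 : s'.narr 4 = s.narr 4 := hf.narr 4 (by
      change 4 ∉ (passLoop (.const 0) (.const 0)).narrW; decide)
    have hf7 : s'.narr 7 = s.narr 7 := hf.narr 7 (by
      change 7 ∉ (passLoop (.const 0) (.const 0)).narrW; decide)
    apply Runs.seq
    refine ⟨_, _, .nset 9 _ s', ?_⟩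
    set s₁ : State := { s' with nreg := Function.update s'.nreg 9 (NExp.eval s' (.get 4
      (.add (.reg 8) (.const 1)))) } with hs₁
    have h9 : s₁.nreg 9 = u := by
      simp [hs₁, NExp.eval, hreg, hf4, hL ⟨j, hj⟩, hu]
    have hf₁ : Frame _ s' s₁ := frame_setN s' 9 _
    have hp₁ : s₁.narr 7 u = (par u).elim 0 fun p => (p : ℕ) + 1 := by
      rw [← hpar u, ← hf7]
    rw [htake]
    have hb : (Test.nle (.const 1) (.get 7 (.reg 9))).eval s₁ ↔ 1 ≤ s₁.narr 7 u := by
      simp [Test.eval, NExp.eval, h9]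
    apply Runs.ite
    · intro hb1
      rw [hb, hp₁] at hb1
      obtain ⟨p, hp⟩ : ∃ p, par u = some p := by
        rcases hpu : par u with _ | p
        · simp [hpu] at hb1
        · exact ⟨p, rfl⟩
      rw [hp] at hp₁
      simp only [Option.elim] at hp₁
      have hstep : passStep Φ L edgeOf Cj ⟨j, hj⟩ =
          Function.update Cj (f u p) (firstConflictFreeColor Φ Cj (f u p)) := by
        simp [passStep, hedge, ← hu, hp]
      rw [hstep]
      apply Runs.seq
      refine ⟨_, _, .nset 10 A s₁, ?_⟩
      set s₂ : State := { s₁ with nreg := Function.update s₁.nreg 10 (A.eval s₁) } with hs₂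
      have hf₂ : Frame _ s₁ s₂ := frame_setN s₁ 10 _
      apply Runs.seq
      refine ⟨_, _, .nset 11 B s₂, ?_⟩
      set s₃ : State := { s₂ with nreg := Function.update s₂.nreg 11 (B.eval s₂) } with hs₃
      have hf₃ : Frame _ s₂ s₃ := frame_setN s₂ 11 _
      have hA := (hAB s₁ u p h9 hp₁).1
      have hB := (hAB s₂ u p (by simpa [hs₂] using h9) hp₁).2
      have hlink : HoldsLink s₃ (f u p) := by
        constructor
        · simp [hs₃, hs₂, hA]
        · simp [hs₃, hB]
      have he₃ : Env Φ ed s₃ := ((he'.frame hf₁ (by decide)).frame hf₂ (by decide)).frame hf₃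
        (by decide)
      have hC₃ : ColorState Φ ed s₃ Cj := ((hC'.frame hf₁ (by decide) (by decide) (by decide)
        (by decide)).frame hf₂ (by decide) (by decide) (by decide) (by decide)).frame hf₃ (by decide)
          (by decide) (by decide) (by decide)
      have hzero : Cj (f u p) = 0 := by
        by_contra hne
        rcases (foldl_passStep_ne_zero L edgeOf _ C (f u p)).1 hne with h | ⟨j', hj', h⟩
        · exact h (hunc u p hp).2
        · rw [hedge] at h
          simp only [Option.map_eq_some_iff] at h
          obtain ⟨p', hp', h⟩ := h
          have h1 : L.symm j' = u := hinj _ _ _ _ h hp' hp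
          have h2 : j' = ⟨j, hj⟩ := L.symm.injective h1
          rw [h2, List.mem_take_iff_getElem] at hj'
          obtain ⟨k, hk, hk'⟩ := hj'
          simp only [List.getElem_finRange] at hk'
          have := congrArg Fin.val hk'
          simp at this hk
          omega
      refine (hc₀ ω he₃ hC₃ hlink (hunc u p hp).1 hzero).mono ?_
      rintro t' s'' ⟨ht', he'', hC''⟩
      refine ⟨?_, he'', hC''⟩
      have hcount : s''.nreg 2 = s'.nreg 2 + 1 := by
        rw [hC''.count, card_colored_update hzero (firstConflictFreeColor_ne_zero _ _ _), hC'.count]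
      rw [hcount, mul_add, mul_one, add_mul]
      have hDle : c₀ * (Φ.commEdges.card + 1) + 40 ≤ D := by
        rw [hD, add_mul]
        omega
      simp only [NExp.cost, Test.cost]
      omega
    · intro hb1
      rw [hb, hp₁] at hb1
      have hp : par u = none := by
        rcases hpu : par u with _ | p
        · rfl
        · simp [hpu] at hb1
      have hstep : passStep Φ L edgeOf Cj ⟨j, hj⟩ = Cj := by
        simp [passStep, hedge, ← hu, hp]
      rw [hstep]
      refine ⟨_, _, .skip s₁, ?_, he'.frame hf₁ (by decide), hC'.frame hf₁ (by decide) (by decide)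
        (by decide) (by decide)⟩
      rw [hf₁.nreg 2 (by decide), add_mul]
      simp only [NExp.cost, Test.cost]
      omega
  · rintro t s' ⟨t', h1, h2, h3, h4⟩
    refine ⟨?_, h3, ?_⟩
    · simp only [NExp.cost] at h1
      have : N * 20 + (N + 1) * (1 + 10) ≤ (c₀ + 40) * (N + 1) := by
        rw [add_mul c₀]; omega
      omega
    · rwa [List.take_of_length_le (by simp)] at h4

end Spec

end STDMA
end

noncomputable section

namespace STDMA

/-! ### Breadth first search -/

section BFS

variable {V : Type*} {R : SimpleGraph V} {D : V → ℕ} {par : V → Option V} {root : V → V}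

/-- A state of a breadth first search of `R`: `D u` is `0` if `u` is not yet visited, and otherwise
the distance of `u` from its root plus one. -/
structure PartialBFS (R : SimpleGraph V) (D : V → ℕ) (par : V → Option V) (root : V → V) :
    Prop where
  unvisited : ∀ u, D u = 0 → par u = none ∧ root u = u
  parent : ∀ u p, par u = some p → R.Adj p u ∧ D p ≠ 0 ∧ D u = D p + 1 ∧ root u = root p
  isRoot : ∀ u, D u ≠ 0 → par u = none → root u = u ∧ D u = 1
  root_visited : ∀ u, D u ≠ 0 → D (root u) ≠ 0
  dist : ∀ u, D u ≠ 0 → R.Reachable (root u) u ∧ D u = R.dist (root u) u + 1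
  root_eq : ∀ u w, D u ≠ 0 → D w ≠ 0 → R.Reachable u w → root u = root w

theorem partialBFS_init (R : SimpleGraph V) : PartialBFS R (fun _ => 0) (fun _ => none) id := by
  constructor <;> simp

theorem exists_exit {P : V → Prop} {u w : V} (p : R.Walk u w) (hu : P u) (hw : ¬ P w) :
    ∃ a b, R.Adj a b ∧ P a ∧ ¬ P b ∧ ∃ q : R.Walk u a, q.length + 1 ≤ p.length := by
  induction p with
  | nil => exact (hw hu).elim
  | @cons u v w h p ih =>
    by_cases hv : P v
    · obtain ⟨a, b, hab, ha, hb, q, hq⟩ := ih hv hw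
      exact ⟨a, b, hab, ha, hb, .cons h q, by simpa using hq⟩
    · exact ⟨u, v, h, hu, hv, .nil, by simp⟩

/-- A new root is admissible only when no edge leaves the visited set: then its component contains
no visited vertex, and no component acquires two roots. -/
theorem PartialBFS.addRoot [DecidableEq V] (h : PartialBFS R D par root)
    (hclosed : ∀ a b, R.Adj a b → D a ≠ 0 → D b ≠ 0) {r : V} (hr : D r = 0) :
    PartialBFS R (Function.update D r 1) par root := by
  have hreach : ∀ u, D u ≠ 0 → ¬ R.Reachable u r := by
    rintro u hu ⟨p⟩
    obtain ⟨a, b, hab, ha, hb, -⟩ := exists_exit (P := fun x => D x ≠ 0) p hu (by simpa using hr)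
    exact hb (hclosed a b hab ha)
  have hval : ∀ u, u ≠ r → Function.update D r 1 u = D u := fun u hu => Function.update_of_ne hu _ _
  have hvis : ∀ u, Function.update D r 1 u ≠ 0 → u = r ∨ D u ≠ 0 := by
    intro u hu
    by_cases hur : u = r
    · exact .inl hur
    · exact .inr (by rwa [hval u hur] at hu)
  have hmono : ∀ u, D u ≠ 0 → u ≠ r := by
    rintro u hu rfl
    exact hu hr
  have hpr := h.unvisited r hr
  constructor
  · intro u hu
    by_cases hur : u = r
    · subst hur; simp at hu
    · exact h.unvisited u (by rwa [hval u hur] at hu)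
  · intro u p hup
    obtain ⟨h1, h2, h3, h4⟩ := h.parent u p hup
    rw [hval p (hmono p h2), hval u (hmono u (by omega))]
    exact ⟨h1, h2, h3, h4⟩
  · intro u hu hp
    rcases hvis u hu with rfl | hu'
    · exact ⟨hpr.2, by simp⟩
    · rw [hval u (hmono u hu')]
      exact h.isRoot u hu' hp
  · intro u hu
    rcases hvis u hu with rfl | hu'
    · rw [hpr.2]; simp
    · have := h.root_visited u hu'
      rwa [hval _ (hmono _ this)]
  · intro u hu
    rcases hvis u hu with rfl | hu'
    · rw [hpr.2]; simp
    · rw [hval u (hmono u hu')]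
      exact h.dist u hu'
  · intro u w hu hw huw
    rcases hvis u hu with rfl | hu' <;> rcases hvis w hw with rfl | hw'
    · rfl
    · exact (hreach w hw' huw.symm).elim
    · exact (hreach u hu' huw).elim
    · exact h.root_eq u w hu' hw' huw

/-- The new depth is a true distance because `a` has minimal depth among the visited ends of
frontier edges: a shortest path from the root to `b` must leave the visited set through some such
end, which is at least as deep as `a`. -/
theorem PartialBFS.addEdge [DecidableEq V] (h : PartialBFS R D par root) {a b : V}
    (hab : R.Adj a b) (ha : D a ≠ 0) (hb : D b = 0)
    (hmin : ∀ a' b', R.Adj a' b' → D a' ≠ 0 → D b' = 0 → D a ≤ D a') :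
    PartialBFS R (Function.update D b (D a + 1)) (Function.update par b (some a))
      (Function.update root b (root a)) := by
  have hval : ∀ u, u ≠ b → Function.update D b (D a + 1) u = D u :=
    fun u hu => Function.update_of_ne hu _ _
  have hpar : ∀ u, u ≠ b → Function.update par b (some a) u = par u :=
    fun u hu => Function.update_of_ne hu _ _
  have hroot : ∀ u, u ≠ b → Function.update root b (root a) u = root u :=
    fun u hu => Function.update_of_ne hu _ _
  have hvis : ∀ u, Function.update D b (D a + 1) u ≠ 0 → u = b ∨ D u ≠ 0 := by
    intro u hu
    by_cases hur : u = b
    · exact .inl hur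
    · exact .inr (by rwa [hval u hur] at hu)
  have hmono : ∀ u, D u ≠ 0 → u ≠ b := by
    rintro u hu rfl
    exact hu hb
  have hab' := hmono a ha
  have hra := h.root_visited a ha
  have hreach : R.Reachable (root a) b := (h.dist a ha).1.trans hab.reachable
  constructor
  · intro u hu
    by_cases hub : u = b
    · subst hub; simp at hu
    · rw [hpar u hub, hroot u hub]
      exact h.unvisited u (by rwa [hval u hub] at hu)
  · intro u p hup
    by_cases hub : u = b
    · subst hub
      simp only [Function.update_self, Option.some.injEq] at hup
      subst hup
      rw [hval a hab', hroot a hab']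
      simp [hab, ha]
    · rw [hpar u hub] at hup
      obtain ⟨h1, h2, h3, h4⟩ := h.parent u p hup
      have hpb := hmono p h2
      rw [hval p hpb, hval u hub, hroot u hub, hroot p hpb]
      exact ⟨h1, h2, h3, h4⟩
  · intro u hu hp
    rcases hvis u hu with rfl | hu'
    · simp at hp
    · have hub := hmono u hu'
      rw [hval u hub, hroot u hub]
      exact h.isRoot u hu' (by rwa [hpar u hub] at hp)
  · intro u hu
    rcases hvis u hu with rfl | hu'
    · rw [Function.update_self, hval _ (hmono _ hra)]
      exact hra
    · rw [hroot u (hmono u hu'), hval _ (hmono _ (h.root_visited u hu'))]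
      exact h.root_visited u hu'
  · intro u hu
    rcases hvis u hu with rfl | hu'
    · simp only [Function.update_self]
      refine ⟨hreach, ?_⟩
      have h1 := (h.dist a ha).2
      have hup : R.dist (root a) u ≤ R.dist (root a) a + 1 := by
        obtain ⟨p, hp⟩ := (h.dist a ha).1.exists_walk_length_eq_dist
        have := SimpleGraph.dist_le (p.concat hab)
        rwa [SimpleGraph.Walk.length_concat, hp] at this
      have hlow : D a ≤ R.dist (root a) u := by
        obtain ⟨p, hp⟩ := hreach.exists_walk_length_eq_dist
        obtain ⟨a', b', hab', ha', hb', q, hq⟩ :=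
          exists_exit (P := fun x => D x ≠ 0) p hra (by simpa using hb)
        have h2 := hmin a' b' hab' ha' (by simpa using hb')
        have h3 := h.root_eq a a' ha ha' ((h.dist a ha).1.symm.trans q.reachable)
        have h4 := (h.dist a' ha').2
        have h5 := SimpleGraph.dist_le q
        rw [← h3] at h4
        omega
      omega
    · rw [hval u (hmono u hu'), hroot u (hmono u hu')]
      exact h.dist u hu'
  · intro u w hu hw huw
    rcases hvis u hu with rfl | hu' <;> rcases hvis w hw with rfl | hw'
    · rfl
    · rw [Function.update_self, hroot w (hmono w hw')]
      exact h.root_eq a w ha hw' (hab.reachable.trans huw)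
    · rw [Function.update_self, hroot u (hmono u hu')]
      exact h.root_eq u a hu' ha (huw.trans hab.reachable.symm)
    · rw [hroot u (hmono u hu'), hroot w (hmono w hw')]
      exact h.root_eq u w hu' hw' huw

/-- The graph with an edge between each vertex and its parent. -/
def parentGraph (par : V → Option V) : SimpleGraph V :=
  SimpleGraph.fromRel fun a b => par b = some a

theorem PartialBFS.parentGraph_adj (h : PartialBFS R D par root) {a b : V} :
    (parentGraph par).Adj a b ↔ par b = some a ∨ par a = some b := by
  rw [parentGraph, SimpleGraph.fromRel_adj, and_iff_right_iff_imp]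
  rintro (hp | hp) rfl
  · exact (h.parent _ _ hp).1.ne rfl
  · exact (h.parent _ _ hp).1.ne rfl

/-- Every edge is a bridge. After deleting the edge from `u` to its parent, all that is reachable
from `u` descends from `u` and is at least as deep, whereas the parent is less deep. -/
theorem PartialBFS.isAcyclic (h : PartialBFS R D par root) : (parentGraph par).IsAcyclic := by
  rw [SimpleGraph.isAcyclic_iff_forall_adj_isBridge]
  have key : ∀ u p, par u = some p → ¬ ((parentGraph par).deleteEdges {s(p, u)}).Reachable u p := by
    intro u p hup hreach
    have hdesc : ∀ w, Relation.ReflTransGen (fun x y => par x = some y) w u → D u ≤ D w := by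
      intro w hw
      induction hw using Relation.ReflTransGen.head_induction_on with
      | refl => exact le_rfl
      | head hxy _ ih =>
        have := (h.parent _ _ hxy).2.2.1
        omega
    have hclosed : ∀ w, ((parentGraph par).deleteEdges {s(p, u)}).Reachable u w →
        Relation.ReflTransGen (fun x y => par x = some y) w u := by
      intro w hw
      rw [SimpleGraph.reachable_iff_reflTransGen] at hw
      induction hw with
      | refl => exact .refl
      | @tail b c _ hbc ih =>
        rw [SimpleGraph.deleteEdges_adj, h.parentGraph_adj] at hbc
        obtain ⟨hbc | hbc, hne⟩ := hbc
        · exact .head hbc ih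
        · rcases Relation.ReflTransGen.cases_head ih with rfl | ⟨d, hd, hdu⟩
          · rw [hup] at hbc
            obtain rfl : p = c := Option.some_injective _ hbc
            simp [Sym2.eq_swap] at hne
          · rw [hbc] at hd
            obtain rfl : c = d := Option.some_injective _ hd
            exact hdu
    have h1 := hdesc p (hclosed p hreach)
    have h2 := (h.parent u p hup).2.2.1
    omega
  intro a b hab
  rw [SimpleGraph.isBridge_iff]
  rcases h.parentGraph_adj.1 hab with hp | hp
  · exact fun hr => key b a hp hr.symm
  · rw [Sym2.eq_swap]
    exact key a b hp

theorem PartialBFS.parentGraph_le (h : PartialBFS R D par root) : parentGraph par ≤ R := by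
  intro a b hab
  rcases h.parentGraph_adj.1 hab with hp | hp
  · exact (h.parent _ _ hp).1
  · exact (h.parent _ _ hp).1.symm

theorem PartialBFS.exists_walk (h : PartialBFS R D par root) : ∀ (n : ℕ) (u : V), D u = n + 1 →
    ∃ p : (parentGraph par).Walk (root u) u, p.length = n := by
  intro n
  induction n with
  | zero =>
    intro u hu
    rcases hp : par u with _ | p
    · rw [(h.isRoot u (by omega) hp).1]
      exact ⟨.nil, rfl⟩
    · have := h.parent u p hp
      omega
  | succ n ih =>
    intro u hu
    rcases hp : par u with _ | p
    · have := h.isRoot u (by omega) hp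
      omega
    · obtain ⟨h1, h2, h3, h4⟩ := h.parent u p hp
      obtain ⟨q, hq⟩ := ih p (by omega)
      rw [h4]
      exact ⟨q.concat (h.parentGraph_adj.2 (.inl hp)), by simp [hq]⟩

/-- The chain of parents bounds the forest distance from above, and the distance in the larger graph
`R` bounds it from below; both bounds are the recorded depth. -/
theorem PartialBFS.dist_parentGraph (h : PartialBFS R D par root) {u : V} (hu : D u ≠ 0) :
    D u = (parentGraph par).dist (root u) u + 1 := by
  obtain ⟨n, hn⟩ := Nat.exists_eq_succ_of_ne_zero hu
  obtain ⟨p, hp⟩ := h.exists_walk n u hn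
  have h1 := SimpleGraph.dist_le p
  have h2 := p.reachable.dist_anti h.parentGraph_le
  have h3 := (h.dist u hu).2
  have h4 : R.dist (root u) u ≤ (parentGraph par).dist (root u) u := h2
  omega

/-- Vertices never visited are isolated in `R`. They count as their own roots, as `unvisited`
records. -/
theorem PartialBFS.isBFSForest (h : PartialBFS R D par root)
    (hall : ∀ a b, R.Adj a b → D b ≠ 0) : IsBFSForest R (parentGraph par) root where
  le := h.parentGraph_le
  acyclic := h.isAcyclic
  root_eq := by
    intro u w huw
    by_cases hne : u = w
    · rw [hne]
    · have hex : ∀ x y, R.Reachable x y → x ≠ y → D x ≠ 0 := by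
        rintro x y ⟨p⟩ hxy
        cases p with
        | nil => exact (hxy rfl).elim
        | cons hadj _ => exact hall _ _ hadj.symm
      exact h.root_eq u w (hex u w huw hne) (hex w u huw.symm (Ne.symm hne)) huw
  reachable_root := by
    intro u
    by_cases hu : D u = 0
    · rw [(h.unvisited u hu).2]
    · obtain ⟨n, hn⟩ := Nat.exists_eq_succ_of_ne_zero hu
      exact (h.exists_walk n u hn).choose.reachable
  dist_eq := by
    intro u
    by_cases hu : D u = 0
    · rw [(h.unvisited u hu).2]; simp
    · have h1 := h.dist_parentGraph hu
      have h2 := (h.dist u hu).2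
      omega

/-- The edges of the forest that point away from the root are those from a parent to its child. -/
theorem PartialBFS.adj_and_dist_iff (h : PartialBFS R D par root) {a b : V} :
    ((parentGraph par).Adj a b ∧ (parentGraph par).dist (root b) b =
      (parentGraph par).dist (root b) a + 1) ↔ par b = some a := by
  constructor
  · rintro ⟨hadj, hdist⟩
    rcases h.parentGraph_adj.1 hadj with hp | hp
    · exact hp
    · obtain ⟨-, h2, h3, h4⟩ := h.parent _ _ hp
      have h5 := h.dist_parentGraph h2
      have h6 := h.dist_parentGraph (u := a) (by omega)
      rw [h4] at h6
      omega
  · intro hp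
    obtain ⟨-, h2, h3, h4⟩ := h.parent _ _ hp
    refine ⟨h.parentGraph_adj.2 (.inl hp), ?_⟩
    have h5 := h.dist_parentGraph h2
    have h6 := h.dist_parentGraph (u := b) (by omega)
    rw [← h4] at h5
    omega

end BFS

end STDMA
end

noncomputable section

namespace STDMA

/-! ### The program: breadth first search -/

/-- Array `6` holds the distances from the root plus one, array `7` the parents plus one. -/
def bfsClearBody : Cmd := .seq (.nput 6 (.reg 4) (.const 0)) (.nput 7 (.reg 4) (.const 0))

def bfsClear : Cmd := forN 4 (.reg 0) bfsClearBody

def bfsScanBody : Cmd :=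
  .ite (.and (.nle (.get 3 (.reg 4)) (.const 0)) (.nle (.get 6 (.get 1 (.reg 4))) (.const 0)))
    (.ite (.nle (.get 6 (.get 0 (.reg 4))) (.const 0))
      (.nset 7 (.add (.reg 4) (.const 1)))
      (.ite (.and (.nle (.const 1) (.reg 6))
          (.nle (.get 6 (.get 0 (.sub (.reg 6) (.const 1)))) (.get 6 (.get 0 (.reg 4)))))
        .skip (.nset 6 (.add (.reg 4) (.const 1)))))
    .skip

/-- Find an uncoloured edge from a visited vertex nearest to its root to an unvisited one, and an
uncoloured edge between unvisited vertices. -/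
def bfsScan : Cmd :=
  .seq (.nset 6 (.const 0)) (.seq (.nset 7 (.const 0)) (forN 4 (.reg 1) bfsScanBody))

/-- A root is created only together with an uncoloured edge leaving it, and that edge is handed on
to `bfsExtend`. Thus every successful pass adds exactly one forest edge. -/
def bfsRoot : Cmd :=
  .ite (.and (.nle (.reg 6) (.const 0)) (.nle (.const 1) (.reg 7)))
    (.seq (.nput 6 (.get 0 (.sub (.reg 7) (.const 1))) (.const 1)) (.nset 6 (.reg 7))) .skip

def bfsExtend : Cmd :=
  .ite (.nle (.reg 6) (.const 0)) (.nset 5 (.const 0))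
    (.seq (.nput 6 (.get 1 (.sub (.reg 6) (.const 1)))
        (.add (.get 6 (.get 0 (.sub (.reg 6) (.const 1)))) (.const 1)))
      (.nput 7 (.get 1 (.sub (.reg 6) (.const 1)))
        (.add (.get 0 (.sub (.reg 6) (.const 1))) (.const 1))))

def bfsBody : Cmd := .seq bfsScan (.seq bfsRoot bfsExtend)

def bfsTest : Test := .nle (.const 1) (.reg 5)

def bfsCmd : Cmd := .seq bfsClear (.seq (.nset 5 (.const 1)) (.while bfsTest bfsBody))

section Spec

variable {N : ℕ} {Φ : Network N} {ed : Fin Φ.commEdges.card ≃ Φ.commEdges} {s s' : State}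
  {ω : Tape}

/-- Array `6` holds the function `D`. -/
def HasDepths (s : State) (D : Fin N → ℕ) : Prop := ∀ u : Fin N, s.narr 6 u = D u

theorem bfsClear_spec (h : Env Φ ed s) :
    Runs ω bfsClear s fun t s' => t ≤ (N + 1) * (bfsClearBody.maxCost + 11) ∧
      HasDepths s' (fun _ : Fin N => 0) ∧ HasParents s' (fun _ : Fin N => none) := by
  refine (Runs.forN N bfsClearBody.maxCost
    (fun j s' => ∀ u < j, s'.narr 6 u = 0 ∧ s'.narr 7 u = 0) (by decide) ?_ ?_ ?_ ?_).mono ?_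
  · intro s' hf
    simp [NExp.eval, hf.nreg 0 (by decide), h.nodes]
  · exact fun _ _ _ h => h
  · simp
  · intro j hj s' hf hi hI
    refine Runs.of_loopFree (by decide) fun t ht _ => ⟨ht, fun c hc => ?_⟩
    simp only [bfsClearBody, Cmd.run, NExp.eval, hi]
    rcases Nat.lt_succ_iff_lt_or_eq.1 hc with h | rfl
    · simp [h.ne, hI c h]
    · simp
  · rintro t s' ⟨h1, h2⟩
    exact ⟨by simpa [NExp.cost, add_assoc] using h1, fun u => (h2 u u.2).1, fun u => (h2 u u.2).2⟩

/-- The uncoloured edge `i` leads from a visited to an unvisited vertex. -/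
def IsFrontier (C : Coloring N) (D : Fin N → ℕ) (x : Link N) : Prop :=
  (C x = 0 ∧ D x.2 = 0) ∧ D x.1 ≠ 0

/-- Registers 6 and 7 hold an edge index plus one, so that 0 can mean that no such edge has been
seen. -/
theorem bfsScan_spec (h : Env Φ ed s) {C : Coloring N} (hC : ColorState Φ ed s C)
    {D : Fin N → ℕ} (hD : HasDepths s D) :
    Runs ω bfsScan s fun t s' => t ≤ (Φ.commEdges.card + 1) * (bfsScanBody.maxCost + 11) + 4 ∧
      ((s'.nreg 6 = 0 ∧ ∀ i, ¬ IsFrontier C D (ed i).1) ∨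
        ∃ i : Fin Φ.commEdges.card, s'.nreg 6 = i + 1 ∧ IsFrontier C D (ed i).1 ∧
          ∀ i', IsFrontier C D (ed i').1 → D (ed i).1.1 ≤ D (ed i').1.1) ∧
      ((s'.nreg 7 = 0 ∧ ∀ i, ¬ ((C (ed i).1 = 0 ∧ D (ed i).1.2 = 0) ∧ D (ed i).1.1 = 0)) ∨
        ∃ i : Fin Φ.commEdges.card, s'.nreg 7 = i + 1 ∧
          (C (ed i).1 = 0 ∧ D (ed i).1.2 = 0) ∧ D (ed i).1.1 = 0) := by
  apply Runs.seq
  refine ⟨_, _, .nset 6 (.const 0) s, ?_⟩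
  change Runs ω _ (s.setN 6 0) _
  apply Runs.seq
  refine ⟨_, _, .nset 7 (.const 0) (s.setN 6 0), ?_⟩
  change Runs ω _ ((s.setN 6 0).setN 7 0) _
  set s₀ := (s.setN 6 0).setN 7 0 with hs₀
  have he₀ : Env Φ ed s₀ := (h.frame (frame_setN _ _ _) (by decide)).frame (frame_setN _ _ _)
    (by decide)
  refine (Runs.forN Φ.commEdges.card bfsScanBody.maxCost
    (fun j s' =>
      ((s'.nreg 6 = 0 ∧ ∀ i : Fin Φ.commEdges.card, (i : ℕ) < j → ¬ IsFrontier C D (ed i).1) ∨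
        ∃ i : Fin Φ.commEdges.card, s'.nreg 6 = i + 1 ∧ IsFrontier C D (ed i).1 ∧
          ∀ i' : Fin Φ.commEdges.card, (i' : ℕ) < j → IsFrontier C D (ed i').1 →
            D (ed i).1.1 ≤ D (ed i').1.1) ∧
      ((s'.nreg 7 = 0 ∧ ∀ i : Fin Φ.commEdges.card, (i : ℕ) < j →
          ¬ ((C (ed i).1 = 0 ∧ D (ed i).1.2 = 0) ∧ D (ed i).1.1 = 0)) ∨
        ∃ i : Fin Φ.commEdges.card, s'.nreg 7 = i + 1 ∧
          (C (ed i).1 = 0 ∧ D (ed i).1.2 = 0) ∧ D (ed i).1.1 = 0)) (by decide) ?_ ?_ ?_ ?_).mono ?_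
  · intro s' hf
    simp [NExp.eval, hf.nreg 1 (by decide), he₀.edges]
  · intro j s' x hI
    simpa [State.setN] using hI
  · exact ⟨.inl ⟨by simp [hs₀, State.setN], by simp⟩, .inl ⟨by simp [hs₀, State.setN], by simp⟩⟩
  · intro j hj s' hf hi hI
    refine Runs.of_loopFree (by decide) fun t ht _ => ⟨ht, ?_⟩
    have he' : Env Φ ed s' := he₀.frame hf (by decide)
    have h6 : ∀ u : Fin N, s'.narr 6 u = D u := fun u => by
      rw [hf.narr 6 (by decide)]; exact hD u
    have h3 : ∀ i : Fin Φ.commEdges.card, s'.narr 3 i = C (ed i).1 := fun i => by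
      rw [hf.narr 3 (by decide)]; exact hC.colors i
    have hsrc := he'.src ⟨j, hj⟩
    have hdst := he'.dst ⟨j, hj⟩
    have hcol := h3 ⟨j, hj⟩
    simp only at hsrc hdst hcol
    set x := (ed ⟨j, hj⟩).1 with hx
    have hlt : ∀ P : Fin Φ.commEdges.card → Prop, (∀ i : Fin Φ.commEdges.card, (i : ℕ) < j + 1 → P i) ↔
        (∀ i : Fin Φ.commEdges.card, (i : ℕ) < j → P i) ∧ P ⟨j, hj⟩ := by
      intro P
      constructor
      · exact fun H => ⟨fun i hi => H i (by omega), H _ (by simp)⟩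
      · rintro ⟨H1, H2⟩ i hi
        rcases Nat.lt_succ_iff_lt_or_eq.1 hi with hi | hi
        · exact H1 i hi
        · obtain rfl : i = ⟨j, hj⟩ := Fin.ext hi
          exact H2
    simp only [hlt, ← hx]
    unfold bfsScanBody
    by_cases hcand : C x = 0 ∧ D x.2 = 0
    · rw [Cmd.run, if_pos (by simpa [Test.eval, NExp.eval, hi, hcol, hdst, h6] using hcand)]
      by_cases hsx : D x.1 = 0
      · rw [Cmd.run, if_pos (by simpa [Test.eval, NExp.eval, hi, hsrc, h6] using hsx)]
        have hnf : ¬ IsFrontier C D x := fun hfr => hfr.2 hsx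
        refine ⟨?_, .inr ⟨⟨j, hj⟩, by simp [Cmd.run, NExp.eval, hi], hcand, hsx⟩⟩
        have e6 : (Cmd.run ω (.nset 7 (.add (.reg 4) (.const 1))) s').nreg 6 = s'.nreg 6 := by
          simp [Cmd.run]
        rw [e6]
        rcases hI.1 with ⟨h1, h2⟩ | ⟨i, h1, h2, h4⟩
        · exact .inl ⟨h1, h2, hnf⟩
        · exact .inr ⟨i, h1, h2, h4, fun hfr => (hnf hfr).elim⟩
      · rw [Cmd.run, if_neg (by simpa [Test.eval, NExp.eval, hi, hsrc, h6] using hsx)]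
        have hfr : IsFrontier C D x := ⟨hcand, hsx⟩
        have h7 : (s'.nreg 7 = 0 ∧ (∀ i : Fin Φ.commEdges.card, (i : ℕ) < j →
            ¬ ((C (ed i).1 = 0 ∧ D (ed i).1.2 = 0) ∧ D (ed i).1.1 = 0)) ∧
            ¬ ((C x = 0 ∧ D x.2 = 0) ∧ D x.1 = 0)) ∨
          ∃ i : Fin Φ.commEdges.card, s'.nreg 7 = i + 1 ∧
            (C (ed i).1 = 0 ∧ D (ed i).1.2 = 0) ∧ D (ed i).1.1 = 0 := by
          rcases hI.2 with ⟨h1, h2⟩ | h1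
          · exact .inl ⟨h1, h2, fun h => hsx h.2⟩
          · exact .inr h1
        rw [Cmd.run]
        rcases hI.1 with ⟨h1, h2⟩ | ⟨i, h1, h2, h4⟩
        · rw [if_neg (by simp [Test.eval, NExp.eval, h1])]
          refine ⟨.inr ⟨⟨j, hj⟩, by simp [Cmd.run, NExp.eval, hi], hfr, ?_⟩, ?_⟩
          · exact ⟨fun i' hi' hfr' => (h2 i' hi' hfr').elim, fun _ => le_rfl⟩
          · simpa [Cmd.run] using h7
        · have hsi := he'.src i
          by_cases hle : D (ed i).1.1 ≤ D x.1
          · rw [if_pos (by simpa [Test.eval, NExp.eval, h1, hi, hsrc, hsi, h6] using hle)]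
            exact ⟨.inr ⟨i, h1, h2, h4, fun _ => hle⟩, h7⟩
          · rw [if_neg (by simpa [Test.eval, NExp.eval, h1, hi, hsrc, hsi, h6] using hle)]
            refine ⟨.inr ⟨⟨j, hj⟩, by simp [Cmd.run, NExp.eval, hi], hfr, ?_, fun _ => le_rfl⟩, ?_⟩
            · intro i' hi' hfr'
              exact (le_of_lt (not_le.1 hle)).trans (h4 i' hi' hfr')
            · simpa [Cmd.run] using h7
    · rw [Cmd.run, if_neg (by simpa [Test.eval, NExp.eval, hi, hcol, hdst, h6] using hcand)]
      have hnf : ¬ IsFrontier C D x := fun hfr => hcand hfr.1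
      constructor
      · rcases hI.1 with ⟨h1, h2⟩ | ⟨i, h1, h2, h4⟩
        · exact .inl ⟨h1, h2, hnf⟩
        · exact .inr ⟨i, h1, h2, h4, fun hfr => (hnf hfr).elim⟩
      · rcases hI.2 with ⟨h1, h2⟩ | h1
        · exact .inl ⟨h1, h2, fun h => hcand h.1⟩
        · exact .inr h1
  · rintro t s' ⟨h1, h2⟩
    refine ⟨?_, ?_⟩
    · simp only [NExp.cost] at h1 ⊢
      have : bfsScanBody.maxCost + 1 + 10 = bfsScanBody.maxCost + 11 := by ring
      rw [this] at h1
      omega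
    · simpa using h2

end Spec

end STDMA
end

noncomputable section

namespace STDMA

/-! ### Growing a breadth first search forest one edge at a time -/

section Spec

variable {N : ℕ} {Φ : Network N} {ed : Fin Φ.commEdges.card ≃ Φ.commEdges} {s s' : State}
  {ω : Tape}

/-- The number of vertices with a parent. -/
def parentCount (par : Fin N → Option (Fin N)) : ℕ :=
  (Finset.univ.filter fun u => (par u).isSome).card

theorem parentCount_le (par : Fin N → Option (Fin N)) : parentCount par ≤ N :=
  (Finset.card_filter_le _ _).trans (by simp)

theorem parentCount_update {par : Fin N → Option (Fin N)} {b : Fin N} (hb : par b = none)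
    (a : Fin N) : parentCount (Function.update par b (some a)) = parentCount par + 1 := by
  have : (Finset.univ.filter fun u => (Function.update par b (some a) u).isSome) =
      insert b (Finset.univ.filter fun u => (par u).isSome) := by
    ext u
    by_cases hu : u = b
    · subst hu; simp
    · simp [hu]
  rw [parentCount, this, Finset.card_insert_of_notMem (by simp [hb]), parentCount]

theorem bfsExtend_run (h : Env Φ ed s) {D : Fin N → ℕ} {par : Fin N → Option (Fin N)}
    (hD : HasDepths s D) (hp : HasParents s par) (i : Fin Φ.commEdges.card)
    (hi : s.nreg 6 = i + 1) (ω : Tape) :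
    HasDepths (bfsExtend.run ω s) (Function.update D (ed i).1.2 (D (ed i).1.1 + 1)) ∧
    HasParents (bfsExtend.run ω s) (Function.update par (ed i).1.2 (some (ed i).1.1)) ∧
    (bfsExtend.run ω s).nreg 5 = s.nreg 5 := by
  have hsrc := h.src i
  have hdst := h.dst i
  unfold bfsExtend
  rw [Cmd.run, if_neg (by simp [Test.eval, NExp.eval, hi])]
  refine ⟨fun u => ?_, fun u => ?_, rfl⟩
  · have hDs := hD (ed i).1.1
    by_cases hu : u = (ed i).1.2
    · subst hu
      simp [Cmd.run, NExp.eval, hi, hsrc, hdst, hDs]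
    · have : (u : ℕ) ≠ (ed i).1.2 := fun h => hu (Fin.ext h)
      simp [Cmd.run, NExp.eval, hi, hdst, this, hu, hD u]
  · by_cases hu : u = (ed i).1.2
    · subst hu
      simp [Cmd.run, NExp.eval, hi, hsrc, hdst]
    · have : (u : ℕ) ≠ (ed i).1.2 := fun h => hu (Fin.ext h)
      simp [Cmd.run, NExp.eval, hi, hdst, this, hu, hp u]

theorem bfsRoot_run (h : Env Φ ed s) {D : Fin N → ℕ} {par : Fin N → Option (Fin N)}
    (hD : HasDepths s D) (hp : HasParents s par) (i : Fin Φ.commEdges.card)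
    (h6 : s.nreg 6 = 0) (hi : s.nreg 7 = i + 1) (ω : Tape) :
    HasDepths (bfsRoot.run ω s) (Function.update D (ed i).1.1 1) ∧
    HasParents (bfsRoot.run ω s) par ∧ (bfsRoot.run ω s).nreg 6 = i + 1 := by
  have hsrc := h.src i
  unfold bfsRoot
  rw [Cmd.run, if_pos (by simp [Test.eval, NExp.eval, hi, h6])]
  refine ⟨fun u => ?_, fun u => ?_, by simp [Cmd.run, NExp.eval, hi]⟩
  · by_cases hu : u = (ed i).1.1
    · subst hu
      simp [Cmd.run, NExp.eval, hi, hsrc]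
    · have : (u : ℕ) ≠ (ed i).1.1 := fun h => hu (Fin.ext h)
      simp [Cmd.run, NExp.eval, hi, hsrc, this, hu, hD u]
  · simpa [Cmd.run] using hp u

theorem bfsRoot_run_eq (h : s.nreg 6 ≠ 0 ∨ s.nreg 7 = 0) (ω : Tape) : bfsRoot.run ω s = s := by
  unfold bfsRoot
  rw [Cmd.run, if_neg]
  · rfl
  · simp only [Test.eval, NExp.eval]
    omega

/-- `R` is the graph of the uncoloured edges. -/
def IsUncolored (Φ : Network N) (C : Coloring N) (R : SimpleGraph (Fin N)) : Prop :=
  ∀ x : Link N, R.Adj x.1 x.2 ↔ x ∈ Φ.commEdges ∧ C x = 0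

theorem IsUncolored.exists_index {C : Coloring N} {R : SimpleGraph (Fin N)}
    (hR : IsUncolored Φ C R) (ed : Fin Φ.commEdges.card ≃ Φ.commEdges) {a b : Fin N}
    (hab : R.Adj a b) : ∃ i, (ed i).1 = (a, b) ∧ C (a, b) = 0 := by
  obtain ⟨h1, h2⟩ := (hR (a, b)).1 hab
  exact ⟨ed.symm ⟨_, h1⟩, by simp, h2⟩

theorem bfsBody_spec (h : Env Φ ed s) {C : Coloring N} (hC : ColorState Φ ed s C)
    {R : SimpleGraph (Fin N)} (hR : IsUncolored Φ C R) {D : Fin N → ℕ}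
    {par : Fin N → Option (Fin N)} {root : Fin N → Fin N} (hbfs : PartialBFS R D par root)
    (hD : HasDepths s D) (hp : HasParents s par) :
    Runs ω bfsBody s fun t s' =>
      t ≤ (Φ.commEdges.card + 1) * (bfsScanBody.maxCost + 11) + 4 +
        (bfsRoot.maxCost + bfsExtend.maxCost) ∧
      ((s'.nreg 5 = 0 ∧ HasDepths s' D ∧ HasParents s' par ∧ ∀ a b, R.Adj a b → D b ≠ 0) ∨
        (s'.nreg 5 = s.nreg 5 ∧ ∃ D' par' root', PartialBFS R D' par' root' ∧ HasDepths s' D' ∧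
          HasParents s' par' ∧ parentCount par' = parentCount par + 1)) := by
  have hadj : ∀ i : Fin Φ.commEdges.card, C (ed i).1 = 0 → R.Adj (ed i).1.1 (ed i).1.2 :=
    fun i hi => (hR _).2 ⟨(ed i).2, hi⟩
  apply Runs.seq
  refine (bfsScan_spec h hC hD).mono_frame ?_
  rintro t₁ s₁ hf₁ ⟨ht₁, hfront, hnew⟩
  have he₁ : Env Φ ed s₁ := h.frame hf₁ (by decide)
  have hD₁ : HasDepths s₁ D := by
    intro u
    rw [hf₁.narr 6 (by decide)]; exact hD u
  have hp₁ : HasParents s₁ par := by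
    intro u
    rw [hf₁.narr 7 (by decide)]; exact hp u
  have h5 : s₁.nreg 5 = s.nreg 5 := hf₁.nreg 5 (by decide)
  apply Runs.seq
  refine Runs.of_loopFree (by decide) fun t₂ ht₂ hf₂ => ?_
  refine Runs.of_loopFree (by decide) fun t₃ ht₃ hf₃ => ⟨by omega, ?_⟩
  have h5' : (bfsRoot.run ω s₁).nreg 5 = s.nreg 5 := (hf₂.nreg 5 (by decide)).trans h5
  rcases hfront with ⟨h6, hno⟩ | ⟨i, h6, hfr, hmin⟩
  · rcases hnew with ⟨h7, hno'⟩ | ⟨i, h7, hnew⟩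
    · left
      rw [bfsRoot_run_eq (.inr h7)]
      have hrun : bfsExtend.run ω s₁ = s₁.setN 5 0 := by
        unfold bfsExtend
        rw [Cmd.run, if_pos (by simp [Test.eval, NExp.eval, h6])]
        rfl
      rw [hrun]
      refine ⟨by simp [State.setN], hD₁, hp₁, fun a b hab hb => ?_⟩
      obtain ⟨i, hi, hc⟩ := hR.exists_index ed hab
      by_cases ha : D a = 0
      · exact hno' i (by rw [hi]; exact ⟨⟨hc, hb⟩, ha⟩)
      · exact hno i (by rw [hi]; exact ⟨⟨hc, hb⟩, ha⟩)
    · right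
      obtain ⟨⟨hc, hb⟩, ha⟩ := hnew
      have hab := hadj i hc
      have hclosed : ∀ a b, R.Adj a b → D a ≠ 0 → D b ≠ 0 := by
        intro a b hab ha hb
        obtain ⟨j, hj, hc⟩ := hR.exists_index ed hab
        exact hno j (by rw [hj]; exact ⟨⟨hc, hb⟩, ha⟩)
      obtain ⟨g1, g2, g3⟩ := bfsRoot_run he₁ hD₁ hp₁ i h6 h7 ω
      have he₂ : Env Φ ed (bfsRoot.run ω s₁) := he₁.frame hf₂ (by decide)
      obtain ⟨k1, k2, k3⟩ := bfsExtend_run he₂ g1 g2 i g3 ω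
      have hb' : Function.update D (ed i).1.1 1 (ed i).1.2 = 0 := by
        rw [Function.update_of_ne hab.ne']; exact hb
      refine ⟨k3.trans h5', _, _, _, (hbfs.addRoot hclosed ha).addEdge hab (by simp) hb' ?_,
        k1, k2, ?_⟩
      -- Minimality is automatic here: the fresh root has the smallest possible depth, 1.
      · intro a' b' _ ha' _
        rw [Function.update_self]
        omega
      · exact parentCount_update (hbfs.unvisited _ hb).1 _
  · right
    obtain ⟨⟨hc, hb⟩, ha⟩ := hfr
    have hab := hadj i hc
    rw [bfsRoot_run_eq (.inl (by omega))]
    obtain ⟨k1, k2, k3⟩ := bfsExtend_run he₁ hD₁ hp₁ i h6 ω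
    refine ⟨k3.trans h5, _, _, _, hbfs.addEdge hab ha hb ?_, k1, k2, ?_⟩
    · intro a' b' hab' ha' hb'
      obtain ⟨j, hj, hc⟩ := hR.exists_index ed hab'
      have := hmin j (by rw [hj]; exact ⟨⟨hc, hb'⟩, ha'⟩)
      rwa [hj] at this
    · exact parentCount_update (hbfs.unvisited _ hb).1 _

theorem parentCount_eq_of_hasParents {par : Fin N → Option (Fin N)} (h : HasParents s par) :
    parentCount par = (Finset.univ.filter fun u : Fin N => s.narr 7 u ≠ 0).card := by
  unfold parentCount
  congr 1
  ext u
  simp only [Finset.mem_filter, Finset.mem_univ, true_and, h u]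
  cases par u <;> simp

/-- Each pass costs O(e) and all but the last add a forest edge. This is slower than a standard
search, but colouring a forest edge costs O(e) as well, so nothing is lost in the total. -/
theorem bfsCmd_spec : ∃ c : ℕ, ∀ {N : ℕ} {Φ : Network N}
    {ed : Fin Φ.commEdges.card ≃ Φ.commEdges} {s : State} (ω : Tape) {C : Coloring N}
    {R : SimpleGraph (Fin N)}, Env Φ ed s → ColorState Φ ed s C → IsUncolored Φ C R →
    Runs ω bfsCmd s fun t s' => ∃ D par root, PartialBFS R D par root ∧ HasParents s' par ∧
      (∀ a b, R.Adj a b → D b ≠ 0) ∧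
      t ≤ c * (N + 1) + c * (Φ.commEdges.card + 1) * (parentCount par + 1) := by
  refine ⟨bfsClearBody.maxCost + 11 + (bfsScanBody.maxCost + 11 + 4 +
    (bfsRoot.maxCost + bfsExtend.maxCost) + bfsTest.cost) + 10, ?_⟩
  intro N Φ ed s ω C R he hC hR
  apply Runs.seq
  refine (bfsClear_spec he).mono_frame ?_
  rintro t₁ s₁ hf₁ ⟨ht₁, hD₁, hp₁⟩
  have he₁ : Env Φ ed s₁ := he.frame hf₁ (by decide)
  have hC₁ := hC.frame hf₁ (by decide) (by decide) (by decide) (by decide)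
  apply Runs.seq
  refine ⟨_, _, .nset 5 (.const 1) s₁, ?_⟩
  change Runs ω _ (s₁.setN 5 1) _
  have hf₂ := frame_setN s₁ 5 1
  have he₂ : Env Φ ed (s₁.setN 5 1) := he₁.frame hf₂ (by decide)
  have hC₂ := hC₁.frame hf₂ (by decide) (by decide) (by decide) (by decide)
  set T := (Φ.commEdges.card + 1) * (bfsScanBody.maxCost + 11) + 4 +
        (bfsRoot.maxCost + bfsExtend.maxCost) + bfsTest.cost with hT
  refine (Runs.while (t₀ := 0) (fun t s' => s'.nreg 5 ≤ 1 ∧ ∃ D par root,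
    -- The flag in register 5 reserves the time `T` for the final pass, the one that finds nothing
    -- and clears the flag.
    PartialBFS R D par root ∧ HasDepths s' D ∧ HasParents s' par ∧
    (s'.nreg 5 = 0 → ∀ a b, R.Adj a b → D b ≠ 0) ∧ t + s'.nreg 5 * T ≤ (parentCount par + 1) * T)
    (fun s' => s'.nreg 5 + (N - (Finset.univ.filter fun u : Fin N => s'.narr 7 u ≠ 0).card))
    ?_ ?_).mono ?_
  · refine ⟨by simp [State.setN], _, _, _, partialBFS_init R, hD₁, hp₁, by simp [State.setN], ?_⟩
    have : parentCount (fun _ : Fin N => none) = 0 := by simp [parentCount]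
    simp [State.setN, this]
  · rintro t s' hf ⟨h5, D, par, root, hbfs, hD, hp, -, ht⟩ hb
    have h5' : s'.nreg 5 = 1 := by
      simp only [bfsTest, Test.eval, NExp.eval] at hb
      omega
    have he' : Env Φ ed s' := he₂.frame hf (by decide)
    have hC' := hC₂.frame hf (by decide) (by decide) (by decide) (by decide)
    refine (bfsBody_spec he' hC' hR hbfs hD hp).mono ?_
    rintro t' s'' ⟨ht', ⟨k5, kD, kp, kall⟩ | ⟨k5, D', par', root', kbfs, kD, kp, kcount⟩⟩
    · refine ⟨⟨by omega, D, par, root, hbfs, kD, kp, fun _ => kall, ?_⟩, ?_⟩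
      · rw [h5'] at ht
        rw [k5]
        omega
      · rw [← parentCount_eq_of_hasParents hp, ← parentCount_eq_of_hasParents kp]
        omega
    · refine ⟨⟨by omega, D', par', root', kbfs, kD, kp, fun h => by omega, ?_⟩, ?_⟩
      · rw [k5, h5', kcount]
        rw [h5'] at ht
        have : (parentCount par + 1 + 1) * T = (parentCount par + 1) * T + T := by ring
        omega
      · rw [← parentCount_eq_of_hasParents hp, ← parentCount_eq_of_hasParents kp]
        have := parentCount_le par'
        omega
  · rintro t s' ⟨t', h1, ⟨h5, D, par, root, hbfs, hD, hp, hall, ht⟩, hb⟩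
    have h5' : s'.nreg 5 = 0 := by
      simp only [bfsTest, Test.eval, NExp.eval] at hb
      omega
    refine ⟨D, par, root, hbfs, hp, hall h5', ?_⟩
    rw [h5'] at ht
    clear_value T
    simp only [NExp.cost]
    set e := Φ.commEdges.card
    set A := bfsClearBody.maxCost + 11
    set B := bfsScanBody.maxCost + 11
    set E := bfsRoot.maxCost + bfsExtend.maxCost
    set n := parentCount par
    have hTle : T ≤ (B + 4 + E + bfsTest.cost) * (e + 1) := by
      rw [hT]
      have h1 : E ≤ E * (e + 1) := Nat.le_mul_of_pos_right _ (by omega)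
      have h2 : bfsTest.cost ≤ bfsTest.cost * (e + 1) := Nat.le_mul_of_pos_right _ (by omega)
      have : (B + 4 + E + bfsTest.cost) * (e + 1) = (e + 1) * B + 4 * (e + 1) + E * (e + 1) +
        bfsTest.cost * (e + 1) := by ring
      omega
    have h2 : (n + 1) * T ≤ (n + 1) * ((B + 4 + E + bfsTest.cost) * (e + 1)) :=
      Nat.mul_le_mul_left _ hTle
    have h3 : (A + (B + 4 + E + bfsTest.cost) + 10) * (N + 1) =
        (N + 1) * A + (B + 4 + E + bfsTest.cost) * (N + 1) + 10 * (N + 1) := by ring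
    have h4 : (A + (B + 4 + E + bfsTest.cost) + 10) * (e + 1) * (n + 1) =
        (n + 1) * ((B + 4 + E + bfsTest.cost) * (e + 1)) + (A + 10) * (e + 1) * (n + 1) := by ring
    have h5 : bfsTest.cost ≤ (B + 4 + E + bfsTest.cost) * (N + 1) :=
      le_trans (by omega) (Nat.le_mul_of_pos_right _ (by omega))
    omega

end Spec

end STDMA
end

noncomputable section

namespace STDMA

/-! ### The program: one round, and the main loop -/

/-- Find a breadth first search forest of the uncoloured edges, and colour its edges. -/
def roundCmd : Cmd := .seq bfsCmd (.seq outPass inPass)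

def moreTest : Test := .not (.nle (.reg 1) (.reg 2))

def mainLoop : Cmd := .while moreTest roundCmd

section Spec

variable {N : ℕ} {Φ : Network N} {ed : Fin Φ.commEdges.card ≃ Φ.commEdges} {s s' : State}
  {ω : Tape}

/-- The edge from its parent into a vertex. -/
def outEdge (par : Fin N → Option (Fin N)) (u : Fin N) : Option (Link N) :=
  (par u).map fun p => (p, u)

/-- The edge from a vertex to its parent. -/
def inEdge (par : Fin N → Option (Fin N)) (u : Fin N) : Option (Link N) :=
  (par u).map fun p => (u, p)

/-- Colour the edges of a forest, first those into and then those out of the children. -/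
def roundColor (Φ : Network N) (L : Equiv.Perm (Fin N)) (par : Fin N → Option (Fin N))
    (C : Coloring N) : Coloring N :=
  (List.finRange N).foldl (passStep Φ L (inEdge par))
    ((List.finRange N).foldl (passStep Φ L (outEdge par)) C)

theorem foldl_outEdge_ne_zero (L : Equiv.Perm (Fin N)) (par : Fin N → Option (Fin N))
    (C : Coloring N) (x : Link N) :
    (List.finRange N).foldl (passStep Φ L (outEdge par)) C x ≠ 0 ↔
      C x ≠ 0 ∨ par x.2 = some x.1 := by
  rw [foldl_passStep_ne_zero]
  refine or_congr_right ⟨?_, fun h => ⟨L x.2, by simp, by simp [outEdge, h]⟩⟩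
  rintro ⟨j, -, hj⟩
  simp only [outEdge, Option.map_eq_some_iff] at hj
  obtain ⟨p, hp, rfl⟩ := hj
  exact hp

theorem foldl_inEdge_ne_zero (L : Equiv.Perm (Fin N)) (par : Fin N → Option (Fin N))
    (C : Coloring N) (x : Link N) :
    (List.finRange N).foldl (passStep Φ L (inEdge par)) C x ≠ 0 ↔
      C x ≠ 0 ∨ par x.1 = some x.2 := by
  rw [foldl_passStep_ne_zero]
  refine or_congr_right ⟨?_, fun h => ⟨L x.1, by simp, by simp [inEdge, h]⟩⟩
  rintro ⟨j, -, hj⟩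
  simp only [inEdge, Option.map_eq_some_iff] at hj
  obtain ⟨p, hp, rfl⟩ := hj
  exact hp

theorem roundColor_ne_zero (L : Equiv.Perm (Fin N)) (par : Fin N → Option (Fin N))
    (C : Coloring N) (x : Link N) :
    roundColor Φ L par C x ≠ 0 ↔ C x ≠ 0 ∨ par x.2 = some x.1 ∨ par x.1 = some x.2 := by
  rw [roundColor, foldl_inEdge_ne_zero, foldl_outEdge_ne_zero, or_assoc]

theorem IsUncolored.roundColor {C : Coloring N} {R : SimpleGraph (Fin N)}
    (hR : IsUncolored Φ C R) (L : Equiv.Perm (Fin N)) {D : Fin N → ℕ}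
    {par : Fin N → Option (Fin N)} {root : Fin N → Fin N} (h : PartialBFS R D par root) :
    IsUncolored Φ (roundColor Φ L par C) (R \ parentGraph par) := by
  intro x
  have h1 := roundColor_ne_zero (Φ := Φ) L par C x
  have h2 := hR x
  rw [SimpleGraph.sdiff_adj, h.parentGraph_adj, h2]
  tauto

/-- If nobody had a parent, both ends of an edge would be their own roots, although a component has
only one root. -/
theorem PartialBFS.parentCount_pos {R : SimpleGraph (Fin N)} {D : Fin N → ℕ}
    {par : Fin N → Option (Fin N)} {root : Fin N → Fin N} (h : PartialBFS R D par root)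
    (hall : ∀ a b, R.Adj a b → D b ≠ 0) (hR : R ≠ ⊥) : 0 < parentCount par := by
  obtain ⟨a, b, -, hab⟩ := SimpleGraph.ne_bot_iff_exists_adj.1 hR |>.imp fun a h =>
    h.imp fun b h => (⟨h.ne, h⟩ : a ≠ b ∧ R.Adj a b)
  by_contra h0
  have hnone : ∀ u, par u = none := by
    intro u
    by_contra hu
    apply h0
    exact Finset.card_pos.2 ⟨u, by simpa [Option.isSome_iff_ne_none] using hu⟩
  have ha := hall b a hab.symm
  have hb := hall a b hab
  have h1 := h.root_eq a b ha hb hab.reachable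
  rw [(h.isRoot a ha (hnone a)).1, (h.isRoot b hb (hnone b)).1] at h1
  exact hab.ne h1

-- The outward pass alone colours one new link per forest edge. This pays for the passes of the
-- search.
open Classical in
theorem card_colored_outEdge_le (L : Equiv.Perm (Fin N)) {par : Fin N → Option (Fin N)}
    {C : Coloring N} (h0 : ∀ u p, par u = some p → C (p, u) = 0) :
    (Finset.univ.filter fun x => C x ≠ 0).card + parentCount par ≤
      (Finset.univ.filter fun x =>
        (List.finRange N).foldl (passStep Φ L (outEdge par)) C x ≠ 0).card := by
  let g : Fin N → Link N := fun u => ((par u).getD u, u)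
  have hg : Function.Injective g := fun u u' h => congrArg Prod.snd h
  have hsome : ∀ u, (par u).isSome = true → par u = some (g u).1 := by
    intro u hu
    obtain ⟨p, hp⟩ := Option.isSome_iff_exists.1 hu
    simp [g, hp]
  have hdisj : Disjoint (Finset.univ.filter fun x => C x ≠ 0)
      ((Finset.univ.filter fun u => (par u).isSome).image g) := by
    rw [Finset.disjoint_left]
    intro x hx hx'
    simp only [Finset.mem_image, Finset.mem_filter, Finset.mem_univ, true_and] at hx hx'
    obtain ⟨u, hu, rfl⟩ := hx'
    exact hx (h0 u _ (hsome u hu))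
  rw [parentCount, ← Finset.card_image_of_injective _ hg, ← Finset.card_union_of_disjoint hdisj]
  apply Finset.card_le_card
  intro x hx
  simp only [Finset.mem_union, Finset.mem_image, Finset.mem_filter, Finset.mem_univ,
    true_and] at hx ⊢
  rw [foldl_outEdge_ne_zero]
  rcases hx with hx | ⟨u, hu, rfl⟩
  · exact .inl hx
  · exact .inr (hsome u hu)

/-- Here `n` is the number of forest edges and `m₀`, `m₁`, `m₂` count the coloured links before,
between and after the two passes. Since at least `n > 0` links are new, both the O(e(n + 1)) search
and the O(N) overhead are covered by O(N + e) per new link. -/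
theorem round_time_le {cb cp N e n m₀ m₁ m₂ t₁ t₂ t₃ : ℕ}
    (h₁ : t₁ ≤ cb * (N + 1) + cb * (e + 1) * (n + 1))
    (h₂ : t₂ + cp * (e + 1) * m₀ ≤ cp * (N + 1) + cp * (e + 1) * m₁)
    (h₃ : t₃ + cp * (e + 1) * m₁ ≤ cp * (N + 1) + cp * (e + 1) * m₂)
    (hn : 0 < n) (hm₁ : m₀ + n ≤ m₁) (hm₂ : m₁ ≤ m₂) :
    t₁ + (t₂ + t₃) + (3 * cb + 3 * cp) * (N + e + 2) * m₀ ≤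
      (3 * cb + 3 * cp) * (N + e + 2) * m₂ := by
  obtain ⟨d, rfl⟩ : ∃ d, m₂ = m₀ + d := ⟨m₂ - m₀, by omega⟩
  have hd : n ≤ d := by omega
  have h4 : cp * (e + 1) * (m₀ + d) = cp * (e + 1) * m₀ + cp * (e + 1) * d := by ring
  have h5 : cb * (e + 1) * (n + 1) ≤ cb * (e + 1) * (2 * d) := Nat.mul_le_mul_left _ (by omega)
  have h6 : (cb + 2 * cp) * (N + 1) ≤ (cb + 2 * cp) * (N + 1) * d :=
    Nat.le_mul_of_pos_right _ (by omega)
  have h7 : (3 * cb + 3 * cp) * (N + e + 2) * (m₀ + d) = (3 * cb + 3 * cp) * (N + e + 2) * m₀ +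
      ((cb + 2 * cp) * (N + 1) * d + cb * (e + 1) * (2 * d) + cp * (e + 1) * d +
        ((2 * cb + cp) * (N + 1) * d + (cb + 2 * cp) * (e + 1) * d)) := by ring
  have h8 : (cb + 2 * cp) * (N + 1) = cb * (N + 1) + cp * (N + 1) + cp * (N + 1) := by ring
  rw [h7]
  omega

theorem roundCmd_spec : ∃ c : ℕ, ∀ {N : ℕ} {Φ : Network N}
    {ed : Fin Φ.commEdges.card ≃ Φ.commEdges} {s : State} (ω : Tape) {C : Coloring N}
    {R : SimpleGraph (Fin N)} {L : Equiv.Perm (Fin N)}, Env Φ ed s → ColorState Φ ed s C →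
    IsUncolored Φ C R → HasInverse s L → R ≠ ⊥ →
    Runs ω roundCmd s fun t s' => ∃ D par root, PartialBFS R D par root ∧
      (∀ a b, R.Adj a b → D b ≠ 0) ∧ Env Φ ed s' ∧ ColorState Φ ed s' (roundColor Φ L par C) ∧
      t + c * (N + Φ.commEdges.card + 2) * s.nreg 2 ≤
        c * (N + Φ.commEdges.card + 2) * s'.nreg 2 ∧ s.nreg 2 < s'.nreg 2 := by
  obtain ⟨cb, hcb⟩ := bfsCmd_spec
  obtain ⟨cp, hcp⟩ := passLoop_spec
  refine ⟨3 * cb + 3 * cp, ?_⟩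
  intro N Φ ed s ω C R L he hC hR hL hne
  apply Runs.seq
  refine (hcb ω he hC hR).mono_frame ?_
  rintro t₁ s₁ hf₁ ⟨D, par, root, hbfs, hpar, hall, ht₁⟩
  have he₁ : Env Φ ed s₁ := he.frame hf₁ (by decide)
  have hC₁ := hC.frame hf₁ (by decide) (by decide) (by decide) (by decide)
  have hL₁ : HasInverse s₁ L := by
    intro j
    rw [hf₁.narr 4 (by decide)]; exact hL j
  have hadj : ∀ u p, par u = some p → R.Adj p u := fun u p h => (hbfs.parent u p h).1
  apply Runs.seq
  have hout := hcp ω (L := L) (par := par) parentExp (.reg 9) (fun u p => (p, u)) (by decide)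
    (fun s u p h1 h2 => by simp [parentExp, NExp.eval, h1, h2])
    (fun u p u' p' h _ _ => congrArg Prod.snd h)
    (fun u p hp => (hR (p, u)).1 (hadj u p hp)) he₁ hC₁ hL₁ hpar
  refine Runs.mono_frame hout ?_
  rintro t₂ s₂ hf₂ ⟨ht₂, he₂, hC₂⟩
  change ColorState Φ ed s₂ ((List.finRange N).foldl (passStep Φ L (outEdge par)) C) at hC₂
  have hL₂ : HasInverse s₂ L := by
    intro j
    rw [hf₂.narr 4 (by decide)]; exact hL₁ j
  have hpar₂ : HasParents s₂ par := by
    intro j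
    rw [hf₂.narr 7 (by decide)]; exact hpar j
  have hin := hcp ω (L := L) (par := par) (.reg 9) parentExp (fun u p => (u, p)) (by decide)
    (fun s u p h1 h2 => by simp [parentExp, NExp.eval, h1, h2])
    (fun u p u' p' h _ _ => congrArg Prod.fst h)
    (fun u p hp => by
      have h1 := (hR (u, p)).1 (hadj u p hp).symm
      refine ⟨h1.1, ?_⟩
      by_contra h2
      rcases (foldl_outEdge_ne_zero L par C (u, p)).1 h2 with h3 | h3
      · exact h3 h1.2
      · have h4 := (hbfs.parent u p hp).2.2.1
        have h5 := (hbfs.parent p u h3).2.2.1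
        omega) he₂ hC₂ hL₂ hpar₂
  refine Runs.mono hin ?_
  rintro t₃ s₃ ⟨ht₃, he₃, hC₃⟩
  have hpos := hbfs.parentCount_pos hall hne
  have hm₁ : s₁.nreg 2 + parentCount par ≤ s₂.nreg 2 := by
    rw [hC₁.count, hC₂.count]
    exact card_colored_outEdge_le L fun u p hp => ((hR (p, u)).1 (hadj u p hp)).2
  have hm₂ : s₂.nreg 2 ≤ s₃.nreg 2 := by
    rw [hC₂.count, hC₃.count]
    apply Finset.card_le_card
    intro x hx
    simp only [Finset.mem_filter, Finset.mem_univ, true_and] at hx ⊢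
    exact (foldl_inEdge_ne_zero L par _ x).2 (.inl hx)
  have h2 : s₁.nreg 2 = s.nreg 2 := hf₁.nreg 2 (by decide)
  rw [h2] at hm₁ ht₂
  refine ⟨D, par, root, hbfs, hall, he₃, hC₃, ?_, by omega⟩
  exact round_time_le ht₁ ht₂ ht₃ hpos hm₁ hm₂

end Spec

end STDMA
end

noncomputable section

namespace STDMA

/-! ### Identifying the rounds of the program with the schedule of the algorithm -/

section Spec

variable {N : ℕ} {Φ : Network N} {ed : Fin Φ.commEdges.card ≃ Φ.commEdges} {s s' : State}
  {ω : Tape}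

theorem residual_congr {V : Type*} {G : SimpleGraph V} {F F' : ℕ → SimpleGraph V} :
    ∀ {i : ℕ}, (∀ j < i, F j = F' j) → residual G F i = residual G F' i
  | 0, _ => rfl
  | i + 1, h => by
    rw [residual, residual, residual_congr fun j hj => h j (by omega), h i (by omega)]

/-- The result of `m` rounds with the forests given by the parent functions `par i`. -/
def scheduleRounds (Φ : Network N) (L : Equiv.Perm (Fin N)) (par : ℕ → Fin N → Option (Fin N))
    (m : ℕ) : Coloring N :=
  (List.range m).foldl (fun C i => roundColor Φ L (par i) C) fun _ => 0

theorem scheduleRounds_succ (L : Equiv.Perm (Fin N)) (par : ℕ → Fin N → Option (Fin N)) (m : ℕ) :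
    scheduleRounds Φ L par (m + 1) = roundColor Φ L (par m) (scheduleRounds Φ L par m) := by
  simp [scheduleRounds, List.range_succ]

theorem scheduleRounds_congr (L : Equiv.Perm (Fin N)) {par par' : ℕ → Fin N → Option (Fin N)} :
    ∀ {m : ℕ}, (∀ i < m, par i = par' i) → scheduleRounds Φ L par m = scheduleRounds Φ L par' m
  | 0, _ => rfl
  | m + 1, h => by
    rw [scheduleRounds_succ, scheduleRounds_succ, scheduleRounds_congr L fun i hi => h i (by omega),
      h m (by omega)]

/-- The records of `m` rounds of breadth first search. -/
structure Rounds (G : SimpleGraph (Fin N)) (m : ℕ) (depth : ℕ → Fin N → ℕ)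
    (par : ℕ → Fin N → Option (Fin N)) (root : ℕ → Fin N → Fin N) : Prop where
  bfs : ∀ i < m, PartialBFS (residual G (fun i => parentGraph (par i)) i) (depth i) (par i) (root i)
  all : ∀ i < m, ∀ a b, (residual G (fun i => parentGraph (par i)) i).Adj a b → depth i b ≠ 0
  ne_bot : ∀ i < m, residual G (fun i => parentGraph (par i)) i ≠ ⊥

/-- Recording the forest with index `m` does not disturb the residual graphs up to `m`, which depend
only on earlier forests. -/
theorem Rounds.succ {G : SimpleGraph (Fin N)} {m : ℕ} {depth : ℕ → Fin N → ℕ}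
    {par : ℕ → Fin N → Option (Fin N)} {root : ℕ → Fin N → Fin N} (h : Rounds G m depth par root)
    {D : Fin N → ℕ} {p : Fin N → Option (Fin N)} {r : Fin N → Fin N}
    (hbfs : PartialBFS (residual G (fun i => parentGraph (par i)) m) D p r)
    (hall : ∀ a b, (residual G (fun i => parentGraph (par i)) m).Adj a b → D b ≠ 0)
    (hne : residual G (fun i => parentGraph (par i)) m ≠ ⊥) :
    Rounds G (m + 1) (Function.update depth m D) (Function.update par m p)
      (Function.update root m r) := by
  have hres : ∀ i ≤ m, residual G (fun i => parentGraph (Function.update par m p i)) i =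
      residual G (fun i => parentGraph (par i)) i := by
    intro i hi
    apply residual_congr
    intro j hj
    rw [Function.update_of_ne (by omega)]
  constructor
  · intro i hi
    rw [hres i (by omega)]
    by_cases him : i = m
    · subst him; simpa using hbfs
    · simpa [him] using h.bfs i (by omega)
  · intro i hi
    rw [hres i (by omega)]
    by_cases him : i = m
    · subst him; simpa using hall
    · simpa [him] using h.all i (by omega)
  · intro i hi
    rw [hres i (by omega)]
    by_cases him : i = m
    · subst him; exact hne
    · exact h.ne_bot i (by omega)

/-- A decomposition into breadth first search forests from the records of the search. -/
def Rounds.decomposition {G : SimpleGraph (Fin N)} {m : ℕ} {depth : ℕ → Fin N → ℕ}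
    {par : ℕ → Fin N → Option (Fin N)} {root : ℕ → Fin N → Fin N} (h : Rounds G m depth par root)
    (hbot : residual G (fun i => parentGraph (par i)) m = ⊥) : BFSDecomposition G where
  m := m
  F i := parentGraph (par i)
  root := root
  isBFSForest i hi := (h.bfs i hi).isBFSForest (h.all i hi)
  residual_ne_bot := h.ne_bot
  residual_eq_bot := hbot

/-- The choice made in `colorStep` is harmless because a vertex has at most one associated edge. -/
theorem colorStep_eq_passStep (L : Equiv.Perm (Fin N)) (D : BFSDecomposition Φ.graph)
    (edgeOf : Fin N → Option (Link N)) (i : ℕ)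
    (h : ∀ u x, D.IsEdgeOf i u x ↔ edgeOf u = some x) (C : Coloring N) (j : Fin N) :
    colorStep Φ L D C (i, j) = passStep Φ L edgeOf C j := by
  unfold colorStep passStep
  split_ifs with hex
  · have h1 := (h _ _).1 hex.choose_spec
    rw [h1]
    rfl
  · rcases hu : edgeOf (L.symm j) with _ | x
    · rfl
    · exact (hex ⟨x, (h _ _).2 hu⟩).elim

/-- The oriented graphs with indices 2i and 2i + 1 are the links from parents to children and back
in the i-th forest, so scanning them two at a time reproduces one round. -/
theorem Rounds.schedule_eq {m : ℕ} {depth : ℕ → Fin N → ℕ}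
    {par : ℕ → Fin N → Option (Fin N)} {root : ℕ → Fin N → Fin N}
    (h : Rounds Φ.graph m depth par root)
    (hbot : residual Φ.graph (fun i => parentGraph (par i)) m = ⊥) (L : Equiv.Perm (Fin N)) :
    conflictFreeLinkSchedule Φ L (h.decomposition hbot) = scheduleRounds Φ L par m := by
  set D := h.decomposition hbot with hD
  have hout : ∀ i < m, ∀ u x, D.IsEdgeOf (2 * i) u x ↔ outEdge (par i) u = some x := by
    intro i hi u x
    have hdiv : 2 * i / 2 = i := by omega
    have key := (h.bfs i hi).adj_and_dist_iff (a := x.1) (b := x.2)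
    have hF : D.F i = parentGraph (par i) := rfl
    have hr : D.root i = root i := rfl
    unfold BFSDecomposition.IsEdgeOf BFSDecomposition.oriented
    rw [if_pos (even_two_mul i), if_pos (even_two_mul i), hdiv, hF, hr, key]
    simp only [outEdge, Option.map_eq_some_iff]
    constructor
    · rintro ⟨h1, rfl⟩
      exact ⟨x.1, h1, rfl⟩
    · rintro ⟨p, h1, rfl⟩
      exact ⟨h1, rfl⟩
  have hin : ∀ i < m, ∀ u x, D.IsEdgeOf (2 * i + 1) u x ↔ inEdge (par i) u = some x := by
    intro i hi u x
    have hdiv : (2 * i + 1) / 2 = i := by omega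
    have hodd : ¬ Even (2 * i + 1) := by simp
    have key := (h.bfs i hi).adj_and_dist_iff (a := x.2) (b := x.1)
    have hF : D.F i = parentGraph (par i) := rfl
    have hr : D.root i = root i := rfl
    unfold BFSDecomposition.IsEdgeOf BFSDecomposition.oriented
    rw [if_neg hodd, if_neg hodd, hdiv, hF, hr, SimpleGraph.adj_comm, key]
    simp only [inEdge, Option.map_eq_some_iff]
    constructor
    · rintro ⟨h1, rfl⟩
      exact ⟨x.2, h1, rfl⟩
    · rintro ⟨p, h1, rfl⟩
      exact ⟨h1, rfl⟩
  have hfold : ∀ k ≤ m, ((List.range (2 * k)).flatMap fun i =>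
      (List.finRange N).map fun j => (i, j)).foldl (colorStep Φ L D) (fun _ => 0) =
      scheduleRounds Φ L par k := by
    intro k
    induction k with
    | zero => intro _; rfl
    | succ k ih =>
      intro hk
      have hrange : List.range (2 * (k + 1)) = List.range (2 * k) ++ [2 * k, 2 * k + 1] := by
        rw [show 2 * (k + 1) = 2 * k + 1 + 1 by ring, List.range_succ, List.range_succ]
        simp
      rw [hrange, List.flatMap_append, List.foldl_append, ih (by omega), scheduleRounds_succ]
      simp only [List.flatMap_cons, List.flatMap_nil, List.append_nil, List.foldl_append,
        List.foldl_map, roundColor]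
      simp only [colorStep_eq_passStep L D _ _ (hout k (by omega)),
        colorStep_eq_passStep L D _ _ (hin k (by omega))]
  exact hfold m le_rfl

-- The invariant identifies the uncoloured links with the current residual graph. Hence fewer than e
-- coloured links means that the residual graph is nonempty and another search is legitimate, and
-- exactly e means that the decomposition is complete.
open Classical in
theorem mainLoop_spec : ∃ c : ℕ, ∀ {N : ℕ} {Φ : Network N}
    {ed : Fin Φ.commEdges.card ≃ Φ.commEdges} {s : State} (ω : Tape) {L : Equiv.Perm (Fin N)},
    Env Φ ed s → ColorState Φ ed s (fun _ => 0) → HasInverse s L →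
    Runs ω mainLoop s fun t s' => ∃ D : BFSDecomposition Φ.graph,
      HasColors Φ ed s' (conflictFreeLinkSchedule Φ L D) ∧
      t ≤ c * (N + Φ.commEdges.card + 2) * Φ.commEdges.card + moreTest.cost := by
  obtain ⟨c, hc⟩ := roundCmd_spec
  refine ⟨c + moreTest.cost, ?_⟩
  intro N Φ ed s ω L he hC hL
  set W := (c + moreTest.cost) * (N + Φ.commEdges.card + 2) with hW
  refine (Runs.while (t₀ := 0) (fun t s' => ∃ m depth par root, Rounds Φ.graph m depth par root ∧
    IsUncolored Φ (scheduleRounds Φ L par m)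
      (residual Φ.graph (fun i => parentGraph (par i)) m) ∧ Env Φ ed s' ∧
    ColorState Φ ed s' (scheduleRounds Φ L par m) ∧ t ≤ W * s'.nreg 2)
    (fun s' => Φ.commEdges.card - s'.nreg 2) ?_ ?_).mono ?_
  · refine ⟨0, fun _ _ => 0, fun _ _ => none, fun _ => id, ⟨by simp, by simp, by simp⟩, ?_, he, hC,
      by simp⟩
    intro x
    simp [residual, scheduleRounds, Network.commEdges]
  · rintro t s' hf ⟨m, depth, par, root, hrounds, hunc, he', hC', ht⟩ hb
    have hL' : HasInverse s' L := by
      intro j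
      rw [hf.narr 4 (by decide)]; exact hL j
    have hlt : s'.nreg 2 < Φ.commEdges.card := by
      simpa [moreTest, Test.eval, NExp.eval, he'.edges] using hb
    have hne : residual Φ.graph (fun i => parentGraph (par i)) m ≠ ⊥ := by
      intro hbot
      rw [hC'.count] at hlt
      obtain ⟨x, hx, hx'⟩ := Finset.exists_mem_notMem_of_card_lt_card hlt
      have := (hunc x).2 ⟨hx, by simpa using hx'⟩
      rw [hbot] at this
      exact this
    refine (hc ω he' hC' hunc hL' hne).mono ?_
    rintro t' s'' ⟨D, p, r, hbfs, hall, he'', hC'', ht', hlt'⟩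
    have hle : s''.nreg 2 ≤ Φ.commEdges.card := by
      rw [hC''.count]
      exact card_colored_le hC''.off
    have hsched : scheduleRounds Φ L (Function.update par m p) (m + 1) =
        roundColor Φ L p (scheduleRounds Φ L par m) := by
      rw [scheduleRounds_succ, Function.update_self,
        scheduleRounds_congr L (par' := par) fun i hi => Function.update_of_ne (by omega) _ _]
    have hres : residual Φ.graph (fun i => parentGraph (Function.update par m p i)) (m + 1) =
        residual Φ.graph (fun i => parentGraph (par i)) m \ parentGraph p := by
      rw [residual, Function.update_self, residual_congr (F' := fun i => parentGraph (par i))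
        fun i hi => by rw [Function.update_of_ne (by omega)]]
    refine ⟨⟨m + 1, _, _, _, hrounds.succ hbfs hall hne, ?_, he'', ?_, ?_⟩, by omega⟩
    · rw [hsched, hres]
      exact hunc.roundColor L hbfs
    · rw [hsched]
      exact hC''
    · have h1 : W * s''.nreg 2 = c * (N + Φ.commEdges.card + 2) * s''.nreg 2 +
          moreTest.cost * (N + Φ.commEdges.card + 2) * s''.nreg 2 := by rw [hW]; ring
      have h2 : W * s'.nreg 2 = c * (N + Φ.commEdges.card + 2) * s'.nreg 2 +
          moreTest.cost * (N + Φ.commEdges.card + 2) * s'.nreg 2 := by rw [hW]; ring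
      have h3 : moreTest.cost * (N + Φ.commEdges.card + 2) * s'.nreg 2 + moreTest.cost ≤
          moreTest.cost * (N + Φ.commEdges.card + 2) * s''.nreg 2 := by
        calc _ ≤ moreTest.cost * (N + Φ.commEdges.card + 2) * (s'.nreg 2 + 1) := by
              rw [Nat.mul_succ]
              exact Nat.add_le_add_left (Nat.le_mul_of_pos_right _ (Nat.succ_pos _)) _
          _ ≤ _ := Nat.mul_le_mul_left _ hlt'
      omega
  · rintro t s' ⟨t', h1, ⟨m, depth, par, root, hrounds, hunc, he', hC', ht⟩, hb⟩
    have hge : Φ.commEdges.card ≤ s'.nreg 2 := by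
      simpa [moreTest, Test.eval, NExp.eval, he'.edges] using hb
    have hle : s'.nreg 2 ≤ Φ.commEdges.card := by
      rw [hC'.count]
      exact card_colored_le hC'.off
    have hbot : residual Φ.graph (fun i => parentGraph (par i)) m = ⊥ := by
      have hsub : (Finset.univ.filter fun x => scheduleRounds Φ L par m x ≠ 0) ⊆ Φ.commEdges := by
        intro x hx
        by_contra hn
        exact (Finset.mem_filter.1 hx).2 (hC'.off x hn)
      have heq := Finset.eq_of_subset_of_card_le hsub (by rw [← hC'.count]; exact hge)
      ext a b
      simp only [SimpleGraph.bot_adj, iff_false]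
      intro hab
      obtain ⟨h2, h3⟩ := (hunc (a, b)).1 hab
      rw [← heq] at h2
      exact (Finset.mem_filter.1 h2).2 h3
    refine ⟨hrounds.decomposition hbot, ?_, ?_⟩
    · intro i
      rw [hrounds.schedule_eq hbot L]
      exact hC'.colors i
    · have : s'.nreg 2 = Φ.commEdges.card := le_antisymm hle hge
      rw [this] at ht
      omega

end Spec

end STDMA
end

noncomputable section

namespace STDMA

/-! ### The random labelling -/

section Shuffle

/-- The incremental shuffle: at time `k`, the entry at the position `c k ≤ k` is moved to the
position `k` and replaced by `k + 1`. -/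
def shuffle (c : ℕ → ℕ) : ℕ → ℕ → ℕ
  | 0 => fun _ => 0
  | k + 1 => Function.update (Function.update (shuffle c k) k (shuffle c k (c k))) (c k) (k + 1)

variable {c c' : ℕ → ℕ} {n : ℕ}

theorem shuffle_succ_self (c : ℕ → ℕ) (n : ℕ) : shuffle c (n + 1) (c n) = n + 1 :=
  Function.update_self ..

theorem shuffle_succ_last (h : c n ≠ n) : shuffle c (n + 1) n = shuffle c n (c n) := by
  rw [shuffle, Function.update_of_ne h.symm, Function.update_self]

theorem shuffle_succ_of_ne {i : ℕ} (h : i ≠ c n) (h' : i ≠ n) :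
    shuffle c (n + 1) i = shuffle c n i := by
  rw [shuffle, Function.update_of_ne h, Function.update_of_ne h']

theorem shuffle_congr (h : ∀ k < n, c k = c' k) : shuffle c n = shuffle c' n := by
  induction n with
  | zero => rfl
  | succ n ih => rw [shuffle, shuffle, ih fun k hk => h k (by omega), h n (by omega)]

theorem shuffle_mem (hc : ∀ k < n, c k ≤ k) {i : ℕ} (hi : i < n) :
    1 ≤ shuffle c n i ∧ shuffle c n i ≤ n := by
  induction n generalizing i with
  | zero => omega
  | succ n ih =>
    have ih' := fun j hj => @ih (fun k hk => hc k (by omega)) j hj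
    by_cases h : i = c n
    · rw [h, shuffle_succ_self]
      omega
    by_cases h' : i = n
    · have hcn := hc n (by omega)
      rw [h', shuffle_succ_last (by omega)]
      have := ih' (c n) (by omega)
      omega
    · rw [shuffle_succ_of_ne h h']
      have := ih' i (by omega)
      omega

/-- The largest value betrays the last choice, because all older values are at most `n`. This makes
the shuffle reversible. -/
theorem eq_of_shuffle_succ_eq (hc : ∀ k < n + 1, c k ≤ k) {i : ℕ} (hi : i < n + 1)
    (h : shuffle c (n + 1) i = n + 1) : i = c n := by
  by_contra h1
  have hm := fun j hj => @shuffle_mem c n (fun k hk => hc k (by omega)) j hj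
  by_cases h' : i = n
  · have hcn := hc n (by omega)
    rw [h', shuffle_succ_last (by omega)] at h
    have := hm (c n) (by omega)
    omega
  · rw [shuffle_succ_of_ne h1 h'] at h
    have := hm i (by omega)
    omega

theorem shuffle_injOn (hc : ∀ k < n, c k ≤ k) : Set.InjOn (shuffle c n) (Set.Iio n) := by
  induction n with
  | zero => intro i hi; exact absurd hi (by simp)
  | succ n ih =>
    have ih' := ih fun k hk => hc k (by omega)
    have hcn := hc n (by omega)
    intro i hi j hj hij
    simp only [Set.mem_Iio] at hi hj
    by_cases h1 : i = c n
    · rw [h1, shuffle_succ_self] at hij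
      rw [h1, eq_of_shuffle_succ_eq hc hj hij.symm]
    by_cases h2 : j = c n
    · rw [h2, shuffle_succ_self] at hij
      exact absurd (eq_of_shuffle_succ_eq hc hi hij) h1
    by_cases h3 : i = n <;> by_cases h4 : j = n
    · omega
    · rw [h3, shuffle_succ_last (by omega), shuffle_succ_of_ne h2 h4] at hij
      exact absurd (ih' (by simp; omega) (by simp; omega) hij) (Ne.symm h2)
    · rw [h4, shuffle_succ_last (by omega), shuffle_succ_of_ne h1 h3] at hij
      exact absurd (ih' (by simp; omega) (by simp; omega) hij) h1
    · rw [shuffle_succ_of_ne h1 h3, shuffle_succ_of_ne h2 h4] at hij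
      exact ih' (by simp; omega) (by simp; omega) hij

/-- The choices can be recovered from the result of the shuffle. -/
theorem eq_of_shuffle_eq (hc : ∀ k < n, c k ≤ k) (hc' : ∀ k < n, c' k ≤ k)
    (h : ∀ i < n, shuffle c n i = shuffle c' n i) : ∀ k < n, c k = c' k := by
  induction n with
  | zero => intro k hk; omega
  | succ n ih =>
    have hcn := hc n (by omega)
    have hcn' := hc' n (by omega)
    have hn : c n = c' n := by
      apply eq_of_shuffle_succ_eq hc' (by omega)
      rw [← h _ (by omega), shuffle_succ_self]
    have := ih (fun k hk => hc k (by omega)) (fun k hk => hc' k (by omega)) fun i hi => by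
      by_cases h1 : i = c n
      · have := h n (by omega)
        rwa [shuffle_succ_last (by omega), shuffle_succ_last (by omega), ← hn, ← h1] at this
      · have := h i (by omega)
        rwa [shuffle_succ_of_ne h1 (by omega), shuffle_succ_of_ne (by omega) (by omega)] at this
    intro k hk
    by_cases hkn : k = n
    · rw [hkn, hn]
    · exact this k (by omega)

/-- The permutation given by a shuffle. -/
theorem exists_perm_shuffle (hc : ∀ k < n, c k ≤ k) :
    ∃ L : Equiv.Perm (Fin n), ∀ i : Fin n, shuffle c n i = (L i : ℕ) + 1 := by
  have hm := fun (i : Fin n) => shuffle_mem hc i.2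
  let f : Fin n → Fin n := fun i => ⟨shuffle c n i - 1, by have := hm i; have := i.2; omega⟩
  have hf : Function.Injective f := by
    intro i j hij
    have h1 := Fin.mk.inj_iff.1 hij
    have := hm i
    have := hm j
    exact Fin.ext (shuffle_injOn hc i.2 j.2 (by omega))
  refine ⟨Equiv.ofBijective f (Finite.injective_iff_bijective.1 hf), fun i => ?_⟩
  have := hm i
  change _ = shuffle c n i - 1 + 1
  omega

/-- Every permutation is the result of a shuffle. -/
theorem exists_shuffle_eq (L : Equiv.Perm (Fin n)) :
    ∃ c : ℕ → ℕ, (∀ k < n, c k ≤ k) ∧ ∀ i : Fin n, shuffle c n i = (L i : ℕ) + 1 := by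
  let ext (a : (k : Fin n) → Fin (k + 1)) (k : ℕ) : ℕ := if h : k < n then a ⟨k, h⟩ else 0
  have hext : ∀ a, ∀ k < n, ext a k ≤ k := by
    intro a k hk
    simp only [ext, dif_pos hk]
    exact Nat.lt_succ_iff.1 (a ⟨k, hk⟩).2
  choose g hg using fun a => exists_perm_shuffle (hext a)
  have hinj : Function.Injective g := by
    intro a b hab
    funext k
    have h1 := eq_of_shuffle_eq (hext a) (hext b)
      (fun i hi => by rw [hg a ⟨i, hi⟩, hg b ⟨i, hi⟩, hab]) k k.2
    simp only [ext, dif_pos k.2] at h1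
    exact Fin.ext h1
  -- There are n! sequences of choices, as many as permutations, so the injective map `g` is also
  -- surjective.
  have hcard : Fintype.card ((k : Fin n) → Fin (k + 1)) = Fintype.card (Equiv.Perm (Fin n)) := by
    rw [Fintype.card_pi, Fintype.card_perm, Fintype.card_fin]
    simp only [Fintype.card_fin]
    rw [Fin.prod_univ_eq_prod_range (fun k => k + 1), Finset.prod_range_add_one_eq_factorial]
  obtain ⟨a, ha⟩ := ((Fintype.bijective_iff_injective_and_card g).2 ⟨hinj, hcard⟩).2 L
  exact ⟨ext a, hext a, fun i => by rw [hg a i, ha]⟩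

end Shuffle

/-- The entries at the distinct positions (k, k) are independent, and the k-th takes a prescribed
value with probability 1 / (k + 1). -/
theorem tapeMeasure_cylinder {n : ℕ} {c : ℕ → ℕ} (hc : ∀ k < n, c k ≤ k) :
    tapeMeasure {ω | ∀ k < n, (ω (k, k) : ℕ) = c k} = 1 / (n.factorial : ENNReal) := by
  let S : Finset (ℕ × ℕ) := (Finset.range n).image fun k => (k, k)
  let t (p : ℕ × ℕ) : Set (Fin (p.2 + 1)) := {x | (x : ℕ) = c p.1}
  have hset : {ω : Tape | ∀ k < n, (ω (k, k) : ℕ) = c k} = Set.pi S t := by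
    ext ω
    simp [S, t, Set.mem_pi]
  rw [hset, tapeMeasure, MeasureTheory.Measure.infinitePi_pi _ fun _ _ => .of_discrete,
    Finset.prod_image fun a _ b _ h => (Prod.mk.inj h).1]
  have hfac : ∀ k ∈ Finset.range n, (PMF.uniformOfFintype (Fin (k + 1))).toMeasure (t (k, k)) =
      ((k + 1 : ℕ) : ENNReal)⁻¹ := by
    intro k hk
    have ht : t (k, k) = {⟨c k, Nat.lt_succ_of_le (hc k (Finset.mem_range.1 hk))⟩} := by
      ext x
      simp [t, Fin.ext_iff]
    rw [ht, PMF.toMeasure_apply_singleton _ _ (.of_discrete), PMF.uniformOfFintype_apply,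
      Fintype.card_fin]
  rw [Finset.prod_congr rfl hfac, one_div, ← Finset.prod_range_add_one_eq_factorial, Nat.cast_prod,
    ENNReal.prod_inv_distrib]
  intro a _ b _ _
  exact Or.inr (ENNReal.natCast_ne_top _)

/-! ### Drawing the labels and assembling the whole program -/

section Program

/-- In iteration k exactly k draws have been made and the bound is k, so the tape is read at (k, k).
The copy precedes the overwriting; if the drawn position is k itself, the copied 0 is overwritten at
once. -/
def shuffleBody : Cmd :=
  .seq (.draw 5 (.reg 4)) (.seq (.nput 2 (.reg 4) (.get 2 (.reg 5)))
    (.nput 2 (.reg 5) (.add (.reg 4) (.const 1))))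

/-- Label the vertices at random. -/
def shuffleLoop : Cmd := forN 4 (.reg 0) shuffleBody

def invertBody : Cmd := .nput 4 (.get 2 (.reg 4)) (.reg 4)

/-- Compute the vertex of each label. -/
def invertLoop : Cmd := forN 4 (.reg 0) invertBody

def labelCmd : Cmd := .seq shuffleLoop invertLoop

end Program

theorem shuffleLoop_spec (ω : Tape) {s : State} (hs : s.draws = 0) (hz : ∀ i, s.narr 2 i = 0) :
    Runs ω shuffleLoop s fun t s' => t ≤ (s.nreg 0 + 1) * (shuffleBody.maxCost + 11) ∧
      ∀ i, s'.narr 2 i = shuffle (fun k => ω (k, k)) (s.nreg 0) i := by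
  refine (Runs.forN (s.nreg 0) shuffleBody.maxCost
    (fun j s' => s'.draws = j ∧ s'.narr 2 = shuffle (fun k => ω (k, k)) j)
    (by decide) ?_ ?_ ?_ ?_).mono ?_
  · intro s' hf
    exact hf.nreg 0 (by decide)
  · intro j s' x h
    exact h
  · exact ⟨hs, funext hz⟩
  · rintro j hj s' hf hj' ⟨h1, h2⟩
    have h3 : (ω (s'.draws, s'.nreg 4) : ℕ) = ω (j, j) := by rw [h1, hj']
    refine Runs.of_loopFree (by decide) fun t ht _ => ⟨ht, ?_, ?_⟩
    · simp [shuffleBody, Cmd.run, h1]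
    · simp [h3, shuffleBody, Cmd.run, h2, hj', NExp.eval, shuffle]
  · rintro t s' ⟨h1, -, h2⟩
    refine ⟨h1, fun i => by rw [h2]⟩

theorem invertLoop_spec (ω : Tape) {N : ℕ} {s : State} (hN : s.nreg 0 = N) {L : Equiv.Perm (Fin N)}
    (hL : HasLabels s L) :
    Runs ω invertLoop s fun t s' => t ≤ (N + 1) * (invertBody.maxCost + 11) ∧ HasInverse s' L := by
  refine (Runs.forN N invertBody.maxCost
    (fun j s' => ∀ i : Fin N, i < j → s'.narr 4 (L i + 1) = i)
    (by decide) ?_ ?_ ?_ ?_).mono ?_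
  · intro s' hf
    exact (hf.nreg 0 (by decide)).trans hN
  · intro j s' x h
    exact h
  · intro i hi
    omega
  · rintro j hj s' hf hj' h
    refine Runs.of_loopFree (by decide) fun t ht _ => ⟨ht, fun i hi => ?_⟩
    have h2 : s'.narr 2 j = L ⟨j, hj⟩ + 1 := by
      rw [hf.narr 2 (by decide)]
      exact hL ⟨j, hj⟩
    by_cases hij : i = ⟨j, hj⟩
    · subst hij
      simp [invertBody, Cmd.run, NExp.eval, hj', h2]
    · have h3 : (L i : ℕ) ≠ L ⟨j, hj⟩ := fun h => hij (L.injective (Fin.ext h))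
      have h4 : (i : ℕ) ≠ j := fun h => hij (Fin.ext h)
      simp only [invertBody, Cmd.run, NExp.eval, hj', h2, Function.update_self]
      rw [Function.update_of_ne (by omega), h i (by omega)]
  · rintro t s' ⟨h1, h2⟩
    refine ⟨h1, fun j => ?_⟩
    have := h2 (L.symm j) (L.symm j).2
    rwa [Equiv.apply_symm_apply] at this

variable {N : ℕ} {Φ : Network N} {ed : Fin Φ.commEdges.card ≃ Φ.commEdges}

theorem env_input : Env Φ ed (input Φ ed) := by
  constructor <;> simp [input]

theorem colorState_input : ColorState Φ ed (input Φ ed) fun _ => 0 := by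
  constructor <;> simp [input, existing]

theorem labelCmd_spec (ω : Tape) :
    Runs ω labelCmd (input Φ ed) fun t s' =>
      t ≤ (N + 1) * (shuffleBody.maxCost + invertBody.maxCost + 22) ∧
      Env Φ ed s' ∧ ColorState Φ ed s' (fun _ => 0) ∧
      ∃ L : Equiv.Perm (Fin N), HasLabels s' L ∧ HasInverse s' L ∧
        ∀ i : Fin N, shuffle (fun k => ω (k, k)) N i = (L i : ℕ) + 1 := by
  have hN : (input Φ ed).nreg 0 = N := rfl
  obtain ⟨L, hL⟩ := exists_perm_shuffle (c := fun k => ω (k, k)) (n := N)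
    fun k _ => Nat.lt_succ_iff.1 (ω (k, k)).2
  apply Runs.seq
  refine (shuffleLoop_spec ω rfl (by simp [input])).mono_frame ?_
  rintro t s' hf ⟨ht, hs'⟩
  rw [hN] at ht hs'
  have he := env_input.frame hf (by decide)
  have hC := colorState_input.frame hf (by decide) (by decide) (by decide) (by decide)
  have hl : HasLabels s' L := fun j => by rw [hs', hL]
  refine (invertLoop_spec ω he.nodes hl).mono_frame ?_
  rintro t' s'' hf' ⟨ht', hi⟩
  refine ⟨?_, he.frame hf' (by decide),
    hC.frame hf' (by decide) (by decide) (by decide) (by decide), L, ?_, hi, hL⟩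
  · have : (N + 1) * (shuffleBody.maxCost + invertBody.maxCost + 22) =
      (N + 1) * (shuffleBody.maxCost + 11) + (N + 1) * (invertBody.maxCost + 11) := by ring
    omega
  · intro j
    rw [hf'.narr 2 (by decide)]
    exact hl j

/-- The program for ConflictFreeLinkSchedule. -/
def scheduleCmd : Cmd := .seq labelCmd mainLoop

theorem scheduleCmd_spec : ∃ c : ℕ, ∀ {N : ℕ} {Φ : Network N}
    {ed : Fin Φ.commEdges.card ≃ Φ.commEdges} (ω : Tape),
    Runs ω scheduleCmd (input Φ ed) fun t s' =>
      ∃ (L : Equiv.Perm (Fin N)) (D : BFSDecomposition Φ.graph), HasLabels s' L ∧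
        (∀ i : Fin N, shuffle (fun k => ω (k, k)) N i = (L i : ℕ) + 1) ∧
        HasColors Φ ed s' (conflictFreeLinkSchedule Φ L D) ∧
        t ≤ c * ((N + Φ.commEdges.card + 2) * (Φ.commEdges.card + 1)) := by
  obtain ⟨c, hc⟩ := mainLoop_spec
  refine ⟨shuffleBody.maxCost + invertBody.maxCost + 22 + c + moreTest.cost, ?_⟩
  intro N Φ ed ω
  apply Runs.seq
  refine (labelCmd_spec ω).mono ?_
  rintro t s' ⟨ht, he, hC, L, hl, hi, hL⟩
  refine (hc ω he hC hi).mono_frame ?_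
  rintro t' s'' hf ⟨D, hD, ht'⟩
  refine ⟨L, D, fun j => ?_, hL, hD, ?_⟩
  · rw [hf.narr 2 (by decide)]
    exact hl j
  · clear hL hD hf hl hi hC he hc
    generalize shuffleBody.maxCost + invertBody.maxCost + 22 = a at *
    generalize moreTest.cost = b at *
    clear ed
    generalize Φ.commEdges.card = e at *
    have h1 : (N + 1) * a ≤ a * ((N + e + 2) * (e + 1)) := by
      rw [mul_comm]
      apply Nat.mul_le_mul_left
      nlinarith
    have h2 : c * (N + e + 2) * e ≤ c * ((N + e + 2) * (e + 1)) := by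
      rw [mul_assoc]
      exact Nat.mul_le_mul_left _ (Nat.mul_le_mul_left _ (by omega))
    have h3 : b ≤ b * ((N + e + 2) * (e + 1)) := Nat.le_mul_of_pos_right _ (by positivity)
    rw [add_mul, add_mul]
    omega

/-! ### The time bound in terms of the thickness -/

theorem Network.two_le_of_commEdges (h : 0 < Φ.commEdges.card) : 2 ≤ N := by
  obtain ⟨x, hx⟩ := Finset.card_pos.1 h
  simp only [Network.commEdges, Finset.mem_filter] at hx
  have h1 : (x.1 : ℕ) ≠ x.2 := fun h => hx.2.1 (Fin.ext h)
  have := x.1.2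
  have := x.2.2
  omega

/-- The product is at most 4ev + 2e². The first term is at most 8ev log v because log v ≥ log 2 >
1/2, the second at most 64evθ by the bound on e. The extra 1 in the constant only keeps it positive
when c = 0. -/
theorem time_le {v e θ c t : ℕ} (hv : 2 ≤ v) (he : 0 < e) (h : e ≤ 32 * v * θ)
    (ht : t ≤ c * ((v + e + 2) * (e + 1))) :
    (t : ℝ) ≤ (64 * c + 1 : ℝ) * ((e : ℝ) * v * Real.log v + (e : ℝ) * v * θ) := by
  have hv' : (2 : ℝ) ≤ v := by exact_mod_cast hv
  have he' : (1 : ℝ) ≤ e := by exact_mod_cast he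
  have hθ : (e : ℝ) ≤ 32 * v * θ := by exact_mod_cast h
  have hlog : (1 / 2 : ℝ) ≤ Real.log v := by
    have := Real.log_two_gt_d9
    have := Real.log_le_log (by norm_num) hv'
    linarith
  have ht' : (t : ℝ) ≤ c * ((v + e + 2) * (e + 1)) := by exact_mod_cast ht
  have hev : (0 : ℝ) ≤ e * v := by positivity
  have h1 : ((v : ℝ) + e + 2) * (e + 1) ≤ 2 * e * (2 * v + e) := by
    nlinarith [mul_nonneg (sub_nonneg.2 he') (sub_nonneg.2 hv')]
  have h2 : (2 : ℝ) * e * (2 * v + e) ≤ 8 * (e * v * Real.log v) + 64 * (e * v * θ) := by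
    have h3 : (e : ℝ) * v * (1 / 2) ≤ e * v * Real.log v := mul_le_mul_of_nonneg_left hlog hev
    have h4 : (e : ℝ) * e ≤ e * (32 * v * θ) := mul_le_mul_of_nonneg_left hθ (by linarith)
    linarith
  have hA : (0 : ℝ) ≤ e * v * Real.log v := mul_nonneg hev (by linarith)
  have hB : (0 : ℝ) ≤ e * v * θ := by positivity
  calc (t : ℝ) ≤ c * ((v + e + 2) * (e + 1)) := ht'
    _ ≤ c * (64 * (e * v * Real.log v + e * v * θ)) :=
      mul_le_mul_of_nonneg_left (by linarith) (by positivity)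
    _ ≤ _ := by nlinarith

end STDMA
end

theorem mainTheorem1 :
    ∃ (prog : Cmd) (c : ℝ), 0 < c ∧
      ∀ (v : ℕ) (Φ : Network v) (ed : Fin Φ.commEdges.card ≃ Φ.commEdges),
        0 < Φ.commEdges.card →
        (∀ ω : Tape, ∃ (t : ℕ) (s : State) (L : Equiv.Perm (Fin v))
            (D : BFSDecomposition Φ.graph),
          Exec ω prog (input Φ ed) t s ∧
          HasLabels s L ∧
          HasColors Φ ed s (conflictFreeLinkSchedule Φ L D) ∧
          (t : ℝ) ≤ c * ((Φ.commEdges.card : ℝ) * v * Real.log v +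
            (Φ.commEdges.card : ℝ) * v * thickness Φ.graph)) ∧
        ∀ L : Equiv.Perm (Fin v),
          tapeMeasure {ω | ∃ t s, Exec ω prog (input Φ ed) t s ∧ HasLabels s L} =
            1 / (v.factorial : ENNReal) := by
  obtain ⟨c, hc⟩ := scheduleCmd_spec
  refine ⟨scheduleCmd, 64 * c + 1, by positivity, fun v Φ ed he => ⟨fun ω => ?_, fun L => ?_⟩⟩
  · obtain ⟨t, s, hex, L, D, hl, -, hD, ht⟩ := hc (Φ := Φ) (ed := ed) ω
    exact ⟨t, s, L, D, hex, hl, hD,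
      time_le (Network.two_le_of_commEdges he) he Φ.card_commEdges_le ht⟩
  · obtain ⟨a, ha, haL⟩ := exists_shuffle_eq L
    -- By uniqueness of the execution and reversibility of the shuffle, the labelling `L` appears
    -- exactly for the tapes whose draws are the choices `a`.
    rw [← tapeMeasure_cylinder ha]
    congr 1
    ext ω
    have hω : ∀ k < v, (ω (k, k) : ℕ) ≤ k := fun k _ => Nat.lt_succ_iff.1 (ω (k, k)).2
    obtain ⟨t, s, hex, L', D, hl, hL', -⟩ := hc (Φ := Φ) (ed := ed) ω
    constructor
    · rintro ⟨t', s', hex', hl'⟩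
      obtain ⟨-, rfl⟩ := hex.unique hex'
      refine eq_of_shuffle_eq hω ha fun i hi => ?_
      rw [hL' ⟨i, hi⟩, haL ⟨i, hi⟩, ← hl ⟨i, hi⟩, hl' ⟨i, hi⟩]
    · intro h
      have hLL : L' = L := by
        ext i
        have h1 := hL' i
        have h2 := haL i
        have h3 : shuffle (fun k => ω (k, k)) v = shuffle a v := shuffle_congr h
        rw [h3] at h1
        omega
      exact ⟨t, s, hex, hLL ▸ hl⟩
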